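/- Let $S$ be a compact connected Riemann surface and let $\phi$ be a GMN differential on $S$, that is, a meromorphic quadratic differential with no zero of order $>1$, with at least one pole, and with at least one simple zero or simple pole. Let $\mathcal P$ be the uniformizing projective structure on $S^*=S\setminus\operatorname{Pol}(\phi)$, the complement of all poles of $\phi$: its charts are the local sections of the holomorphic universal covering of $S^*$ by the unit disk, $\mathbb C$ or $\mathbb P^1$, together with all holomorphic charts (locally) projectively compatible with these. Let $\mathcal P_\phi=\mathcal P+\phi$ be the projective structure on $S^*$ whose charts are locally the ratios of two linearly independent solutions of $y''(z)=\varphi(z)y(z)$, where $z$ is a chart of $\mathcal P$ and $\phi=\varphi(z)\,dz^{\otimes 2}$. Let $p$ be a pole of $\phi$ of order two, and let $\operatorname{Res}_p(\phi)=\pm4\pi i\sqrt r$, where $r\ne 0$ is the leading coefficient of $\phi$ at $p$, i.e. $\phi=(r z^{-2}+O(z^{-1}))\,dz^{\otimes2}$ in a local coordinate $z$ with $z(p)=0$. Then the monodromy of $\mathcal P_\phi$ around $p$ has eigenvalues $$\lambda_\pm=-\exp\left(\pm\operatorname{Res}_p(\phi)/2\right).$$ Precisely: let $z$ be any local holomorphic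 coordinate on $S$ with $z(p)=0$, and let $Q(z)\,dz^{\otimes2}$ be the polar differential of $\mathcal P_\phi$ with respect to $z$, i.e. $Q=-\tfrac12\big((w''/w')'-\tfrac12(w''/w')^2\big)$ for the charts $w$ of $\mathcal P_\phi$ regarded as functions of $z$. Then for all sufficiently small $\rho>0$: 1. the space of multivalued holomorphic solutions of $y''(z)=Q(z)y(z)$ on $0<|z|<\rho$ (that is, of solutions on the universal cover) is two-dimensional, and analytic continuation once counterclockwise around $z=0$ acts on it with characteristic polynomial $(X-\lambda_+)(X-\lambda_-)$; 2. $\mathcal P_\phi$ has a developing map on the universal cover of $\{0<|z|<\rho\}$, and for every such developing map $F$ there is a matrix $M\in GL_2(\mathbb C)$ with characteristic polynomial $(X-\lambda_+)(X-\lambda_-)$ such that $F\circ\gamma=M\cdot F$, where $\gamma$ is the deck transformation of the counterclockwise loop. -/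

import Mathlib

open Set Filter Topology
open scoped Manifold ContDiff

noncomputable section

/-! ### Meromorphic quadratic differentials on a Riemann surface

A Riemann surface is a Hausdorff space `S` with `[ChartedSpace ℂ S] [IsManifold 𝓘(ℂ) ω S]`; its
local holomorphic coordinates are the members of `IsManifold.maximalAtlas 𝓘(ℂ) ω S`. -/

/-- A meromorphic quadratic differential on `S`: in each local coordinate `z = e` it is
`coeff e (z) dz ⊗ dz`, with the usual transformation law.  The coefficients are meromorphic
functions in normal form, which means that they take the value `0` at a pole and are analytic at
every other point. (The values of `coeff` outside the maximal atlas, or outside the target of the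
coordinate, carry no information.) -/
structure MeromorphicQuadraticDifferential (S : Type*) [TopologicalSpace S] [ChartedSpace ℂ S] where
  coeff : OpenPartialHomeomorph S ℂ → ℂ → ℂ
  meromorphic : ∀ e ∈ IsManifold.maximalAtlas 𝓘(ℂ) ω S, MeromorphicNFOn (coeff e) e.target
  transform : ∀ e ∈ IsManifold.maximalAtlas 𝓘(ℂ) ω S, ∀ e' ∈ IsManifold.maximalAtlas 𝓘(ℂ) ω S,
    ∀ x ∈ e.source ∩ e'.source,
      coeff e (e x) = coeff e' (e' x) * deriv (fun u => e' (e.symm u)) (e x) ^ 2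

namespace MeromorphicQuadraticDifferential

variable {S : Type*} [TopologicalSpace S] [ChartedSpace ℂ S]

/-- The order of vanishing at `p`: negative at a pole, `⊤` where the differential is identically
zero near `p`. -/
def order (φ : MeromorphicQuadraticDifferential S) (p : S) : WithTop ℤ :=
  meromorphicOrderAt (φ.coeff (chartAt ℂ p)) (chartAt ℂ p p)

/-- The set of poles. -/
def poles (φ : MeromorphicQuadraticDifferential S) : Set S := {p | φ.order p < 0}

/-- A GMN differential: no zero of order `> 1` (so it is not identically zero either), at least
one pole, and at least one finite critical point (a simple zero or a simple pole). -/
structure IsGMN (φ : MeromorphicQuadraticDifferential S) : Prop where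
  zeros_simple : ∀ p, φ.order p ≤ 1
  exists_pole : ∃ p, φ.order p < 0
  exists_finite_critical : ∃ p, φ.order p = 1 ∨ φ.order p = ((-1 : ℤ) : WithTop ℤ)

/-- `R` is one of the two values `± 4 π i √r` of the residue of `φ` at a pole `p` of order two:
here `r = s ^ 2` is the leading coefficient, `φ = (r / z ^ 2 + ⋯) dz ⊗ dz`, in some local
coordinate `z = e` centred at `p` (such as one in which `φ` is exactly `r / z ^ 2 dz ⊗ dz`). -/
def IsResidue (φ : MeromorphicQuadraticDifferential S) (p : S) (R : ℂ) : Prop :=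
  ∃ e ∈ IsManifold.maximalAtlas 𝓘(ℂ) ω S, p ∈ e.source ∧ e p = 0 ∧
    ∃ s : ℂ, R = 4 * Real.pi * Complex.I * s ∧
      Tendsto (fun u => u ^ 2 * φ.coeff e u) (𝓝[≠] 0) (𝓝 (s ^ 2))

end MeromorphicQuadraticDifferential

/-! ### Projective structures

The projective line is `OnePoint ℂ`, on which `GL (Fin 2) ℂ` acts by Möbius transformations. -/

section Projective

variable {S : Type*} [TopologicalSpace S] [ChartedSpace ℂ S]

/-- The point `[a : b]` of the projective line. -/
def projPoint (a b : ℂ) : OnePoint ℂ := if b = 0 then OnePoint.infty else ((a / b : ℂ) : OnePoint ℂ)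

/-- A map to the projective line is holomorphic at `u` if, after a Möbius transformation, it is
an ordinary holomorphic function near `u`. -/
def HolomorphicToP1At (f : ℂ → OnePoint ℂ) (u : ℂ) : Prop :=
  ∃ (g : GL (Fin 2) ℂ) (h : ℂ → ℂ), AnalyticAt ℂ h u ∧
    ∀ᶠ v in 𝓝 u, f v = g • ((h v : ℂ) : OnePoint ℂ)

/-- A homeomorphism from an open subset of `S` onto an open subset of the projective line is a
chart if it is holomorphic (its inverse is then holomorphic as well). -/
def IsP1Chart (w : OpenPartialHomeomorph S (OnePoint ℂ)) : Prop :=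
  ∀ x ∈ w.source, HolomorphicToP1At (fun u => w ((chartAt ℂ x).symm u)) (chartAt ℂ x x)

/-- Projective compatibility: the transition map is, near each point, the restriction of an
element of `PGL₂(ℂ)`. -/
def ProjectivelyCompatible (w w' : OpenPartialHomeomorph S (OnePoint ℂ)) : Prop :=
  ∀ x ∈ w.source ∩ w'.source, ∃ g : GL (Fin 2) ℂ, ∀ᶠ y in 𝓝 x, w' y = g • w y

/-- A projective structure on the open subset `U` of the Riemann surface `S`: a maximal collection
of projectively compatible charts with domains in `U` which cover `U`. -/
structure ProjectiveStructure (U : Set S) where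
  charts : Set (OpenPartialHomeomorph S (OnePoint ℂ))
  isP1Chart : ∀ w ∈ charts, IsP1Chart w
  source_subset : ∀ w ∈ charts, w.source ⊆ U
  cover : ∀ x ∈ U, ∃ w ∈ charts, x ∈ w.source
  compatible : ∀ w ∈ charts, ∀ w' ∈ charts, ProjectivelyCompatible w w'
  maximal : ∀ w : OpenPartialHomeomorph S (OnePoint ℂ), IsP1Chart w → w.source ⊆ U →
    (∀ w' ∈ charts, ProjectivelyCompatible w w') → w ∈ charts

/-- `P` is the uniformizing projective structure of `U`: there is a universal covering `π` of `U`
by the unit disk, the complex plane or the Riemann sphere, all of whose local sections are charts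
of `P`.  (Charts being holomorphic, `π` is holomorphic.) -/
def ProjectiveStructure.IsUniformizing {U : Set S} (P : ProjectiveStructure U) : Prop :=
  ∃ Ω : Set (OnePoint ℂ),
    (Ω = (fun z : ℂ => (z : OnePoint ℂ)) '' Metric.ball 0 1 ∨
      Ω = range (fun z : ℂ => (z : OnePoint ℂ)) ∨ Ω = univ) ∧
    ∃ π : Ω → S, range π = U ∧ IsCoveringMapOn π U ∧
      ∀ w : OpenPartialHomeomorph S (OnePoint ℂ), w.source ⊆ U →
        (∀ x ∈ w.source, ∃ hx : w x ∈ Ω, π ⟨w x, hx⟩ = x) → w ∈ P.charts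

/-- `y` is a holomorphic solution of `y'' = Q y` near `u`. -/
def IsSolutionAt (Q y : ℂ → ℂ) (u : ℂ) : Prop :=
  AnalyticAt ℂ y u ∧ ∀ᶠ v in 𝓝 u, deriv (deriv y) v = Q v * y v

/-- The charts of the projective structure `P + φ`: those charts which are locally the ratio of two
linearly independent solutions (that is, with non-zero Wronskian) of `y''(z) = φ(z) y(z)`, where `z`
is a complex valued local chart of `P` and `φ = φ(z) dz ⊗ dz`. -/
def ProjectiveStructure.addCharts {U : Set S} (P : ProjectiveStructure U)
    (φ : MeromorphicQuadraticDifferential S) : Set (OpenPartialHomeomorph S (OnePoint ℂ)) :=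
  {w | IsP1Chart w ∧ w.source ⊆ U ∧ ∀ x ∈ w.source,
    ∃ z ∈ IsManifold.maximalAtlas 𝓘(ℂ) ω S, x ∈ z.source ∧
      (∃ c ∈ P.charts, x ∈ c.source ∧ ∀ᶠ y in 𝓝 x, c y = ((z y : ℂ) : OnePoint ℂ)) ∧
      ∃ y₁ y₂ : ℂ → ℂ, IsSolutionAt (φ.coeff z) y₁ (z x) ∧ IsSolutionAt (φ.coeff z) y₂ (z x) ∧
        deriv y₁ (z x) * y₂ (z x) - y₁ (z x) * deriv y₂ (z x) ≠ 0 ∧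
        ∀ᶠ y in 𝓝 x, w y = projPoint (y₁ (z y)) (y₂ (z y))}

/-- The Schwarzian derivative `(f'' / f')' - (f'' / f')² / 2`. -/
def schwarzian (f : ℂ → ℂ) (u : ℂ) : ℂ :=
  deriv (fun v => deriv (deriv f) v / deriv f v) u - (deriv (deriv f) u / deriv f u) ^ 2 / 2

/-- The coefficient, in the local coordinate `z = e`, of the difference between the projective
structure with charts `A` and the projective structure having `e` as a chart, namely
`- (1/2)` times the Schwarzian derivative with respect to `z` of a chart in `A` (any one with a
finite value at the given point; the choice is immaterial by Möbius invariance). For the charts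
`A` of a meromorphic projective structure this is its polar differential in the coordinate `z`. -/
def polarCoeff (A : Set (OpenPartialHomeomorph S (OnePoint ℂ))) (e : OpenPartialHomeomorph S ℂ)
    (u : ℂ) : ℂ :=
  open Classical in
  if h : ∃ w ∈ A, e.symm u ∈ w.source ∧ w (e.symm u) ≠ OnePoint.infty then
    -(1 / 2) * schwarzian (fun v => (h.choose (e.symm v)).elim 0 id) u
  else 0

end Projective

/-! ### Monodromy around a puncture

The universal cover of the punctured disk `0 < |z| < r` is the half-plane `Re ζ < log r`, with
covering map `z = exp ζ`; the counterclockwise loop acts on it by `ζ ↦ ζ + 2πi`. -/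

/-- The universal cover of the punctured disk of radius `r`. -/
abbrev PuncturedDiskCover (r : ℝ) : Type := {ζ : ℂ // ζ.re < Real.log r}

/-- The deck transformation of the counterclockwise loop. -/
def PuncturedDiskCover.shift {r : ℝ} (ζ : PuncturedDiskCover r) : PuncturedDiskCover r :=
  ⟨ζ.1 + 2 * Real.pi * Complex.I, by simpa using ζ.2⟩

lemma PuncturedDiskCover.continuous_shift {r : ℝ} :
    Continuous (PuncturedDiskCover.shift (r := r)) := by
  unfold PuncturedDiskCover.shift
  fun_prop

lemma PuncturedDiskCover.exp_shift {r : ℝ} (ζ : PuncturedDiskCover r) :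
    Complex.exp ζ.shift.1 = Complex.exp ζ.1 :=
  Complex.exp_periodic ζ.1

/-- The space of (multi-valued) solutions of `y'' = Q y` on the punctured disk of radius `r`,
regarded as functions on its universal cover. -/
def solutionSpace (Q : ℂ → ℂ) (r : ℝ) : Submodule ℂ (PuncturedDiskCover r → ℂ) where
  carrier := {Y | ∀ ζ₀ : PuncturedDiskCover r, ∃ y : ℂ → ℂ, IsSolutionAt Q y (Complex.exp ζ₀.1) ∧
    ∀ᶠ ζ in 𝓝 ζ₀, Y ζ = y (Complex.exp ζ.1)}
  zero_mem' := fun ζ₀ => ⟨fun _ => 0, ⟨analyticAt_const, by simp⟩, by simp⟩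
  add_mem' := by
    intro Y₁ Y₂ h₁ h₂ ζ₀
    obtain ⟨y₁, ⟨ha₁, he₁⟩, hY₁⟩ := h₁ ζ₀
    obtain ⟨y₂, ⟨ha₂, he₂⟩, hY₂⟩ := h₂ ζ₀
    refine ⟨y₁ + y₂, ⟨ha₁.add ha₂, ?_⟩, ?_⟩
    · filter_upwards [he₁, he₂, ha₁.eventually_analyticAt.eventually_nhds,
        ha₂.eventually_analyticAt.eventually_nhds] with v e₁ e₂ a₁ a₂
      have hd : deriv (y₁ + y₂) =ᶠ[𝓝 v] deriv y₁ + deriv y₂ := by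
        filter_upwards [a₁, a₂] with x b₁ b₂
        exact deriv_add b₁.differentiableAt b₂.differentiableAt
      rw [hd.deriv_eq, deriv_add a₁.self_of_nhds.deriv.differentiableAt
        a₂.self_of_nhds.deriv.differentiableAt, e₁, e₂, Pi.add_apply, mul_add]
    · filter_upwards [hY₁, hY₂] with ζ k₁ k₂
      simp [k₁, k₂]
  smul_mem' := by
    intro c Y h ζ₀
    obtain ⟨y, ⟨ha, he⟩, hY⟩ := h ζ₀
    refine ⟨fun v => c * y v, ⟨analyticAt_const.mul ha, ?_⟩, ?_⟩
    · filter_upwards [he] with v e₁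
      simp only [deriv_const_mul_field', e₁]
      ring
    · filter_upwards [hY] with ζ k
      simp [k]

/-- The monodromy operator of `y'' = Q y` around the puncture: analytic continuation of solutions
along the counterclockwise loop. -/
def monodromy (Q : ℂ → ℂ) (r : ℝ) : solutionSpace Q r →ₗ[ℂ] solutionSpace Q r where
  toFun Y := ⟨fun ζ => Y.1 ζ.shift, by
    intro ζ₀
    obtain ⟨y, hy, hY⟩ := Y.2 ζ₀.shift
    refine ⟨y, by rwa [PuncturedDiskCover.exp_shift] at hy, ?_⟩
    filter_upwards [PuncturedDiskCover.continuous_shift.continuousAt.eventually hY] with ζ h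
    rw [h, PuncturedDiskCover.exp_shift]⟩
  map_add' _ _ := rfl
  map_smul' _ _ := rfl

/-- `F` is a developing map, on the universal cover of the punctured disk `0 < |z| < r` of the local
coordinate `z = e`, of the projective structure with charts `A`. -/
def IsDevelopingMap {S : Type*} [TopologicalSpace S]
    (A : Set (OpenPartialHomeomorph S (OnePoint ℂ))) (e : OpenPartialHomeomorph S ℂ) (r : ℝ)
    (F : PuncturedDiskCover r → OnePoint ℂ) : Prop :=
  ∀ ζ₀ : PuncturedDiskCover r, ∃ w ∈ A, e.symm (Complex.exp ζ₀.1) ∈ w.source ∧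
    ∀ᶠ ζ in 𝓝 ζ₀, F ζ = w (e.symm (Complex.exp ζ.1))

end

/-! ### Calculus of the Schwarzian derivative -/

/-! Parametrize the punctured coordinate disk by the half-plane `Re ζ < log r` through `z = exp ζ`,
and lift this parametrization through the uniformizing covering to a map `g` into the covering
domain. The cocycle rule for the Schwarzian `S` shows that the polar coefficient `Q` of `P + φ`
satisfies `z² Q = B - 1/4`, where `B (exp ζ) = exp (2ζ) φ (exp ζ) - S(g)(ζ) / 2` and the `1/4` comes
from the Schwarzian of the logarithm. The crux is that the uniformizing structure does not disturb
the leading coefficient: `S(g) → 0` as `Re ζ → -∞`. Then `B` extends holomorphically to `0` with `B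
0 = s²`, the leading coefficient of `φ` (`exists_analyticAt_coeff`).

Uniqueness of lifts makes `g` either injective or periodic with period `2πi n`, `n > 0`
(`exists_lift_exp`). If `g` is injective, a Kraus–Nehari type bound `|S(g)(ζ)| ≤ 66 / (log r - Re
ζ)²` (`norm_schwarzian_le_of_injOn`), derived from a crude area theorem, gives the decay.
Periodicity is impossible because `g` leaves every compact subset of the covering domain near the
puncture. Over the disk, a periodic `g` would extend across the puncture with a value of modulus one
and violate the maximum principle. Over the plane, `1/g` would extend across the puncture with value
`0`; since `φ` pulls back to `f(w) dw²` with `f` entire and the limit at the double pole is nonzero,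
`f` would tend to zero at infinity, hence vanish by Liouville, a contradiction. The sphere is
excluded because its image would be compact and therefore contain `p`.

The substitution `y = exp (ζ/2) X` turns `y'' = Q y` into `X'' = B (exp ζ) X`, with exponents `±s`.
For the exponent `a` with nonnegative real part, Frobenius' method gives a zero-free `X = exp (aζ) h
(exp ζ)`; a second solution is `X Φ` with `Φ' = X⁻²`. Under `ζ ↦ ζ + 2πi` one has `X ↦ μ X` and `Φ ↦
μ⁻² Φ + c` with `μ = exp (2πi a)`, while `exp (ζ/2)` changes sign. So the monodromy is triangular
with diagonal entries `-μ` and `-μ⁻¹`; a possible logarithm is absorbed in `c`.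

Finally `Φ` is a ratio of solutions with the correct Schwarzian, hence a developing map
(`isDevelopingMap`). Any other one is locally, and by connectedness globally, a Möbius transform of
`Φ` (`exists_eq_smul`), so its monodromy is conjugate to that of `Φ`. -/

lemma schwarzian_congr {f g : ℂ → ℂ} {u : ℂ} (h : f =ᶠ[𝓝 u] g) : schwarzian f u = schwarzian g u := by
  have h1 : deriv f =ᶠ[𝓝 u] deriv g := h.deriv
  have h2 : deriv (deriv f) =ᶠ[𝓝 u] deriv (deriv g) := h1.deriv
  have h3 : (fun v => deriv (deriv f) v / deriv f v) =ᶠ[𝓝 u]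
      (fun v => deriv (deriv g) v / deriv g v) := by
    filter_upwards [h1, h2] with v e1 e2
    rw [e1, e2]
  unfold schwarzian
  rw [h3.deriv_eq, h1.eq_of_nhds, h2.eq_of_nhds]

lemma schwarzian_eq {f : ℂ → ℂ} {u : ℂ} (hf : AnalyticAt ℂ f u) (h : deriv f u ≠ 0) :
    schwarzian f u = deriv (deriv (deriv f)) u / deriv f u
      - 3 / 2 * (deriv (deriv f) u / deriv f u) ^ 2 := by
  unfold schwarzian
  rw [deriv_fun_div hf.deriv.deriv.differentiableAt hf.deriv.differentiableAt h]
  field_simp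
  ring

lemma AnalyticAt.eventually_deriv_comp {f g : ℂ → ℂ} {u : ℂ} (hf : AnalyticAt ℂ f (g u))
    (hg : AnalyticAt ℂ g u) :
    deriv (fun v => f (g v)) =ᶠ[𝓝 u] fun v => deriv f (g v) * deriv g v := by
  filter_upwards [hg.continuousAt.eventually hf.eventually_analyticAt,
    hg.eventually_analyticAt] with v h1 h2
  exact (h1.differentiableAt.hasDerivAt.comp v h2.differentiableAt.hasDerivAt).deriv

lemma schwarzian_comp {f g : ℂ → ℂ} {u : ℂ} (hf : AnalyticAt ℂ f (g u)) (hg : AnalyticAt ℂ g u)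
    (hf' : deriv f (g u) ≠ 0) (hg' : deriv g u ≠ 0) :
    schwarzian (fun v => f (g v)) u = schwarzian f (g u) * deriv g u ^ 2 + schwarzian g u := by
  have hc : AnalyticAt ℂ (fun v => f (g v)) u := hf.comp hg
  have d1 := hf.eventually_deriv_comp hg
  have d2 : deriv (deriv (fun v => f (g v))) =ᶠ[𝓝 u] fun v =>
      deriv (deriv f) (g v) * deriv g v ^ 2 + deriv f (g v) * deriv (deriv g) v := by
    refine d1.deriv.trans ?_
    filter_upwards [hg.continuousAt.eventually hf.eventually_analyticAt,
      hg.eventually_analyticAt] with v h1 h2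
    have e1 := h1.deriv.differentiableAt.hasDerivAt.comp v h2.differentiableAt.hasDerivAt
    have e2 := e1.mul h2.deriv.differentiableAt.hasDerivAt
    refine e2.deriv.trans ?_
    simp only [Function.comp_apply]
    ring
  have d3 : deriv (deriv (deriv (fun v => f (g v)))) u =
      deriv (deriv (deriv f)) (g u) * deriv g u ^ 3
        + 3 * deriv (deriv f) (g u) * deriv g u * deriv (deriv g) u
        + deriv f (g u) * deriv (deriv (deriv g)) u := by
    rw [d2.deriv_eq]
    have e0 := hg.differentiableAt.hasDerivAt
    have e1 := hf.deriv.differentiableAt.hasDerivAt.comp u e0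
    have e2 := hf.deriv.deriv.differentiableAt.hasDerivAt.comp u e0
    have g1 := hg.deriv.differentiableAt.hasDerivAt
    have g2 := hg.deriv.deriv.differentiableAt.hasDerivAt
    refine ((e2.mul (g1.pow 2)).add (e1.mul g2)).deriv.trans ?_
    simp only [Function.comp_apply, Pi.pow_apply]
    push_cast
    ring
  have d1' := d1.eq_of_nhds
  have d2' := d2.eq_of_nhds
  rw [schwarzian_eq hc (by rw [d1']; exact mul_ne_zero hf' hg'), schwarzian_eq hf hf',
    schwarzian_eq hg hg', d3, d2', d1']
  field_simp
  ring

lemma IsSolutionAt.eventually {Q y : ℂ → ℂ} {u : ℂ} (h : IsSolutionAt Q y u) :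
    ∀ᶠ v in 𝓝 u, IsSolutionAt Q y v :=
  h.1.eventually_analyticAt.and h.2.eventually_nhds

/-- The Wronskian `y₁' y₂ - y₁ y₂'`. -/
noncomputable def wronskian (y₁ y₂ : ℂ → ℂ) (u : ℂ) : ℂ := deriv y₁ u * y₂ u - y₁ u * deriv y₂ u

lemma IsSolutionAt.hasDerivAt_wronskian {Q y₁ y₂ : ℂ → ℂ} {u : ℂ} (h₁ : IsSolutionAt Q y₁ u)
    (h₂ : IsSolutionAt Q y₂ u) : HasDerivAt (wronskian y₁ y₂) 0 u := by
  have a1 := h₁.1.differentiableAt.hasDerivAt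
  have a2 := h₂.1.differentiableAt.hasDerivAt
  have b1 := h₁.1.deriv.differentiableAt.hasDerivAt
  have b2 := h₂.1.deriv.differentiableAt.hasDerivAt
  rw [h₁.2.self_of_nhds] at b1
  rw [h₂.2.self_of_nhds] at b2
  exact ((b1.mul a2).sub (a1.mul b2)).congr_deriv (by ring)

lemma eventually_eq_const_of_hasDerivAt_zero {f : ℂ → ℂ} {u : ℂ}
    (h : ∀ᶠ v in 𝓝 u, HasDerivAt f 0 v) : ∀ᶠ v in 𝓝 u, f v = f u := by
  obtain ⟨ε, hε, hb⟩ := Metric.eventually_nhds_iff_ball.1 h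
  filter_upwards [Metric.ball_mem_nhds u hε] with v hv
  exact (Metric.isOpen_ball).is_const_of_deriv_eq_zero (convex_ball u ε).isPreconnected
    (fun x hx => (hb x hx).differentiableAt.differentiableWithinAt)
    (fun x hx => (hb x hx).deriv) hv (Metric.mem_ball_self hε)

lemma IsSolutionAt.eventually_wronskian_eq {Q y₁ y₂ : ℂ → ℂ} {u : ℂ} (h₁ : IsSolutionAt Q y₁ u)
    (h₂ : IsSolutionAt Q y₂ u) : ∀ᶠ v in 𝓝 u, wronskian y₁ y₂ v = wronskian y₁ y₂ u :=
  eventually_eq_const_of_hasDerivAt_zero <| by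
    filter_upwards [h₁.eventually, h₂.eventually] with v k₁ k₂
    exact k₁.hasDerivAt_wronskian k₂

lemma hasDerivAt_div_wronskian {y₁ y₂ : ℂ → ℂ} {u : ℂ} (h₁ : AnalyticAt ℂ y₁ u)
    (h₂ : AnalyticAt ℂ y₂ u) (h : y₂ u ≠ 0) :
    HasDerivAt (fun v => y₁ v / y₂ v) (wronskian y₁ y₂ u / y₂ u ^ 2) u :=
  h₁.differentiableAt.hasDerivAt.div h₂.differentiableAt.hasDerivAt h

/-- The Wronskian `W` is constant, so `(y₁ / y₂)' = W / y₂²`; its logarithmic derivative is `-2 y₂'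
/ y₂`, and the equation for `y₂` finishes the computation. -/
lemma schwarzian_div_of_isSolutionAt {Q y₁ y₂ : ℂ → ℂ} {u : ℂ} (h₁ : IsSolutionAt Q y₁ u)
    (h₂ : IsSolutionAt Q y₂ u) (h : y₂ u ≠ 0) (hW : wronskian y₁ y₂ u ≠ 0) :
    schwarzian (fun v => y₁ v / y₂ v) u = -2 * Q u := by
  have hne : ∀ᶠ v in 𝓝 u, y₂ v ≠ 0 := h₂.1.continuousAt.eventually_ne h
  have d1 : deriv (fun v => y₁ v / y₂ v) =ᶠ[𝓝 u] fun v => wronskian y₁ y₂ u / y₂ v ^ 2 := by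
    filter_upwards [h₁.eventually, h₂.eventually, hne, h₁.eventually_wronskian_eq h₂]
      with v k₁ k₂ k hw
    rw [(hasDerivAt_div_wronskian k₁.1 k₂.1 k).deriv, hw]
  have d2 : deriv (deriv (fun v => y₁ v / y₂ v)) =ᶠ[𝓝 u]
      fun v => -2 * wronskian y₁ y₂ u * deriv y₂ v / y₂ v ^ 3 := by
    refine d1.deriv.trans ?_
    filter_upwards [h₂.eventually, hne] with v k₂ k
    have := ((hasDerivAt_const v (wronskian y₁ y₂ u)).div
      (k₂.1.differentiableAt.hasDerivAt.pow 2) (pow_ne_zero 2 k))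
    refine this.deriv.trans ?_
    simp only [Pi.pow_apply]
    field_simp
    push_cast
    ring
  have d3 : (fun v => deriv (deriv (fun v => y₁ v / y₂ v)) v / deriv (fun v => y₁ v / y₂ v) v)
      =ᶠ[𝓝 u] fun v => -2 * (deriv y₂ v / y₂ v) := by
    filter_upwards [d1, d2, hne] with v e1 e2 k
    rw [e1, e2]
    field_simp
  have d4 : HasDerivAt (fun v => -2 * (deriv y₂ v / y₂ v))
      (-2 * ((Q u * y₂ u * y₂ u - deriv y₂ u * deriv y₂ u) / y₂ u ^ 2)) u := by
    have b2 := h₂.1.deriv.differentiableAt.hasDerivAt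
    rw [h₂.2.self_of_nhds] at b2
    exact (b2.div h₂.1.differentiableAt.hasDerivAt h).const_mul (-2)
  unfold schwarzian
  rw [d3.deriv_eq, d4.deriv]
  have d3' := d3.eq_of_nhds
  rw [d3']
  field_simp
  ring

lemma deriv_div_ne_zero_of_isSolutionAt {Q y₁ y₂ : ℂ → ℂ} {u : ℂ} (h₁ : IsSolutionAt Q y₁ u)
    (h₂ : IsSolutionAt Q y₂ u) (h : y₂ u ≠ 0) (hW : wronskian y₁ y₂ u ≠ 0) :
    deriv (fun v => y₁ v / y₂ v) u ≠ 0 := by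
  rw [(hasDerivAt_div_wronskian h₁.1 h₂.1 h).deriv]
  exact div_ne_zero hW (pow_ne_zero 2 h)

/-- A locally injective solution of the Schwarzian equation `S f = -2 q` is a ratio of two
solutions of the linear equation `y'' = q y`. -/
lemma exists_isSolutionAt_of_schwarzian {f q : ℂ → ℂ} {u : ℂ} (hf : AnalyticAt ℂ f u)
    (hf' : deriv f u ≠ 0) (hq : ∀ᶠ v in 𝓝 u, schwarzian f v = -2 * q v) :
    ∃ y₁ y₂ : ℂ → ℂ, IsSolutionAt q y₁ u ∧ IsSolutionAt q y₂ u ∧ wronskian y₁ y₂ u ≠ 0 ∧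
      ∀ᶠ v in 𝓝 u, y₂ v ≠ 0 ∧ f v = y₁ v / y₂ v := by
  -- A branch of `(f' / f' u)^(-1/2)`. Dividing by `f' u` places the argument of the logarithm at
  -- `1`. The two solutions will be `f y` and `y`.
  set y : ℂ → ℂ := fun v => Complex.exp (-(1 / 2) * Complex.log (deriv f v / deriv f u)) with hy
  have hslit : ∀ᶠ v in 𝓝 u, deriv f v / deriv f u ∈ Complex.slitPlane := by
    have hc : ContinuousAt (fun v => deriv f v / deriv f u) u :=
      hf.deriv.continuousAt.div_const _
    refine hc.eventually (Complex.isOpen_slitPlane.mem_nhds ?_)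
    simp only [div_self hf']
    exact Complex.one_mem_slitPlane
  have hne : ∀ᶠ v in 𝓝 u, deriv f v ≠ 0 := hf.deriv.continuousAt.eventually_ne hf'
  have hyne : ∀ v, y v ≠ 0 := fun v => Complex.exp_ne_zero _
  have hfa := hf.eventually_analyticAt
  have hyan : ∀ᶠ v in 𝓝 u, AnalyticAt ℂ y v := by
    filter_upwards [hslit, hfa] with v h1 h2
    exact (analyticAt_const.mul ((h2.deriv.div_const).clog h1)).cexp
  have d1 : ∀ᶠ v in 𝓝 u, HasDerivAt y (-(1 / 2) * (deriv (deriv f) v / deriv f v) * y v) v := by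
    filter_upwards [hslit, hfa, hne] with v h1 h2 h3
    have := (((h2.deriv.differentiableAt.hasDerivAt.div_const (deriv f u)).clog h1).const_mul
      (-(1 / 2))).cexp
    refine this.congr_deriv ?_
    simp only [hy]
    field_simp
  have d1e : deriv y =ᶠ[𝓝 u] fun v => -(1 / 2) * (deriv (deriv f) v / deriv f v) * y v := by
    filter_upwards [d1] with v h using h.deriv
  have d2 : ∀ᶠ v in 𝓝 u, deriv (deriv y) v = q v * y v := by
    filter_upwards [d1, d1e.eventuallyEq_nhds, hfa, hne, hq] with v h1 h2 h3 h4 h5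
    have e := (((h3.deriv.deriv.div h3.deriv h4).differentiableAt.hasDerivAt).const_mul
      (-(1 / 2))).mul h1
    rw [h2.deriv_eq]
    refine e.deriv.trans ?_
    have h6 : q v = -(1 / 2) * schwarzian f v := by rw [h5]; ring
    rw [h6]
    unfold schwarzian
    simp only [Pi.div_def]
    field_simp
    ring
  have hysol : IsSolutionAt q y u := ⟨hyan.self_of_nhds, d2⟩
  have d3 : ∀ᶠ v in 𝓝 u, HasDerivAt (fun v => f v * y v) (deriv f v * y v + f v * deriv y v) v := by
    filter_upwards [hfa, hyan] with v h1 h2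
    exact h1.differentiableAt.hasDerivAt.mul h2.differentiableAt.hasDerivAt
  have d3e : deriv (fun v => f v * y v) =ᶠ[𝓝 u] fun v => deriv f v * y v + f v * deriv y v := by
    filter_upwards [d3] with v h using h.deriv
  refine ⟨fun v => f v * y v, y, ⟨hf.mul hysol.1, ?_⟩, hysol, ?_, ?_⟩
  · filter_upwards [d3e.eventuallyEq_nhds, hfa, hyan, d1e, d2, hne] with v h1 h2 h3 h4 h5 h6
    rw [h1.deriv_eq]
    have e := (h2.deriv.differentiableAt.hasDerivAt.mul h3.differentiableAt.hasDerivAt).add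
      (h2.differentiableAt.hasDerivAt.mul h3.deriv.differentiableAt.hasDerivAt)
    refine e.deriv.trans ?_
    rw [h5, h4]
    field_simp
    ring
  · unfold wronskian
    rw [d3.self_of_nhds.deriv]
    have : (deriv f u * y u + f u * deriv y u) * y u - f u * y u * deriv y u
      = deriv f u * y u ^ 2 := by ring
    rw [this]
    exact mul_ne_zero hf' (pow_ne_zero 2 (hyne u))
  · filter_upwards with v
    exact ⟨hyne v, by rw [mul_div_assoc, div_self (hyne v), mul_one]⟩

lemma schwarzian_log {ℓ : ℂ → ℂ} {u : ℂ} (hu : u ≠ 0)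
    (h : ∀ᶠ v in 𝓝 u, HasDerivAt ℓ v⁻¹ v) : schwarzian ℓ u = 1 / (2 * u ^ 2) := by
  have hne : ∀ᶠ v in 𝓝 u, v ≠ 0 := continuousAt_id.eventually_ne hu
  have d1 : deriv ℓ =ᶠ[𝓝 u] fun v => v⁻¹ := h.mono fun v hv => hv.deriv
  have d2 : deriv (deriv ℓ) =ᶠ[𝓝 u] fun v => -(v ^ 2)⁻¹ := by
    refine d1.deriv.trans ?_
    filter_upwards with v
    exact deriv_inv
  have d3 : (fun v => deriv (deriv ℓ) v / deriv ℓ v) =ᶠ[𝓝 u] fun v => -v⁻¹ := by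
    filter_upwards [d1, d2, hne] with v e1 e2 k
    rw [e1, e2]
    field_simp
  unfold schwarzian
  have d4 : HasDerivAt (fun v : ℂ => -v⁻¹) (-(-(u ^ 2)⁻¹)) u := (hasDerivAt_inv hu).neg
  rw [d3.deriv_eq, d4.deriv]
  have d3' := d3.eq_of_nhds
  rw [d3']
  field_simp
  norm_num

/-! ### A crude area theorem and the Schwarzian of univalent functions -/

/-- The image of the open ball is open. Its closure lies in the compact image of the closed ball,
whose bounding circle is sent outside the ball of radius `η`. So the image is relatively clopen in
the connected ball of radius `η`. -/
lemma Complex.ball_subset_image_ball {k : ℂ → ℂ} {ρ η : ℝ} (hρ : 0 < ρ) (hη : 0 < η)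
    (hk : AnalyticOnNhd ℂ k (Metric.closedBall 0 ρ)) (hinj : InjOn k (Metric.closedBall 0 ρ))
    (h0 : k 0 = 0) (hs : ∀ z, ‖z‖ = ρ → η ≤ ‖k z‖) :
    Metric.ball 0 η ⊆ k '' Metric.ball 0 ρ := by
  have hopen : IsOpen (k '' Metric.ball 0 ρ) := by
    rcases (hk.mono Metric.ball_subset_closedBall).is_constant_or_isOpen
      (convex_ball 0 ρ).isPreconnected with ⟨w, hw⟩ | h
    · exfalso
      have h1 : (0 : ℂ) ∈ Metric.ball 0 ρ := Metric.mem_ball_self hρ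
      have h2 : ((ρ / 2 : ℝ) : ℂ) ∈ Metric.ball 0 ρ := by
        simp [abs_of_pos hρ, hρ]
      have := hinj (Metric.ball_subset_closedBall h1) (Metric.ball_subset_closedBall h2)
        ((hw _ h1).trans (hw _ h2).symm)
      have h3 : ρ / 2 ≠ 0 := by positivity
      exact h3 (by exact_mod_cast this.symm)
    · exact h _ subset_rfl Metric.isOpen_ball
  refine (convex_ball 0 η).isPreconnected.subset_of_closure_inter_subset hopen
    ⟨0, Metric.mem_ball_self hη, 0, Metric.mem_ball_self hρ, h0⟩ ?_
  rintro w ⟨hw, hwη⟩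
  have hcl : IsClosed (k '' Metric.closedBall 0 ρ) :=
    ((isCompact_closedBall 0 ρ).image_of_continuousOn hk.continuousOn).isClosed
  have := closure_minimal (image_mono Metric.ball_subset_closedBall) hcl hw
  obtain ⟨z, hz, rfl⟩ := this
  refine ⟨z, ?_, rfl⟩
  rw [mem_closedBall_zero_iff] at hz
  rw [mem_ball_zero_iff] at hwη ⊢
  refine lt_of_le_of_ne hz fun h => ?_
  exact absurd (hs z h) (not_le.2 hwη)

open MeasureTheory Real in
lemma setIntegral_annulus_eq {g : ℂ → ℝ} {ρ σ : ℝ} (hρ : 0 < ρ) (hσ : ρ ≤ σ)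
    (hg : ContinuousOn g {z | ρ ≤ ‖z‖ ∧ ‖z‖ ≤ σ}) :
    ∫ z in {z : ℂ | ρ < ‖z‖ ∧ ‖z‖ < σ}, g z =
      ∫ r in ρ..σ, r * (2 * π * circleAverage g 0 r) := by
  have hmeas : MeasurableSet {z : ℂ | ρ < ‖z‖ ∧ ‖z‖ < σ} :=
    ((isOpen_lt continuous_const continuous_norm).inter
      (isOpen_lt continuous_norm continuous_const)).measurableSet
  rw [← integral_indicator hmeas, ← Complex.integral_comp_polarCoord_symm]
  have hsymm : ∀ p : ℝ × ℝ, Complex.polarCoord.symm p = circleMap 0 p.1 p.2 := by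
    intro p
    rw [Complex.polarCoord_symm_apply, circleMap_zero, Complex.exp_mul_I]
    simp
  have hcont : ContinuousOn (fun p : ℝ × ℝ => p.1 • g (Complex.polarCoord.symm p))
      (Icc ρ σ ×ˢ Icc (-π) π) := by
    refine continuousOn_fst.smul (hg.comp ?_ ?_)
    · refine ContinuousOn.congr (f := fun p => circleMap 0 p.1 p.2) ?_ fun p _ => hsymm p
      unfold circleMap
      fun_prop
    · intro p hp
      have h0 : 0 ≤ p.1 := hρ.le.trans hp.1.1
      simp only [mem_ofPred_eq, Complex.norm_polarCoord_symm, abs_of_nonneg h0]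
      exact hp.1
  have hind : ∀ p ∈ polarCoord.target,
      p.1 • ({z : ℂ | ρ < ‖z‖ ∧ ‖z‖ < σ}.indicator g) (Complex.polarCoord.symm p) =
      (Ioo ρ σ ×ˢ univ).indicator (fun p : ℝ × ℝ => p.1 • g (Complex.polarCoord.symm p)) p := by
    intro p hp
    have h0 : 0 < p.1 := hp.1
    by_cases h : ρ < p.1 ∧ p.1 < σ
    · rw [indicator_of_mem, indicator_of_mem]
      · exact ⟨h, mem_univ _⟩
      · simpa only [mem_ofPred_eq, Complex.norm_polarCoord_symm, abs_of_pos h0] using h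
    · rw [indicator_of_notMem, indicator_of_notMem, smul_zero]
      · exact fun h' => h h'.1
      · simpa only [mem_ofPred_eq, Complex.norm_polarCoord_symm, abs_of_pos h0] using h
  rw [setIntegral_congr_fun (polarCoord.open_target.measurableSet) hind,
    setIntegral_indicator (measurableSet_Ioo.prod MeasurableSet.univ)]
  have hset : polarCoord.target ∩ (Ioo ρ σ ×ˢ univ) = Ioo ρ σ ×ˢ Ioo (-π) π := by
    ext p
    simp only [polarCoord_target, mem_inter_iff, mem_prod, mem_Ioi, mem_Ioo, mem_univ, and_true]
    constructor
    · rintro ⟨⟨_, h2⟩, h3⟩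
      exact ⟨h3, h2⟩
    · rintro ⟨h1, h2⟩
      exact ⟨⟨hρ.trans h1.1, h2⟩, h1⟩
  rw [hset]
  have hint : IntegrableOn (fun p : ℝ × ℝ => p.1 • g (Complex.polarCoord.symm p))
      (Ioo ρ σ ×ˢ Ioo (-π) π) (volume.prod volume) := by
    have : IntegrableOn (fun p : ℝ × ℝ => p.1 • g (Complex.polarCoord.symm p))
      (Icc ρ σ ×ˢ Icc (-π) π) (volume.prod volume) :=
      hcont.integrableOn_compact (isCompact_Icc.prod isCompact_Icc)
    exact this.mono_set (prod_mono Ioo_subset_Icc_self Ioo_subset_Icc_self)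
  rw [Measure.volume_eq_prod, setIntegral_prod _ hint, intervalIntegral.integral_of_le hσ,
    ← integral_Ioc_eq_integral_Ioo]
  refine setIntegral_congr_fun measurableSet_Ioc fun r _ => ?_
  simp only [smul_eq_mul, hsymm]
  rw [integral_const_mul]
  congr 1
  have hper : Function.Periodic (fun θ => g (circleMap 0 r θ)) (2 * π) :=
    (periodic_circleMap 0 r).comp g
  have h1 := hper.intervalIntegral_add_eq (-π) 0
  rw [show -π + 2 * π = π by ring, zero_add] at h1
  rw [← integral_Ioc_eq_integral_Ioo, ← intervalIntegral.integral_of_le (by linarith [pi_pos]), h1,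
    circleAverage_def, smul_eq_mul, ← mul_assoc, mul_inv_cancel₀ (by positivity), one_mul]

open Real in
/-- The mean of `‖-1 / z ^ 2 + k z‖ ^ 2` on a circle, for `k` holomorphic, is at least
`1 / r ^ 4 + ‖k 0‖ ^ 2`. -/
lemma le_circleAverage_sq_norm {k : ℂ → ℂ} {r : ℝ} (hr : 0 < r)
    (hk : DifferentiableOn ℂ k (Metric.closedBall 0 r)) :
    (r ^ 4)⁻¹ + ‖k 0‖ ^ 2 ≤ circleAverage (fun z => ‖-(z ^ 2)⁻¹ + k z‖ ^ 2) 0 r := by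
  set b := k 0 with hb
  -- On `|z| = r` one has `conj (z⁻²) = z² / r⁴`, so `Re T` collects the cross terms in the
  -- expansions of `|-z⁻² + k|²` and of `|k|² = |b + (k - b)|²`. As `T` is holomorphic with `T 0 =
  -- 0`, these average to zero; the remaining term `|k - b|²` is discarded.
  set T : ℂ → ℂ := fun z => -2 * z ^ 2 * k z / r ^ 4 + 2 * (starRingEnd ℂ) b * (k z - b) with hT
  have hTd : DifferentiableOn ℂ T (Metric.closedBall 0 r) := by
    rw [hT]
    fun_prop
  have hTc : DiffContOnCl ℂ T (Metric.ball 0 |r|) := by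
    rw [abs_of_pos hr]
    exact hTd.diffContOnCl_ball subset_rfl
  have hTavg : circleAverage T 0 r = 0 := by
    rw [hTc.circleAverage]
    simp [hT, ← hb]
  have hsph : Metric.sphere (0 : ℂ) |r| ⊆ Metric.closedBall 0 r := by
    rw [abs_of_pos hr]
    exact Metric.sphere_subset_closedBall
  have hTi : CircleIntegrable T 0 r := (hTd.continuousOn.mono hsph).circleIntegrable'
  have hReT : circleAverage (fun z => (T z).re) 0 r = 0 := by
    have := Complex.reCLM.circleAverage_comp_comm hTi
    rw [hTavg, map_zero] at this
    exact this
  have hTre : CircleIntegrable (fun z => (T z).re) 0 r :=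
    (Complex.continuous_re.comp_continuousOn (hTd.continuousOn.mono hsph)).circleIntegrable'
  have hcont : ContinuousOn (fun z : ℂ => ‖-(z ^ 2)⁻¹ + k z‖ ^ 2) (Metric.sphere 0 |r|) := by
    refine ((ContinuousOn.add ?_ (hk.continuousOn.mono hsph)).norm).pow 2
    refine (ContinuousOn.inv₀ (by fun_prop) fun z hz => ?_).neg
    rw [mem_sphere_zero_iff_norm, abs_of_pos hr] at hz
    exact pow_ne_zero 2 (norm_pos_iff.1 (hz ▸ hr))
  have hle : circleAverage (fun z => ((r ^ 4)⁻¹ + ‖b‖ ^ 2) + (T z).re) 0 r ≤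
      circleAverage (fun z => ‖-(z ^ 2)⁻¹ + k z‖ ^ 2) 0 r := by
    refine circleAverage_mono ((circleIntegrable_const _ _ _).fun_add hTre)
      hcont.circleIntegrable' fun z hz => ?_
    rw [mem_sphere_zero_iff_norm, abs_of_pos hr] at hz
    have hz0 : z ≠ 0 := norm_pos_iff.1 (hz ▸ hr)
    have hconj : (starRingEnd ℂ) ((z ^ 2)⁻¹) = z ^ 2 / r ^ 4 := by
      have h1 : z * (starRingEnd ℂ) z = r ^ 2 := by
        rw [Complex.mul_conj, Complex.normSq_eq_norm_sq, hz]
        push_cast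
        rfl
      have hr0 : (r : ℂ) ≠ 0 := by exact_mod_cast hr.ne'
      have h2 : (starRingEnd ℂ) z ≠ 0 := by simpa using hz0
      rw [map_inv₀, map_pow, eq_div_iff (pow_ne_zero 4 hr0), inv_mul_eq_iff_eq_mul₀
        (pow_ne_zero 2 h2)]
      calc (r : ℂ) ^ 4 = (r ^ 2) ^ 2 := by ring
        _ = (starRingEnd ℂ) z ^ 2 * z ^ 2 := by rw [← h1]; ring
    have e1 : ‖-(z ^ 2)⁻¹ + k z‖ ^ 2 = (r ^ 4)⁻¹ + ‖k z‖ ^ 2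
        + (-2 * ((starRingEnd ℂ) ((z ^ 2)⁻¹) * k z)).re := by
      rw [← Complex.normSq_eq_norm_sq, Complex.normSq_add, Complex.normSq_eq_norm_sq,
        Complex.normSq_eq_norm_sq, norm_neg, norm_inv, norm_pow, hz]
      have : (-(z ^ 2)⁻¹ * (starRingEnd ℂ) (k z)).re = -((starRingEnd ℂ) ((z ^ 2)⁻¹) * k z).re := by
        rw [← Complex.conj_re, map_mul, Complex.conj_conj, map_neg]
        simp
      rw [this]
      have h2 : (-2 * ((starRingEnd ℂ) ((z ^ 2)⁻¹) * k z)).re =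
        -2 * ((starRingEnd ℂ) ((z ^ 2)⁻¹) * k z).re := by
        simp
      rw [h2]
      ring
    have e2 : ‖k z‖ ^ 2 = ‖b‖ ^ 2 + ‖k z - b‖ ^ 2 + (2 * (starRingEnd ℂ) b * (k z - b)).re := by
      have : k z = b + (k z - b) := by ring
      conv_lhs => rw [this]
      rw [← Complex.normSq_eq_norm_sq, Complex.normSq_add, Complex.normSq_eq_norm_sq,
        Complex.normSq_eq_norm_sq]
      have h1 : (b * (starRingEnd ℂ) (k z - b)).re = ((starRingEnd ℂ) b * (k z - b)).re := by
        rw [← Complex.conj_re, map_mul, Complex.conj_conj]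
      have h2 : (2 * (starRingEnd ℂ) b * (k z - b)).re = 2 * ((starRingEnd ℂ) b * (k z - b)).re := by
        rw [mul_assoc]
        simp
      rw [h1, h2]
    have e3 : (T z).re = (-2 * ((starRingEnd ℂ) ((z ^ 2)⁻¹) * k z)).re
        + (2 * (starRingEnd ℂ) b * (k z - b)).re := by
      rw [hT, hconj, ← Complex.add_re]
      congr 2
      ring
    rw [e1, e2, e3]
    nlinarith [sq_nonneg ‖k z - b‖]
  rw [circleAverage_fun_add (circleIntegrable_const _ _ _) hTre, circleAverage_const, hReT,
    add_zero] at hle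
  exact hle

open MeasureTheory in
-- The real Jacobian determinant of a holomorphic map is the squared modulus of its derivative.
lemma setLIntegral_normSq_deriv_eq_volume_image {F F' : ℂ → ℂ} {A : Set ℂ} (hA : MeasurableSet A)
    (hF : ∀ z ∈ A, HasDerivAt F (F' z) z) (hinj : InjOn F A) :
    ∫⁻ z in A, ENNReal.ofReal (‖F' z‖ ^ 2) = volume (F '' A) := by
  rw [← lintegral_abs_det_fderiv_eq_addHaar_image volume hA
    (fun z hz => (hF z hz).complexToReal_fderiv.hasFDerivWithinAt) hinj]
  refine setLIntegral_congr_fun hA fun z _ => ?_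
  have : (F' z • (1 : ℂ →L[ℝ] ℂ)).det = ‖F' z‖ ^ 2 := by
    rw [ContinuousLinearMap.det, ← LinearMap.det_toMatrix Complex.basisOneI, Matrix.det_fin_two]
    simp [LinearMap.toMatrix_apply, ← Complex.normSq_eq_norm_sq, Complex.normSq_apply]
  rw [this, abs_of_nonneg (by positivity)]

open MeasureTheory Real in
-- The reciprocal of `F = 1/z + K` already takes all values of modulus less than `1/m` on `|z| < ρ`.
-- By injectivity `F` therefore maps the annulus `ρ < |z| < σ` into `|w| ≤ m`, and its image has
-- area at most `π m²`. That area is the integral of `|F'|²`, bounded below circle by circle through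
-- `le_circleAverage_sq_norm`.
lemma area_inequality {K : ℂ → ℂ} (hK : DifferentiableOn ℂ K (Metric.ball 0 1))
    (hinj : InjOn (fun z => z⁻¹ + K z) (Metric.ball 0 1 \ {0})) {ρ σ m : ℝ} (hρ : 0 < ρ)
    (hρσ : ρ < σ) (hσ : σ < 1) (hm : ∀ z : ℂ, ‖z‖ = ρ → ‖z⁻¹ + K z‖ ≤ m)
    (hsmall : ∀ z : ℂ, ‖z‖ ≤ ρ → ‖z * K z‖ ≤ 1 / 2) :
    (ρ ^ 2)⁻¹ - (σ ^ 2)⁻¹ + ‖deriv K 0‖ ^ 2 * (σ ^ 2 - ρ ^ 2) ≤ m ^ 2 := by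
  have hKan : AnalyticOnNhd ℂ K (Metric.ball 0 1) := hK.analyticOnNhd Metric.isOpen_ball
  have hne : ∀ z : ℂ, ‖z‖ ≤ ρ → 1 + z * K z ≠ 0 := by
    intro z hz h
    have h1 := hsmall z hz
    have h2 : z * K z = -1 := by linear_combination h
    rw [h2, norm_neg, norm_one] at h1
    norm_num at h1
  set k : ℂ → ℂ := fun z => z / (1 + z * K z) with hk
  have hkF : ∀ z : ℂ, z ≠ 0 → k z = (z⁻¹ + K z)⁻¹ := by
    intro z hz
    have : z⁻¹ + K z = (1 + z * K z) / z := by field_simp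
    rw [this, inv_div]
  have hm0 : 0 < m := by
    have h1 : ‖(ρ : ℂ)‖ = ρ := by simp [abs_of_pos hρ]
    have h2 := hm ρ h1
    refine lt_of_lt_of_le (norm_pos_iff.2 ?_) h2
    have h3 : (ρ : ℂ) ≠ 0 := by exact_mod_cast hρ.ne'
    have : (ρ : ℂ)⁻¹ + K ρ = (1 + ρ * K ρ) / ρ := by field_simp
    rw [this]
    exact div_ne_zero (hne ρ h1.le) h3
  have hball : Metric.closedBall (0 : ℂ) ρ ⊆ Metric.ball 0 1 :=
    Metric.closedBall_subset_ball (hρσ.trans hσ)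
  have hkinj : InjOn k (Metric.closedBall 0 ρ) := by
    intro z hz w hw h
    have hz1 := hne z (mem_closedBall_zero_iff.1 hz)
    have hw1 := hne w (mem_closedBall_zero_iff.1 hw)
    by_cases hz0 : z = 0
    · by_contra hzw
      have : k w = 0 := by rw [← h, hz0]; simp [hk]
      rw [hk, div_eq_zero_iff] at this
      rcases this with h' | h'
      · exact hzw (hz0.trans h'.symm)
      · exact hw1 h'
    by_cases hw0 : w = 0
    · exfalso
      have : k z = 0 := by rw [h, hw0]; simp [hk]
      rw [hk, div_eq_zero_iff] at this
      rcases this with h' | h'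
      · exact hz0 h'
      · exact hz1 h'
    rw [hkF z hz0, hkF w hw0, inv_inj] at h
    exact hinj ⟨hball hz, hz0⟩ ⟨hball hw, hw0⟩ h
  have hkan : AnalyticOnNhd ℂ k (Metric.closedBall 0 ρ) := fun z hz =>
    analyticAt_id.div (analyticAt_const.add (analyticAt_id.mul (hKan z (hball hz))))
      (hne z (mem_closedBall_zero_iff.1 hz))
  have hsub := Complex.ball_subset_image_ball hρ (inv_pos.2 hm0) hkan hkinj (by simp [hk])
    (by
      intro z hz
      have hz0 : z ≠ 0 := norm_pos_iff.1 (hz ▸ hρ)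
      rw [hkF z hz0, norm_inv]
      have h1 : 0 < ‖z⁻¹ + K z‖ := by
        rw [norm_pos_iff]
        intro h
        have : (1 + z * K z) = z * (z⁻¹ + K z) := by field_simp
        exact hne z hz.le (by rw [this, h, mul_zero])
      exact inv_anti₀ h1 (hm z hz))
  set A : Set ℂ := {z : ℂ | ρ < ‖z‖ ∧ ‖z‖ < σ} with hA
  have hAm : MeasurableSet A := ((isOpen_lt continuous_const continuous_norm).inter
      (isOpen_lt continuous_norm continuous_const)).measurableSet
  have hA0 : ∀ z ∈ A, z ≠ 0 := fun z hz => norm_pos_iff.1 (hρ.trans hz.1)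
  have hA1 : ∀ z ∈ A, z ∈ Metric.ball (0 : ℂ) 1 := fun z hz =>
    mem_ball_zero_iff.2 (hz.2.trans hσ)
  have himg : (fun z => z⁻¹ + K z) '' A ⊆ Metric.closedBall 0 m := by
    rintro _ ⟨z, hz, rfl⟩
    rw [mem_closedBall_zero_iff]
    by_contra! hlt
    have hpos : 0 < ‖z⁻¹ + K z‖ := hm0.trans hlt
    have : (z⁻¹ + K z)⁻¹ ∈ Metric.ball (0 : ℂ) m⁻¹ := by
      rw [mem_ball_zero_iff, norm_inv]
      exact inv_strictAnti₀ hm0 hlt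
    obtain ⟨w, hw, hwz⟩ := hsub this
    have hw0 : w ≠ 0 := by
      rintro rfl
      have h1 : k 0 = 0 := by simp [hk]
      rw [h1, eq_comm, inv_eq_zero] at hwz
      exact (norm_pos_iff.1 hpos) hwz
    rw [hkF w hw0, inv_inj] at hwz
    have := hinj ⟨hball (Metric.ball_subset_closedBall hw), hw0⟩ ⟨hA1 z hz, hA0 z hz⟩ hwz
    rw [mem_ball_zero_iff, this] at hw
    exact lt_asymm hw hz.1
  have hderiv : ∀ z ∈ A, HasDerivAt (fun z => z⁻¹ + K z) (-(z ^ 2)⁻¹ + deriv K z) z := fun z hz =>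
    (hasDerivAt_inv (hA0 z hz)).add (hKan z (hA1 z hz)).differentiableAt.hasDerivAt
  have hAsub : A ⊆ Metric.ball 0 1 \ {0} := fun z hz => ⟨hA1 z hz, hA0 z hz⟩
  have harea := setLIntegral_normSq_deriv_eq_volume_image hAm hderiv (hinj.mono hAsub)
  have hcont : ContinuousOn (fun z => ‖-(z ^ 2)⁻¹ + deriv K z‖ ^ 2) {z : ℂ | ρ ≤ ‖z‖ ∧ ‖z‖ ≤ σ} := by
    refine ((ContinuousOn.add ?_ ?_).norm).pow 2
    · exact (ContinuousOn.inv₀ (by fun_prop) fun z hz =>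
        pow_ne_zero 2 (norm_pos_iff.1 (hρ.trans_le hz.1))).neg
    · exact fun z hz => (hKan z (mem_ball_zero_iff.2 (hz.2.trans_lt hσ))).deriv.continuousAt.continuousWithinAt
  have hcomp : IsCompact {z : ℂ | ρ ≤ ‖z‖ ∧ ‖z‖ ≤ σ} := by
    refine (isCompact_closedBall (0 : ℂ) σ).of_isClosed_subset
      ((isClosed_le continuous_const continuous_norm).inter
        (isClosed_le continuous_norm continuous_const)) fun z hz => mem_closedBall_zero_iff.2 hz.2
  have hint : IntegrableOn (fun z => ‖-(z ^ 2)⁻¹ + deriv K z‖ ^ 2) A :=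
    (hcont.integrableOn_compact hcomp).mono_set fun z hz => ⟨hz.1.le, hz.2.le⟩
  have hle : ∫ z in A, ‖-(z ^ 2)⁻¹ + deriv K z‖ ^ 2 ≤ π * m ^ 2 := by
    have h1 := ofReal_integral_eq_lintegral_ofReal hint (ae_of_all _ fun z => sq_nonneg _)
    rw [harea] at h1
    have h2 := h1.le.trans (measure_mono himg)
    rw [Complex.volume_closedBall, ← ENNReal.ofReal_pow hm0.le, ← ENNReal.ofReal_coe_nnreal,
      ← ENNReal.ofReal_mul (by positivity),
      ENNReal.ofReal_le_ofReal_iff (by positivity), NNReal.coe_real_pi] at h2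
    linarith
  rw [setIntegral_annulus_eq hρ hρσ.le hcont] at hle
  have hF : ∀ r ∈ uIcc ρ σ, HasDerivAt
      (fun r : ℝ => π * (-(r ^ 2)⁻¹ + ‖deriv K 0‖ ^ 2 * r ^ 2))
      (r * (2 * π * ((r ^ 4)⁻¹ + ‖deriv K 0‖ ^ 2))) r := by
    intro r hr
    rw [uIcc_of_le hρσ.le] at hr
    have hr0 : r ≠ 0 := (hρ.trans_le hr.1).ne'
    have h1 := ((hasDerivAt_pow 2 r).inv (pow_ne_zero 2 hr0)).neg
    have h2 := (hasDerivAt_pow 2 r).const_mul (‖deriv K 0‖ ^ 2)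
    refine ((h1.add h2).const_mul π).congr_deriv ?_
    push_cast
    field_simp
  have hcontL : ContinuousOn (fun r : ℝ => r * (2 * π * ((r ^ 4)⁻¹ + ‖deriv K 0‖ ^ 2)))
      (Icc ρ σ) := by
    refine continuousOn_id.mul (continuousOn_const.mul (ContinuousOn.add ?_ continuousOn_const))
    exact ContinuousOn.inv₀ (by fun_prop) fun r hr => pow_ne_zero 4 (hρ.trans_le hr.1).ne'
  have hcontR : ContinuousOn (fun r : ℝ => r * (2 * π *
      circleAverage (fun z => ‖-(z ^ 2)⁻¹ + deriv K z‖ ^ 2) 0 r)) (Icc ρ σ) := by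
    refine continuousOn_id.mul (continuousOn_const.mul ?_)
    refine ContinuousOn.circleAverage ?_ fun r hr => hρ.le.trans hr.1
    simpa using hcont
  have hint1 := intervalIntegral.integral_eq_sub_of_hasDerivAt hF
    ((hcontL.mono (uIcc_of_le hρσ.le).subset).intervalIntegrable (μ := volume))
  have hmono := intervalIntegral.integral_mono_on hρσ.le
    (hcontL.intervalIntegrable_of_Icc (μ := volume) hρσ.le) (hcontR.intervalIntegrable_of_Icc (μ := volume) hρσ.le)
    (fun r hr => by
      have hr0 : 0 < r := hρ.trans_le hr.1
      have := le_circleAverage_sq_norm hr0 (k := deriv K) fun z hz =>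
        (hKan z (mem_ball_zero_iff.2 ((mem_closedBall_zero_iff.1 hz).trans_lt
          (hr.2.trans_lt hσ)))).deriv.differentiableAt.differentiableWithinAt
      exact mul_le_mul_of_nonneg_left (mul_le_mul_of_nonneg_left this (by positivity)) hr0.le)
  rw [hint1] at hmono
  have hfin := hmono.trans hle
  have : π * ((ρ ^ 2)⁻¹ - (σ ^ 2)⁻¹ + ‖deriv K 0‖ ^ 2 * (σ ^ 2 - ρ ^ 2)) ≤ π * m ^ 2 := by
    linarith
  exact le_of_mul_le_mul_left this pi_pos

/-- At a critical point `f - f u` is a constant times the `n`-th power of a local coordinate `ψ`,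
with `n ≥ 2`. Two points whose `ψ`-values differ by a primitive `n`-th root of unity then have the
same image. -/
lemma AnalyticAt.deriv_ne_zero_of_injOn {f : ℂ → ℂ} {u : ℂ} {s : Set ℂ} (hf : AnalyticAt ℂ f u)
    (hs : s ∈ 𝓝 u) (hinj : InjOn f s) : deriv f u ≠ 0 := by
  intro hd
  have hg : AnalyticAt ℂ (fun z => f z - f u) u := hf.sub analyticAt_const
  have hnz : ¬ ∀ᶠ z in 𝓝 u, f z - f u = 0 := by
    intro h
    have h1 : ∀ᶠ z in 𝓝[≠] u, (f z - f u = 0 ∧ z ∈ s) ∧ z ∈ ({u} : Set ℂ)ᶜ :=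
      ((h.and hs).filter_mono nhdsWithin_le_nhds).and self_mem_nhdsWithin
    obtain ⟨z, ⟨hz1, hz2⟩, hz3⟩ := h1.exists
    exact hz3 (hinj hz2 (mem_of_mem_nhds hs) (sub_eq_zero.1 hz1))
  obtain ⟨n, h, hh, hh0, hev⟩ := hg.exists_eventuallyEq_pow_smul_nonzero_iff.2 hnz
  simp only [smul_eq_mul] at hev
  have hn0 : n ≠ 0 := by
    rintro rfl
    have := hev.self_of_nhds
    simp only [sub_self, pow_zero, one_mul] at this
    exact hh0 this.symm
  have hn1 : n ≠ 1 := by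
    rintro rfl
    have h1 : HasDerivAt (fun z => (z - u) ^ 1 * h z) (h u) u := by
      have := (((hasDerivAt_id u).sub_const u).pow 1).mul hh.differentiableAt.hasDerivAt
      refine this.congr_deriv ?_
      simp
    have h2 := (h1.congr_of_eventuallyEq hev).deriv
    rw [deriv_sub_const, hd] at h2
    exact hh0 h2.symm
  -- An `n`-th root of `h / h u` near `u`, so that `f - f u = h u * ψ ^ n` with `ψ = (z - u) E`.
  set E : ℂ → ℂ := fun z => Complex.exp (Complex.log (h z / h u) / n) with hE
  have hEan : AnalyticAt ℂ E u := by
    refine ((hh.div_const.clog ?_).div_const).cexp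
    rw [div_self hh0]
    exact Complex.one_mem_slitPlane
  have hEu : E u = 1 := by simp [hE, div_self hh0]
  set ψ : ℂ → ℂ := fun z => (z - u) * E z with hψ
  have hψan : AnalyticAt ℂ ψ u := (analyticAt_id.sub analyticAt_const).mul hEan
  have hψd : HasStrictDerivAt ψ 1 u := by
    have h1 : HasDerivAt ψ 1 u := by
      refine (((hasDerivAt_id u).sub_const u).mul hEan.differentiableAt.hasDerivAt).congr_deriv ?_
      simp [hEu]
    rw [← h1.deriv]
    exact hψan.hasStrictDerivAt
  have hψu : ψ u = 0 := by simp [hψ]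
  have hmap := hψd.map_nhds_eq one_ne_zero
  rw [hψu] at hmap
  have hhne : ∀ᶠ z in 𝓝 u, h z ≠ 0 := hh.continuousAt.eventually_ne hh0
  have hpow : ∀ᶠ z in 𝓝 u, f z - f u = ψ z ^ n * h u := by
    filter_upwards [hev, hhne] with z hz hz0
    rw [hz, hψ, mul_pow, hE, ← Complex.exp_nat_mul, mul_div_cancel₀ _ (by exact_mod_cast hn0),
      Complex.exp_log (div_ne_zero hz0 hh0), mul_assoc, div_mul_cancel₀ _ hh0]
  have himg : ψ '' (s ∩ {z | f z - f u = ψ z ^ n * h u}) ∈ 𝓝 (0 : ℂ) := by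
    rw [← hmap]
    exact image_mem_map (inter_mem hs hpow)
  obtain ⟨ε, hε, hball⟩ := Metric.mem_nhds_iff.1 himg
  have hprim := Complex.isPrimitiveRoot_exp n hn0
  set w := Complex.exp (2 * Real.pi * Complex.I / n) with hw
  have hw1 : w ≠ 1 := hprim.ne_one (by omega)
  have hwn : ‖w‖ = 1 := hprim.norm'_eq_one hn0
  have hεn : ‖((ε / 2 : ℝ) : ℂ)‖ = ε / 2 := by
    rw [Complex.norm_real, Real.norm_of_nonneg (by positivity)]
  obtain ⟨z₁, ⟨hz₁, hz₁'⟩, e₁⟩ := hball (show ((ε / 2 : ℝ) : ℂ) ∈ Metric.ball 0 ε by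
    rw [mem_ball_zero_iff, hεn]; linarith)
  obtain ⟨z₂, ⟨hz₂, hz₂'⟩, e₂⟩ := hball (show w * ((ε / 2 : ℝ) : ℂ) ∈ Metric.ball 0 ε by
    rw [mem_ball_zero_iff, norm_mul, hwn, hεn]; linarith)
  have heq : f z₁ = f z₂ := by
    have h1 : f z₁ - f u = f z₂ - f u := by
      rw [hz₁', hz₂', e₁, e₂, mul_pow, hprim.pow_eq_one, one_mul]
    linear_combination h1
  have := hinj hz₁ hz₂ heq
  rw [this, e₂] at e₁
  have hε0 : ((ε / 2 : ℝ) : ℂ) ≠ 0 := by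
    rw [← norm_pos_iff, hεn]; positivity
  exact hw1 (mul_right_cancel₀ hε0 (by rw [e₁, one_mul]))

/-- In `area_inequality` with `σ = 1/2` and `ρ` small, the terms `ρ⁻²` cancel. With the error terms
bounded by `1/4` each, `x = |K'(0)|` satisfies `x² ≤ 8 x + 26`, which fails for `x > 11`. -/
lemma norm_deriv_zero_le_of_injOn {K : ℂ → ℂ} (hK : DifferentiableOn ℂ K (Metric.ball 0 1))
    (hK0 : K 0 = 0) (hinj : InjOn (fun z => z⁻¹ + K z) (Metric.ball 0 1 \ {0})) :
    ‖deriv K 0‖ ≤ 11 := by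
  by_contra! hlt
  set x := ‖deriv K 0‖ with hx
  have hd : HasDerivAt K (deriv K 0) 0 :=
    (hK.differentiableAt (Metric.ball_mem_nhds 0 one_pos)).hasDerivAt
  have hlit := (hasDerivAt_iff_isLittleO.1 hd).bound one_pos
  obtain ⟨δ, hδ, hb⟩ := Metric.eventually_nhds_iff_ball.1 hlit
  have hKb : ∀ z : ℂ, ‖z‖ < δ → ‖K z‖ ≤ (x + 1) * ‖z‖ := by
    intro z hz
    have h1 := hb z (mem_ball_zero_iff.2 hz)
    rw [hK0] at h1
    simp only [sub_zero, one_mul, smul_eq_mul] at h1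
    calc ‖K z‖ = ‖(K z - z * deriv K 0) + z * deriv K 0‖ := by ring_nf
      _ ≤ ‖K z - z * deriv K 0‖ + ‖z * deriv K 0‖ := norm_add_le _ _
      _ ≤ ‖z‖ + ‖z‖ * x := by rw [norm_mul]; gcongr
      _ = _ := by ring
  set ρ := min (δ / 2) (1 / (2 * (x + 2))) with hρdef
  have hx2 : 0 < x + 2 := by linarith
  have hρ : 0 < ρ := lt_min (by positivity) (by positivity)
  have hρδ : ρ < δ := (min_le_left _ _).trans_lt (by linarith)
  have hρx : ρ * (x + 2) ≤ 1 / 2 := by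
    have h1 : ρ ≤ 1 / (2 * (x + 2)) := min_le_right _ _
    calc ρ * (x + 2) ≤ 1 / (2 * (x + 2)) * (x + 2) := by gcongr
      _ = 1 / 2 := by field_simp
  have hρσ : ρ < 1 / 2 := by nlinarith
  have harea := area_inequality hK hinj hρ hρσ (by norm_num) (m := ρ⁻¹ + (x + 1) * ρ)
    (fun z hz => by
      calc ‖z⁻¹ + K z‖ ≤ ‖z⁻¹‖ + ‖K z‖ := norm_add_le _ _
        _ ≤ ρ⁻¹ + (x + 1) * ρ := by
          have := hKb z (hz ▸ hρδ)
          rw [norm_inv, hz]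
          rw [hz] at this
          gcongr)
    (fun z hz => by
      rw [norm_mul]
      have := hKb z (hz.trans_lt hρδ)
      calc ‖z‖ * ‖K z‖ ≤ ρ * ((x + 1) * ρ) := by
            refine mul_le_mul hz (this.trans ?_) (norm_nonneg _) hρ.le
            gcongr
        _ ≤ 1 / 2 := by nlinarith)
  rw [← hx] at harea
  have h1 : (ρ⁻¹ + (x + 1) * ρ) ^ 2 = (ρ ^ 2)⁻¹ + 2 * (x + 1) + ((x + 1) * ρ) ^ 2 := by
    field_simp
    ring
  rw [h1] at harea
  have h2 : ((x + 1) * ρ) ^ 2 ≤ 1 / 4 := by nlinarith [mul_pos hρ (show 0 < x + 1 by linarith)]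
  have h3 : (x * ρ) ^ 2 ≤ 1 / 4 := by nlinarith [mul_pos hρ (show 0 < x by linarith)]
  norm_num at harea
  nlinarith

/-- The Schwarzian derivative of a univalent function on the unit disk is bounded at the centre
(the optimal constant is `6`). -/
lemma norm_schwarzian_zero_le_of_injOn {f : ℂ → ℂ} (hf : DifferentiableOn ℂ f (Metric.ball 0 1))
    (hinj : InjOn f (Metric.ball 0 1)) : ‖schwarzian f 0‖ ≤ 66 := by
  have hB : Metric.ball (0 : ℂ) 1 ∈ 𝓝 0 := Metric.ball_mem_nhds 0 one_pos
  have hfan := hf.analyticOnNhd Metric.isOpen_ball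
  have h0 : (0 : ℂ) ∈ Metric.ball 0 1 := Metric.mem_ball_self one_pos
  set a := deriv f 0 with ha
  have ha0 : a ≠ 0 := (hfan 0 h0).deriv_ne_zero_of_injOn hB hinj
  have hu : DifferentiableOn ℂ (dslope f 0) (Metric.ball 0 1) :=
    (Complex.differentiableOn_dslope hB).2 hf
  have hune : ∀ z ∈ Metric.ball (0 : ℂ) 1, dslope f 0 z ≠ 0 := by
    intro z hz
    by_cases hz0 : z = 0
    · rw [hz0, dslope_same]
      exact ha0
    · rw [dslope_of_ne _ hz0, slope_def_field]
      refine div_ne_zero (sub_ne_zero.2 fun h => hz0 (hinj hz h0 h)) (sub_ne_zero.2 hz0)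
  -- The function `a / (f - f 0)` equals `v z / z = 1/z + d z`; after subtraction of `d 0` it has
  -- the shape required by the area estimate, and it is injective because `f` is.
  set v : ℂ → ℂ := fun z => a / dslope f 0 z with hv
  have hvd : DifferentiableOn ℂ v (Metric.ball 0 1) := (differentiableOn_const a).div hu hune
  have hv0 : v 0 = 1 := by simp [hv, ← ha, ha0]
  have hvne : ∀ z ∈ Metric.ball (0 : ℂ) 1, v z ≠ 0 := fun z hz => div_ne_zero ha0 (hune z hz)
  have hrel : ∀ z ∈ Metric.ball (0 : ℂ) 1, (f z - f 0) * v z = a * z := by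
    intro z hz
    have h1 : f z - f 0 = z * dslope f 0 z := by
      have := sub_smul_dslope f 0 z
      simpa using this.symm
    rw [h1, hv, mul_assoc, mul_div_cancel₀ _ (hune z hz), mul_comm]
  set d := dslope v 0 with hdd
  have hd : DifferentiableOn ℂ d (Metric.ball 0 1) := (Complex.differentiableOn_dslope hB).2 hvd
  have hvd1 : ∀ z, v z = 1 + z * d z := by
    intro z
    have := sub_smul_dslope v 0 z
    rw [hv0] at this
    simp only [sub_zero, smul_eq_mul] at this
    rw [hdd, this]
    ring
  have hbound : ‖deriv (fun z => d z - d 0) 0‖ ≤ 11 := by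
    refine norm_deriv_zero_le_of_injOn (hd.sub_const _) (sub_self _) ?_
    rintro z ⟨hz, hz0⟩ w ⟨hw, hw0⟩ h
    simp only [mem_singleton_iff] at hz0 hw0
    have key : ∀ z ∈ Metric.ball (0 : ℂ) 1, z ≠ 0 → z⁻¹ + (d z - d 0) = a / (f z - f 0) - d 0 := by
      intro z hz hz0
      have h1 := hrel z hz
      have h2 : f z - f 0 ≠ 0 := sub_ne_zero.2 fun h => hz0 (hinj hz h0 h)
      have h3 : v z / z = a / (f z - f 0) := by
        rw [div_eq_div_iff hz0 h2]
        linear_combination h1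
      rw [← h3, hvd1]
      field_simp
      ring
    simp only at h
    rw [key z hz hz0, key w hw hw0, sub_left_inj] at h
    have h2 : f z - f 0 ≠ 0 := sub_ne_zero.2 fun h => hz0 (hinj hz h0 h)
    have h3 : f w - f 0 ≠ 0 := sub_ne_zero.2 fun h => hw0 (hinj hw h0 h)
    rw [div_eq_div_iff h2 h3] at h
    have h4 := mul_left_cancel₀ ha0 h
    exact hinj hz hw (by linear_combination -h4)
  rw [deriv_sub_const] at hbound
  have hvan := hvd.analyticOnNhd Metric.isOpen_ball
  have hdan := hd.analyticOnNhd Metric.isOpen_ball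
  have hBo : ∀ z ∈ Metric.ball (0 : ℂ) 1, Metric.ball (0 : ℂ) 1 ∈ 𝓝 z := fun z hz =>
    Metric.isOpen_ball.mem_nhds hz
  have v1 : ∀ z ∈ Metric.ball (0 : ℂ) 1, deriv v z = d z + z * deriv d z := by
    intro z hz
    have e : HasDerivAt (fun z => 1 + z * d z) (1 * d z + z * deriv d z) z :=
      ((hasDerivAt_id z).mul (hdan z hz).differentiableAt.hasDerivAt).const_add 1
    rw [funext hvd1, e.deriv, one_mul]
  have v2 : deriv (deriv v) 0 = 2 * deriv d 0 := by
    have e : HasDerivAt (fun z => d z + z * deriv d z) _ 0 :=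
      (hdan 0 h0).differentiableAt.hasDerivAt.add
        ((hasDerivAt_id (0 : ℂ)).mul (hdan 0 h0).deriv.differentiableAt.hasDerivAt)
    rw [(eventuallyEq_of_mem hB v1).deriv_eq, e.deriv]
    simp
    ring
  -- Differentiating `(f - f 0) v = a z` three times expresses the Taylor coefficients of `f`
  -- through those of `v = 1 + z d` and gives `S(f)(0) = -6 d'(0)`, whence `66 = 6 · 11`.
  have f1 : ∀ z ∈ Metric.ball (0 : ℂ) 1, deriv f z * v z + (f z - f 0) * deriv v z = a := by
    intro z hz
    have e := ((hfan z hz).differentiableAt.hasDerivAt.sub_const (f 0)).mul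
      (hvan z hz).differentiableAt.hasDerivAt
    have e' : HasDerivAt (fun z => a * z) (a * 1) z := (hasDerivAt_id z).const_mul a
    have := (e.congr_of_eventuallyEq (eventuallyEq_of_mem (hBo z hz) fun w hw =>
      (hrel w hw).symm)).unique e'
    rw [this, mul_one]
  have f2 : ∀ z ∈ Metric.ball (0 : ℂ) 1, deriv (deriv f) z * v z + 2 * (deriv f z * deriv v z)
      + (f z - f 0) * deriv (deriv v) z = 0 := by
    intro z hz
    have F := (hfan z hz).differentiableAt.hasDerivAt
    have F1 := (hfan z hz).deriv.differentiableAt.hasDerivAt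
    have V := (hvan z hz).differentiableAt.hasDerivAt
    have V1 := (hvan z hz).deriv.differentiableAt.hasDerivAt
    have e := (F1.mul V).add ((F.sub_const (f 0)).mul V1)
    have := (e.congr_of_eventuallyEq (f₁ := fun _ => a) (eventuallyEq_of_mem (hBo z hz) fun w hw =>
      (f1 w hw).symm)).unique (hasDerivAt_const z a)
    linear_combination this
  have f3 : deriv (deriv (deriv f)) 0 * v 0 + 3 * (deriv (deriv f) 0 * deriv v 0)
      + 3 * (deriv f 0 * deriv (deriv v) 0) = 0 := by
    have F := (hfan 0 h0).differentiableAt.hasDerivAt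
    have F1 := (hfan 0 h0).deriv.differentiableAt.hasDerivAt
    have F2 := (hfan 0 h0).deriv.deriv.differentiableAt.hasDerivAt
    have V := (hvan 0 h0).differentiableAt.hasDerivAt
    have V1 := (hvan 0 h0).deriv.differentiableAt.hasDerivAt
    have V2 := (hvan 0 h0).deriv.deriv.differentiableAt.hasDerivAt
    have e := ((F2.mul V).add ((F1.mul V1).const_mul 2)).add ((F.sub_const (f 0)).mul V2)
    have := (e.congr_of_eventuallyEq (f₁ := fun _ => (0 : ℂ)) (eventuallyEq_of_mem hB fun w hw =>
      (f2 w hw).symm)).unique (hasDerivAt_const 0 0)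
    linear_combination this
  have f2' := f2 0 h0
  rw [hv0] at f3 f2'
  have hS : schwarzian f 0 = -6 * deriv d 0 := by
    have g2 : deriv (deriv f) 0 = -2 * (a * deriv v 0) := by linear_combination f2'
    rw [schwarzian_eq (hfan 0 h0) ha0]
    rw [g2, ← ha, v2] at f3
    have g3 : deriv (deriv (deriv f)) 0 = 6 * a * deriv v 0 ^ 2 - 6 * a * deriv d 0 := by
      linear_combination f3
    rw [g2, g3, ← ha]
    field_simp
    ring
  rw [hS, norm_mul]
  norm_num
  linarith

/-- The Schwarzian derivative of a univalent function decays quadratically with the distance to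
the boundary. -/
lemma norm_schwarzian_le_of_injOn {f : ℂ → ℂ} {c : ℂ} {R : ℝ} (hR : 0 < R)
    (hf : DifferentiableOn ℂ f (Metric.ball c R)) (hinj : InjOn f (Metric.ball c R)) :
    ‖schwarzian f c‖ ≤ 66 / R ^ 2 := by
  set ψ : ℂ → ℂ := fun t => c + R * t with hψ
  have hR0 : (R : ℂ) ≠ 0 := by exact_mod_cast hR.ne'
  have hmaps : MapsTo ψ (Metric.ball 0 1) (Metric.ball c R) := by
    intro t ht
    rw [mem_ball_zero_iff] at ht
    rw [mem_ball_iff_norm, hψ, add_sub_cancel_left, norm_mul, Complex.norm_real,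
      Real.norm_of_nonneg hR.le]
    nlinarith
  have hψinj : Function.Injective ψ := by
    intro s t h
    exact mul_left_cancel₀ hR0 (add_left_cancel h)
  have hψd : ∀ t, HasDerivAt ψ R t := fun t =>
    (((hasDerivAt_id t).const_mul (R : ℂ)).const_add c).congr_deriv (by simp)
  have hψ0 : ψ 0 = c := by simp [hψ]
  have hψan : AnalyticAt ℂ ψ 0 := by
    rw [hψ]
    fun_prop
  have hψd' : deriv ψ = fun _ => (R : ℂ) := funext fun t => (hψd t).deriv
  have h1 := norm_schwarzian_zero_le_of_injOn (f := fun t => f (ψ t))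
    (hf.comp (fun t _ => (hψd t).differentiableAt.differentiableWithinAt) hmaps)
    (fun s hs t ht h => hψinj (hinj (hmaps hs) (hmaps ht) h))
  have hcB : Metric.ball c R ∈ 𝓝 c := Metric.ball_mem_nhds c hR
  have hfan : AnalyticAt ℂ f c := hf.analyticAt hcB
  rw [schwarzian_comp (by rwa [hψ0]) hψan (by rw [hψ0]; exact hfan.deriv_ne_zero_of_injOn hcB hinj)
    (by rw [hψd']; exact hR0), hψ0] at h1
  have h2 : schwarzian ψ 0 = 0 := by
    unfold schwarzian
    simp [hψd']
  rw [h2, add_zero, hψd', norm_mul, norm_pow, Complex.norm_real, Real.norm_of_nonneg hR.le] at h1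
  rw [le_div_iff₀ (by positivity)]
  exact h1

/-! ### A regular singular point: one Frobenius solution and a primitive on a half-plane -/

/-- The Cayley transform carries the half-plane to the unit disk, where holomorphic functions have
primitives. -/
lemma exists_primitive_halfPlane {f : ℂ → ℂ} {a : ℝ}
    (hf : DifferentiableOn ℂ f {ζ | ζ.re < a}) :
    ∃ Φ : ℂ → ℂ, ∀ ζ : ℂ, ζ.re < a → HasDerivAt Φ (f ζ) ζ := by
  set c : ℂ → ℂ := fun t => a - (1 + t) / (1 - t) with hc
  have hne : ∀ t ∈ Metric.ball (0 : ℂ) 1, 1 - t ≠ 0 := by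
    intro t ht h
    rw [mem_ball_zero_iff, ← sub_eq_zero.1 h, norm_one] at ht
    exact lt_irrefl _ ht
  have hcd : ∀ t ∈ Metric.ball (0 : ℂ) 1, HasDerivAt c (-2 / (1 - t) ^ 2) t := by
    intro t ht
    have h1 := (((hasDerivAt_id t).const_add 1).div ((hasDerivAt_id t).const_sub 1)
      (hne t ht)).const_sub (a : ℂ)
    refine h1.congr_deriv ?_
    simp only [id]
    ring
  have hmaps : MapsTo c (Metric.ball 0 1) {ζ | ζ.re < a} := by
    intro t ht
    have h1 : (1 - t) ≠ 0 := hne t ht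
    have h2 : 0 < Complex.normSq (1 - t) := Complex.normSq_pos.2 h1
    have h3 : ‖t‖ ^ 2 < 1 := by
      rw [mem_ball_zero_iff] at ht
      nlinarith [norm_nonneg t]
    rw [← Complex.normSq_eq_norm_sq, Complex.normSq_apply] at h3
    have h4 : 0 < ((1 + t) / (1 - t)).re := by
      rw [Complex.div_re, ← add_div]
      refine div_pos ?_ h2
      simp
      nlinarith
    simp only [mem_ofPred_eq, hc, Complex.sub_re, Complex.ofReal_re]
    linarith
  have hd : DifferentiableOn ℂ (fun t => f (c t) * (-2 / (1 - t) ^ 2)) (Metric.ball 0 1) := by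
    refine (hf.comp (fun t ht => (hcd t ht).differentiableAt.differentiableWithinAt) hmaps).mul ?_
    refine (differentiableOn_const _).div (by fun_prop) fun t ht => pow_ne_zero 2 (hne t ht)
  obtain ⟨G, hG⟩ := hd.isExactOn_ball
  refine ⟨fun ζ => G ((a - ζ - 1) / (a - ζ + 1)), fun ζ hζ => ?_⟩
  have hw : 0 < (a - ζ).re := by simpa using hζ
  set w : ℂ := a - ζ with hwdef
  have hw1 : w + 1 ≠ 0 := by
    intro h
    have : (w + 1).re = 0 := by rw [h]; rfl
    simp only [Complex.add_re, Complex.one_re] at this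
    linarith
  have hwball : (w - 1) / (w + 1) ∈ Metric.ball (0 : ℂ) 1 := by
    rw [mem_ball_zero_iff, norm_div, div_lt_one (norm_pos_iff.2 hw1),
      ← sq_lt_sq₀ (norm_nonneg _) (norm_nonneg _), ← Complex.normSq_eq_norm_sq,
      ← Complex.normSq_eq_norm_sq, Complex.normSq_apply, Complex.normSq_apply]
    simp
    nlinarith
  have hcw : c ((w - 1) / (w + 1)) = ζ := by
    have h2 : 1 - (w - 1) / (w + 1) = 2 / (w + 1) := by field_simp; ring
    have h3 : 1 + (w - 1) / (w + 1) = 2 * w / (w + 1) := by field_simp; ring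
    rw [hc]
    simp only [h2, h3]
    rw [hwdef] at hw1 ⊢
    field_simp
    ring
  have hinv : HasDerivAt (fun ζ : ℂ => (a - ζ - 1) / (a - ζ + 1)) (-2 / (w + 1) ^ 2) ζ := by
    have h1 := ((((hasDerivAt_id ζ).const_sub (a : ℂ)).sub_const 1).div
      (((hasDerivAt_id ζ).const_sub (a : ℂ)).add_const 1) hw1)
    refine h1.congr_deriv ?_
    simp only [id, ← hwdef]
    ring
  have := (hG _ hwball).comp ζ hinv
  refine this.congr_deriv ?_
  simp only [hcw]
  have h2 : 1 - (w - 1) / (w + 1) = 2 / (w + 1) := by field_simp; ring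
  rw [h2]
  field_simp

lemma summable_mul_pow_of_le_geometric {c : ℕ → ℂ} {L : ℝ} (hc : ∀ n, ‖c n‖ ≤ L ^ n) {z : ℂ}
    (hz : L * ‖z‖ < 1) : Summable fun n => ‖c n * z ^ n‖ := by
  have hL : 0 ≤ L := by simpa using (norm_nonneg _).trans (hc 1)
  refine Summable.of_nonneg_of_le (fun n => norm_nonneg _) (fun n => ?_)
    (summable_geometric_of_lt_one (mul_nonneg hL (norm_nonneg z)) hz)
  rw [norm_mul, norm_pow, mul_pow]
  exact mul_le_mul_of_nonneg_right (hc n) (by positivity)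

/-- The Euler operator `z d/dz` multiplies the `n`-th coefficient by `n`. The factor `2` in the
condition on `z` leaves room for the majorant `n (1/2)ⁿ` of the differentiated series. -/
lemma mul_deriv_tsum_mul_pow {c : ℕ → ℂ} {L : ℝ} (hL : 0 < L) (hc : ∀ n, ‖c n‖ ≤ L ^ n) {z : ℂ}
    (hz : 2 * L * ‖z‖ < 1) :
    DifferentiableAt ℂ (fun z => ∑' n, c n * z ^ n) z ∧
      z * deriv (fun z => ∑' n, c n * z ^ n) z = ∑' n, (n * c n) * z ^ n := by
  set R := 1 / (2 * L) with hR
  have hRpos : 0 < R := by positivity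
  have hLR : L * R = 1 / 2 := by rw [hR]; field_simp
  have hzR : z ∈ Metric.ball (0 : ℂ) R := by
    rw [mem_ball_zero_iff, hR, lt_div_iff₀ (by positivity)]
    linarith
  have hu : Summable fun n : ℕ => (n * (1 / 2 : ℝ) ^ n) / R := by
    refine Summable.div_const ?_ R
    simpa using summable_pow_mul_geometric_of_norm_lt_one 1 (r := (1 / 2 : ℝ)) (by norm_num)
  have h := hasDerivAt_tsum_of_isPreconnected (g := fun n z => c n * z ^ n)
    (g' := fun n z => c n * (n * z ^ (n - 1))) hu Metric.isOpen_ball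
    (convex_ball (0 : ℂ) R).isPreconnected
    (fun n y _ => (hasDerivAt_pow n y).const_mul (c n))
    (fun n y hy => by
      rcases Nat.eq_zero_or_pos n with rfl | hn
      · simp
      rw [mem_ball_zero_iff] at hy
      rw [norm_mul, norm_mul, norm_pow, Complex.norm_natCast]
      calc ‖c n‖ * (n * ‖y‖ ^ (n - 1)) ≤ L ^ n * (n * R ^ (n - 1)) := by
            gcongr
            exact hc n
        _ = n * (1 / 2 : ℝ) ^ n / R := by
            rw [← hLR, mul_pow]
            obtain ⟨m, rfl⟩ : ∃ m, n = m + 1 := ⟨n - 1, by omega⟩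
            simp only [Nat.add_sub_cancel, pow_succ]
            field_simp)
    (Metric.mem_ball_self hRpos)
    (summable_of_ne_finset_zero (s := {0}) fun n hn => by
      simp only [Finset.mem_singleton] at hn
      simp [hn]) hzR
  refine ⟨h.differentiableAt, ?_⟩
  rw [h.deriv, ← tsum_mul_left]
  refine tsum_congr fun n => ?_
  rcases Nat.eq_zero_or_pos n with rfl | hn
  · simp
  · obtain ⟨m, rfl⟩ : ∃ m, n = m + 1 := ⟨n - 1, by omega⟩
    simp only [Nat.add_sub_cancel, pow_succ]
    ring

/-- The coefficients of the Frobenius solution. -/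
noncomputable def frobeniusCoeff (β : ℕ → ℂ) (s : ℂ) : ℕ → ℂ
  | 0 => 1
  | n + 1 => (((n + 1 : ℕ) : ℂ) * (((n + 1 : ℕ) : ℂ) + 2 * s))⁻¹ *
      ∑ k : Fin (n + 1), β (n + 1 - k) * frobeniusCoeff β s k

/-- Since `|n (n + 2s)| ≥ 1` for `n ≥ 1`, the recursion is dominated by the convolution of `Kⁿ` with
the inductive bound `(2K)ⁿ`, and the geometric sum of powers of `2` closes the induction. -/
lemma norm_frobeniusCoeff_le {β : ℕ → ℂ} {s : ℂ} (hs : 0 ≤ s.re) {K : ℝ}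
    (hβ : ∀ n, ‖β n‖ ≤ K ^ n) (n : ℕ) : ‖frobeniusCoeff β s n‖ ≤ (2 * K) ^ n := by
  have hK : 0 ≤ K := by simpa using (norm_nonneg _).trans (hβ 1)
  induction n using Nat.strong_induction_on with
  | _ n ih =>
    rcases n with _ | n
    · simp [frobeniusCoeff]
    rw [frobeniusCoeff, norm_mul, norm_inv]
    have h1 : 1 ≤ ‖(((n + 1 : ℕ) : ℂ) * (((n + 1 : ℕ) : ℂ) + 2 * s))‖ := by
      rw [norm_mul, Complex.norm_natCast]
      have h2 : (1 : ℝ) ≤ (n + 1 : ℕ) := by exact_mod_cast Nat.succ_le_succ (Nat.zero_le n)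
      have h3 : ((n + 1 : ℕ) : ℝ) ≤ ‖((n + 1 : ℕ) : ℂ) + 2 * s‖ := by
        refine le_trans ?_ (Complex.re_le_norm _)
        simp
        linarith
      nlinarith
    have h2 : ‖∑ k : Fin (n + 1), β (n + 1 - k) * frobeniusCoeff β s k‖ ≤ (2 * K) ^ (n + 1) := by
      calc _ ≤ ∑ k : Fin (n + 1), ‖β (n + 1 - k) * frobeniusCoeff β s k‖ := norm_sum_le _ _
        _ ≤ ∑ k : Fin (n + 1), K ^ (n + 1) * 2 ^ (k : ℕ) := by
          refine Finset.sum_le_sum fun k _ => ?_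
          rw [norm_mul]
          calc _ ≤ K ^ (n + 1 - k : ℕ) * (2 * K) ^ (k : ℕ) :=
                mul_le_mul (hβ _) (ih k k.2) (norm_nonneg _) (by positivity)
            _ = K ^ (n + 1) * 2 ^ (k : ℕ) := by
                rw [mul_pow]
                have : K ^ (n + 1) = K ^ (n + 1 - k : ℕ) * K ^ (k : ℕ) := by
                  rw [← pow_add]; congr 1; omega
                rw [this]; ring
        _ = K ^ (n + 1) * ∑ k ∈ Finset.range (n + 1), (2 : ℝ) ^ k := by
          rw [← Finset.mul_sum, Finset.sum_range]
        _ ≤ K ^ (n + 1) * 2 ^ (n + 1) := by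
          gcongr
          rw [geom_sum_eq (by norm_num)]
          norm_num
        _ = (2 * K) ^ (n + 1) := by rw [mul_pow]; ring
    calc _ ≤ 1 * (2 * K) ^ (n + 1) :=
          mul_le_mul (inv_le_one_of_one_le₀ h1) h2 (norm_nonneg _) zero_le_one
      _ = _ := one_mul _

/-- The condition `0 ≤ Re s` keeps `n (n + 2s)` nonzero for `n ≥ 1`, so no resonance obstructs the
recursion. -/
lemma frobeniusCoeff_recursion {β : ℕ → ℂ} (hβ0 : β 0 = 0) {s : ℂ} (hs : 0 ≤ s.re) (n : ℕ) :
    (n : ℂ) * (n + 2 * s) * frobeniusCoeff β s n =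
      ∑ k ∈ Finset.range (n + 1), frobeniusCoeff β s k * β (n - k) := by
  rcases n with _ | n
  · simp [hβ0]
  rw [Finset.sum_range_succ, Nat.sub_self, hβ0, mul_zero, add_zero, frobeniusCoeff, ← mul_assoc,
    mul_inv_cancel₀, one_mul, Finset.sum_range]
  · exact Finset.sum_congr rfl fun k _ => mul_comm _ _
  · refine mul_ne_zero (by exact_mod_cast Nat.succ_ne_zero n) fun h => ?_
    have := congrArg Complex.re h
    simp at this
    have h2 : (0 : ℝ) ≤ n := n.cast_nonneg
    linarith

/-- Because the constant term vanishes, the constant in Cauchy's estimate `C / tⁿ` need only be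
absorbed for `n ≥ 1`, where `C ≤ (C + 1)ⁿ`. -/
lemma AnalyticAt.exists_hasSum_of_eq_zero {b : ℂ → ℂ} (hb : AnalyticAt ℂ b 0) (hb0 : b 0 = 0) :
    ∃ (β : ℕ → ℂ) (K : ℝ), 0 < K ∧ β 0 = 0 ∧ (∀ n, ‖β n‖ ≤ K ^ n) ∧
      ∀ᶠ z in 𝓝 0, HasSum (fun n => β n * z ^ n) (b z) := by
  obtain ⟨p, r, hp⟩ := hb
  obtain ⟨t, ht0, htr⟩ := ENNReal.lt_iff_exists_nnreal_btwn.1 hp.r_pos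
  have ht0' : 0 < (t : ℝ) := by exact_mod_cast ht0
  obtain ⟨C, hC, hbound⟩ := p.norm_le_div_pow_of_pos_of_lt_radius
    (by exact_mod_cast ht0) (htr.trans_le hp.r_le)
  have h0 : p.coeff 0 = 0 := by
    have := hp.coeff_zero 1
    rw [hb0] at this
    exact this
  refine ⟨p.coeff, (C + 1) / t, by positivity, h0, fun n => ?_, ?_⟩
  · rcases Nat.eq_zero_or_pos n with rfl | hn
    · rw [h0]; simp
    have h1 : ‖p.coeff n‖ ≤ C / t ^ n := by
      rw [← FormalMultilinearSeries.norm_apply_eq_norm_coef]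
      exact hbound n
    refine h1.trans ?_
    rw [div_pow]
    gcongr
    calc C ≤ C + 1 := by linarith
      _ ≤ (C + 1) ^ n := le_self_pow₀ (by linarith) (by omega)
  · have : Metric.eball (0 : ℂ) r ∈ 𝓝 (0 : ℂ) := Metric.eball_mem_nhds 0 hp.r_pos
    filter_upwards [this] with z hz
    have := hp.hasSum hz
    rw [zero_add] at this
    simp only [FormalMultilinearSeries.apply_eq_pow_smul_coeff, smul_eq_mul] at this
    simpa only [mul_comm] using this

/-- This is the equation `X'' = B (exp ζ) X` for `X = exp (sζ) h (exp ζ)`, written with the Euler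
operator acting on `h`. Coefficientwise it is `n (n + 2s) cₙ = Σ cₖ βₙ₋ₖ`. -/
lemma exists_frobenius_solution {B : ℂ → ℂ} (hB : AnalyticAt ℂ B 0) {s : ℂ} (hs : 0 ≤ s.re)
    (hBs : B 0 = s ^ 2) :
    ∃ (r : ℝ) (h : ℂ → ℂ), 0 < r ∧ DifferentiableOn ℂ h (Metric.ball 0 r) ∧
      (∀ z ∈ Metric.ball (0 : ℂ) r, h z ≠ 0) ∧
      ∀ z ∈ Metric.ball (0 : ℂ) r, z * deriv (fun w => w * deriv h w) z + 2 * s * (z * deriv h z) =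
        (B z - s ^ 2) * h z := by
  have hb : AnalyticAt ℂ (fun z => B z - s ^ 2) 0 := hB.sub analyticAt_const
  obtain ⟨β, K, hK, hβ0, hβ, hsum⟩ := hb.exists_hasSum_of_eq_zero (by rw [hBs, sub_self])
  set c := frobeniusCoeff β s with hc
  have hcb : ∀ n, ‖c n‖ ≤ (2 * K) ^ n := norm_frobeniusCoeff_le hs hβ
  have hcb' : ∀ n : ℕ, ‖(n : ℂ) * c n‖ ≤ (4 * K) ^ n := by
    intro n
    rw [norm_mul, Complex.norm_natCast]
    calc (n : ℝ) * ‖c n‖ ≤ 2 ^ n * (2 * K) ^ n := by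
          refine mul_le_mul ?_ (hcb n) (norm_nonneg _) (by positivity)
          exact_mod_cast Nat.lt_two_pow_self.le
      _ = (4 * K) ^ n := by rw [← mul_pow]; ring_nf
  set h : ℂ → ℂ := fun z => ∑' n, c n * z ^ n with hh
  have hh0 : h 0 = 1 := by
    rw [hh]
    simp only
    rw [tsum_eq_single 0 fun n hn => by simp [hn]]
    simp [hc, frobeniusCoeff]
  have hd : ∀ z : ℂ, 8 * K * ‖z‖ < 1 → DifferentiableAt ℂ h z ∧
      z * deriv h z = ∑' n : ℕ, ((n : ℂ) * c n) * z ^ n := fun z hz =>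
    mul_deriv_tsum_mul_pow (by positivity) hcb (by nlinarith [norm_nonneg z])
  -- The coefficients `c n`, `n * c n` and `n² * c n` are bounded by powers of `2K`, `4K` and `8K`;
  -- this radius makes all three series converge.
  set ρ := 1 / (8 * K) with hρ
  have hρpos : 0 < ρ := by positivity
  have hmem : ∀ z ∈ Metric.ball (0 : ℂ) ρ, 8 * K * ‖z‖ < 1 := by
    intro z hz
    rw [mem_ball_zero_iff, hρ, lt_div_iff₀ (by positivity)] at hz
    linarith
  have hne : ∀ᶠ z in 𝓝 (0 : ℂ), h z ≠ 0 := by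
    refine (hd 0 (by simp)).1.continuousAt.eventually_ne ?_
    rw [hh0]
    exact one_ne_zero
  obtain ⟨r, hr, hball⟩ := Metric.eventually_nhds_iff_ball.1
    ((hsum.and hne).and (Metric.ball_mem_nhds (0 : ℂ) hρpos))
  refine ⟨r, h, hr, fun z hz => (hd z (hmem z (hball z hz).2)).1.differentiableWithinAt,
    fun z hz => (hball z hz).1.2, fun z hz => ?_⟩
  have hz8 := hmem z (hball z hz).2
  have e1 := (hd z hz8).2
  have e2 : z * deriv (fun w => w * deriv h w) z = ∑' n : ℕ, ((n : ℂ) * ((n : ℂ) * c n)) * z ^ n := by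
    rw [← (mul_deriv_tsum_mul_pow (L := 4 * K) (by positivity) hcb' (by linarith)).2]
    congr 1
    refine Filter.EventuallyEq.deriv_eq ?_
    filter_upwards [Metric.isOpen_ball.mem_nhds hz] with w hw
    exact (hd w (hmem w (hball w hw).2)).2
  rw [e1, e2, ← (hball z hz).1.1.tsum_eq, mul_comm (tsum _) (h z), hh]
  have s1 : Summable fun n => ‖c n * z ^ n‖ :=
    summable_mul_pow_of_le_geometric hcb (by nlinarith [norm_nonneg z])
  have s2 : Summable fun n => ‖β n * z ^ n‖ :=
    summable_mul_pow_of_le_geometric hβ (by nlinarith [norm_nonneg z])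
  have s3 : Summable fun n : ℕ => ‖((n : ℂ) * c n) * z ^ n‖ :=
    summable_mul_pow_of_le_geometric hcb' (by nlinarith [norm_nonneg z])
  have hcb'' : ∀ n : ℕ, ‖(n : ℂ) * ((n : ℂ) * c n)‖ ≤ (8 * K) ^ n := by
    intro n
    rw [norm_mul, Complex.norm_natCast]
    calc (n : ℝ) * ‖(n : ℂ) * c n‖ ≤ 2 ^ n * (4 * K) ^ n := by
          refine mul_le_mul ?_ (hcb' n) (norm_nonneg _) (by positivity)
          exact_mod_cast Nat.lt_two_pow_self.le
      _ = (8 * K) ^ n := by rw [← mul_pow]; ring_nf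
  have s4 : Summable fun n : ℕ => ‖((n : ℂ) * ((n : ℂ) * c n)) * z ^ n‖ :=
    summable_mul_pow_of_le_geometric hcb'' (by linarith)
  rw [tsum_mul_tsum_eq_tsum_sum_range_of_summable_norm s1 s2, ← tsum_mul_left,
    ← s4.of_norm.tsum_add (s3.of_norm.mul_left _)]
  refine tsum_congr fun n => ?_
  calc _ = ((n : ℂ) * (n + 2 * s) * c n) * z ^ n := by ring
    _ = _ := by
      rw [hc, frobeniusCoeff_recursion hβ0 hs, Finset.sum_mul]
      refine Finset.sum_congr rfl fun k hk => ?_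
      have : z ^ n = z ^ k * z ^ (n - k) := by
        rw [← pow_add, Nat.add_sub_cancel' (Finset.mem_range_succ_iff.1 hk)]
      rw [this]
      ring

/-- On the half-plane `Re ζ < log r`, `X` is a zero-free solution of `X'' = B (exp ζ) X` with
multiplier `exp (2 π i a)` under the deck transformation, and `Φ` is a primitive of `X⁻²`, so that
`X Φ` is a second solution. -/
structure IsFrobeniusPair (B : ℂ → ℂ) (r : ℝ) (a c : ℂ) (X Φ : ℂ → ℂ) : Prop where
  differentiableAt : ∀ ζ : ℂ, ζ.re < Real.log r → DifferentiableAt ℂ X ζ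
  ne_zero : ∀ ζ : ℂ, ζ.re < Real.log r → X ζ ≠ 0
  deriv_deriv : ∀ ζ : ℂ, ζ.re < Real.log r → deriv (deriv X) ζ = B (Complex.exp ζ) * X ζ
  hasDerivAt : ∀ ζ : ℂ, ζ.re < Real.log r → HasDerivAt Φ ((X ζ ^ 2)⁻¹) ζ
  shift : ∀ ζ : ℂ, ζ.re < Real.log r →
    X (ζ + 2 * Real.pi * Complex.I) = Complex.exp (2 * Real.pi * Complex.I * a) * X ζ
  shift' : ∀ ζ : ℂ, ζ.re < Real.log r →
    Φ (ζ + 2 * Real.pi * Complex.I) = Complex.exp (-(4 * Real.pi * Complex.I * a)) * Φ ζ + c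

lemma isOpen_halfPlane (a : ℝ) : IsOpen {ζ : ℂ | ζ.re < a} :=
  isOpen_lt Complex.continuous_re continuous_const

lemma convex_halfPlane (a : ℝ) : Convex ℝ {ζ : ℂ | ζ.re < a} := convex_halfSpace_re_lt a

lemma nonempty_halfPlane (a : ℝ) : ({ζ : ℂ | ζ.re < a}).Nonempty :=
  ⟨((a - 1 : ℝ) : ℂ), by simp⟩

lemma shift_mem_halfPlane {a : ℝ} {ζ : ℂ} (h : ζ.re < a) :
    (ζ + 2 * Real.pi * Complex.I).re < a := by simpa using h

lemma norm_exp_lt {r : ℝ} (hr : 0 < r) {ζ : ℂ} (h : ζ.re < Real.log r) : ‖Complex.exp ζ‖ < r := by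
  rw [Complex.norm_exp]
  exact (Real.lt_log_iff_exp_lt hr).1 h

lemma IsFrobeniusPair.mono {B : ℂ → ℂ} {r r' : ℝ} {a c : ℂ} {X Φ : ℂ → ℂ}
    (h : IsFrobeniusPair B r a c X Φ) (hr' : 0 < r') (hle : r' ≤ r) :
    IsFrobeniusPair B r' a c X Φ := by
  have hlog : ∀ ζ : ℂ, ζ.re < Real.log r' → ζ.re < Real.log r := fun ζ hζ =>
    hζ.trans_le (Real.log_le_log hr' hle)
  exact ⟨fun ζ hζ => h.1 ζ (hlog ζ hζ), fun ζ hζ => h.2 ζ (hlog ζ hζ),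
    fun ζ hζ => h.3 ζ (hlog ζ hζ), fun ζ hζ => h.4 ζ (hlog ζ hζ),
    fun ζ hζ => h.5 ζ (hlog ζ hζ), fun ζ hζ => h.6 ζ (hlog ζ hζ)⟩

/-- The transformation law of `Φ` follows by differentiation: `X⁻²` is multiplied by `exp (-4πi s)`
under the shift, so `Φ (ζ + 2πi) - exp (-4πi s) Φ ζ` is constant. This holds even when `2s` is an
integer. -/
lemma exists_isFrobeniusPair_of_re_nonneg {B : ℂ → ℂ} (hB : AnalyticAt ℂ B 0) {s : ℂ}
    (hs : 0 ≤ s.re) (hBs : B 0 = s ^ 2) :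
    ∃ r > 0, ∃ c X Φ, IsFrobeniusPair B r s c X Φ := by
  obtain ⟨r, h, hr, hd, hne, hode⟩ := exists_frobenius_solution hB hs hBs
  set U : Set ℂ := {ζ | ζ.re < Real.log r} with hU
  have hUo : IsOpen U := isOpen_halfPlane _
  have hmem : ∀ ζ ∈ U, Complex.exp ζ ∈ Metric.ball (0 : ℂ) r := fun ζ hζ =>
    mem_ball_zero_iff.2 (norm_exp_lt hr hζ)
  have han := hd.analyticOnNhd Metric.isOpen_ball
  set X : ℂ → ℂ := fun ζ => Complex.exp (s * ζ) * h (Complex.exp ζ) with hX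
  set θ : ℂ → ℂ := fun w => w * deriv h w with hθ
  have hθan : ∀ w ∈ Metric.ball (0 : ℂ) r, AnalyticAt ℂ θ w := fun w hw =>
    analyticAt_id.mul (han w hw).deriv
  have hexp : ∀ ζ : ℂ, HasDerivAt (fun ζ => Complex.exp (s * ζ)) (s * Complex.exp (s * ζ)) ζ := by
    intro ζ
    refine ((hasDerivAt_id ζ).const_mul s).cexp.congr_deriv ?_
    simp [mul_comm]
  have X1 : ∀ ζ ∈ U, HasDerivAt X
      (Complex.exp (s * ζ) * (s * h (Complex.exp ζ) + θ (Complex.exp ζ))) ζ := by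
    intro ζ hζ
    have e1 := (han _ (hmem ζ hζ)).differentiableAt.hasDerivAt.comp ζ (Complex.hasDerivAt_exp ζ)
    refine ((hexp ζ).mul e1).congr_deriv ?_
    simp only [hθ, Function.comp_apply]
    ring
  have X1e : ∀ ζ ∈ U, deriv X =ᶠ[𝓝 ζ] fun ζ =>
      Complex.exp (s * ζ) * (s * h (Complex.exp ζ) + θ (Complex.exp ζ)) := fun ζ hζ => by
    filter_upwards [hUo.mem_nhds hζ] with w hw using (X1 w hw).deriv
  have hXne : ∀ ζ ∈ U, X ζ ≠ 0 := fun ζ hζ =>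
    mul_ne_zero (Complex.exp_ne_zero _) (hne _ (hmem ζ hζ))
  have X2 : ∀ ζ ∈ U, deriv (deriv X) ζ = B (Complex.exp ζ) * X ζ := by
    intro ζ hζ
    have e1 := (han _ (hmem ζ hζ)).differentiableAt.hasDerivAt.comp ζ (Complex.hasDerivAt_exp ζ)
    have e2 := (hθan _ (hmem ζ hζ)).differentiableAt.hasDerivAt.comp ζ (Complex.hasDerivAt_exp ζ)
    rw [(X1e ζ hζ).deriv_eq]
    refine ((hexp ζ).mul ((e1.const_mul s).add e2)).deriv.trans ?_
    have := hode _ (hmem ζ hζ)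
    simp only [Function.comp_apply, Pi.add_apply] at this ⊢
    change Complex.exp ζ * deriv θ (Complex.exp ζ) +
      2 * s * θ (Complex.exp ζ) = _ at this
    have h3 : θ (Complex.exp ζ) = Complex.exp ζ * deriv h (Complex.exp ζ) := rfl
    simp only [hX]
    linear_combination Complex.exp (s * ζ) * (this - s * h3)
  have hXd : DifferentiableOn ℂ (fun ζ => (X ζ ^ 2)⁻¹) U := fun ζ hζ =>
    (((X1 ζ hζ).differentiableAt.pow 2).inv (pow_ne_zero 2 (hXne ζ hζ))).differentiableWithinAt
  obtain ⟨Φ, hΦ⟩ := exists_primitive_halfPlane hXd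
  have hshift : ∀ ζ : ℂ,
      X (ζ + 2 * Real.pi * Complex.I) = Complex.exp (2 * Real.pi * Complex.I * s) * X ζ := by
    intro ζ
    simp only [hX]
    rw [Complex.exp_periodic ζ, mul_add, Complex.exp_add]
    ring_nf
  set μ := Complex.exp (-(4 * Real.pi * Complex.I * s)) with hμ
  obtain ⟨ζ₀, hζ₀⟩ := nonempty_halfPlane (Real.log r)
  refine ⟨r, hr, Φ (ζ₀ + 2 * Real.pi * Complex.I) - μ * Φ ζ₀, X, Φ,
    fun ζ hζ => (X1 ζ hζ).differentiableAt, hXne, X2, hΦ, fun ζ _ => hshift ζ, ?_⟩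
  have hder : ∀ ζ ∈ U, HasDerivAt (fun ζ => Φ (ζ + 2 * Real.pi * Complex.I) - μ * Φ ζ) 0 ζ := by
    intro ζ hζ
    have h1 := (hΦ _ (shift_mem_halfPlane hζ)).comp_add_const ζ (2 * Real.pi * Complex.I)
    refine (h1.sub ((hΦ ζ hζ).const_mul μ)).congr_deriv ?_
    rw [hshift, mul_pow, mul_inv, ← sub_mul]
    have : (Complex.exp (2 * Real.pi * Complex.I * s) ^ 2)⁻¹ = μ := by
      rw [hμ, ← Complex.exp_nat_mul, ← Complex.exp_neg]
      congr 1
      push_cast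
      ring
    rw [this, sub_self, zero_mul]
  intro ζ hζ
  have := hUo.is_const_of_deriv_eq_zero (convex_halfPlane _).isPreconnected
    (fun x hx => (hder x hx).differentiableAt.differentiableWithinAt)
    (fun x hx => (hder x hx).deriv) hζ hζ₀
  rw [← this]
  ring

/-- Only `s²` is prescribed, so the root with nonnegative real part may be taken as the exponent. -/
lemma exists_isFrobeniusPair {B : ℂ → ℂ} (hB : AnalyticAt ℂ B 0) {s : ℂ} (hBs : B 0 = s ^ 2) :
    ∃ r > 0, ∃ a c X Φ, (a = s ∨ a = -s) ∧ IsFrobeniusPair B r a c X Φ := by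
  rcases le_total 0 s.re with h | h
  · obtain ⟨r, hr, c, X, Φ, hp⟩ := exists_isFrobeniusPair_of_re_nonneg hB h hBs
    exact ⟨r, hr, s, c, X, Φ, Or.inl rfl, hp⟩
  · obtain ⟨r, hr, c, X, Φ, hp⟩ := exists_isFrobeniusPair_of_re_nonneg hB (s := -s)
      (by simpa using h) (by rw [hBs]; ring)
    exact ⟨r, hr, -s, c, X, Φ, Or.inr rfl, hp⟩

/-! ### Passing between the punctured disk and its universal cover -/

/-- The branch of the logarithm near `exp ζ₀` with the value `ζ₀` there. -/
noncomputable def logBranch (ζ₀ v : ℂ) : ℂ := ζ₀ + Complex.log (v / Complex.exp ζ₀)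

@[simp] lemma logBranch_exp_self (ζ₀ : ℂ) : logBranch ζ₀ (Complex.exp ζ₀) = ζ₀ := by
  simp [logBranch]

lemma eventually_div_mem_slitPlane (ζ₀ : ℂ) :
    ∀ᶠ v in 𝓝 (Complex.exp ζ₀), v / Complex.exp ζ₀ ∈ Complex.slitPlane := by
  have hc : ContinuousAt (fun v => v / Complex.exp ζ₀) (Complex.exp ζ₀) :=
    continuousAt_id.div_const _
  refine hc.eventually (Complex.isOpen_slitPlane.mem_nhds ?_)
  simp only [div_self (Complex.exp_ne_zero ζ₀)]
  exact Complex.one_mem_slitPlane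

lemma eventually_hasDerivAt_logBranch (ζ₀ : ℂ) :
    ∀ᶠ v in 𝓝 (Complex.exp ζ₀), HasDerivAt (logBranch ζ₀) v⁻¹ v := by
  filter_upwards [eventually_div_mem_slitPlane ζ₀] with v hv
  refine ((((hasDerivAt_id v).div_const (Complex.exp ζ₀)).clog hv).const_add ζ₀).congr_deriv ?_
  have := Complex.exp_ne_zero ζ₀
  simp only [id]
  field_simp

lemma analyticAt_logBranch (ζ₀ : ℂ) : AnalyticAt ℂ (logBranch ζ₀) (Complex.exp ζ₀) :=
  analyticAt_const.add ((analyticAt_id.div_const).clog (eventually_div_mem_slitPlane ζ₀).self_of_nhds)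

lemma eventually_exp_logBranch (ζ₀ : ℂ) :
    ∀ᶠ v in 𝓝 (Complex.exp ζ₀), Complex.exp (logBranch ζ₀ v) = v := by
  filter_upwards [eventually_div_mem_slitPlane ζ₀] with v hv
  rw [logBranch, Complex.exp_add, Complex.exp_log (Complex.slitPlane_ne_zero hv),
    mul_div_cancel₀ _ (Complex.exp_ne_zero ζ₀)]

lemma eventually_logBranch_exp (ζ₀ : ℂ) : ∀ᶠ ζ in 𝓝 ζ₀, logBranch ζ₀ (Complex.exp ζ) = ζ := by
  have h1 : ∀ᶠ ζ in 𝓝 ζ₀, (ζ - ζ₀).im ∈ Ioo (-Real.pi) Real.pi := by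
    have : ContinuousAt (fun ζ : ℂ => (ζ - ζ₀).im) ζ₀ := by fun_prop
    refine this.eventually (Ioo_mem_nhds ?_ ?_) <;> simp [Real.pi_pos]
  filter_upwards [h1] with ζ hζ
  rw [logBranch, ← Complex.exp_sub, Complex.log_exp hζ.1 hζ.2.le]
  ring

/-- The solution is `v^(1/2) X (log v)`. The factor `v^(1/2)` removes the first-order term created
by the change of variable and contributes the `-1/4`. -/
lemma isSolutionAt_of_cover {Q B X : ℂ → ℂ} {ζ₀ : ℂ} (hX : AnalyticAt ℂ X ζ₀)
    (hode : ∀ᶠ ζ in 𝓝 ζ₀, deriv (deriv X) ζ = B (Complex.exp ζ) * X ζ)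
    (hQ : ∀ᶠ v in 𝓝 (Complex.exp ζ₀), v ^ 2 * Q v = B v - 1 / 4) :
    IsSolutionAt Q (fun v => Complex.exp (logBranch ζ₀ v / 2) * X (logBranch ζ₀ v))
      (Complex.exp ζ₀) := by
  set ℓ := logBranch ζ₀ with hℓ
  have hℓan := analyticAt_logBranch ζ₀
  have hℓ0 : ℓ (Complex.exp ζ₀) = ζ₀ := logBranch_exp_self ζ₀
  have htend : Tendsto ℓ (𝓝 (Complex.exp ζ₀)) (𝓝 ζ₀) := by
    have := hℓan.continuousAt.tendsto
    rwa [← hℓ, hℓ0] at this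
  have hne : ∀ᶠ v in 𝓝 (Complex.exp ζ₀), v ≠ 0 :=
    continuousAt_id.eventually_ne (Complex.exp_ne_zero ζ₀)
  have hXan := htend.eventually hX.eventually_analyticAt
  have d1 : ∀ᶠ v in 𝓝 (Complex.exp ζ₀), HasDerivAt (fun v => Complex.exp (ℓ v / 2) * X (ℓ v))
      (Complex.exp (ℓ v / 2) * (X (ℓ v) / 2 + deriv X (ℓ v)) * v⁻¹) v := by
    filter_upwards [eventually_hasDerivAt_logBranch ζ₀, hXan] with v h1 h2
    have := ((h1.div_const 2).cexp).mul (h2.differentiableAt.hasDerivAt.comp v h1)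
    refine this.congr_deriv ?_
    simp only [Function.comp_apply, ← hℓ]
    ring
  have d1e : deriv (fun v => Complex.exp (ℓ v / 2) * X (ℓ v)) =ᶠ[𝓝 (Complex.exp ζ₀)]
      fun v => Complex.exp (ℓ v / 2) * (X (ℓ v) / 2 + deriv X (ℓ v)) * v⁻¹ :=
    d1.mono fun v h => h.deriv
  refine ⟨((hℓan.div_const).cexp).mul (AnalyticAt.comp (by rwa [hℓ0]) hℓan), ?_⟩
  filter_upwards [d1e.eventuallyEq_nhds, eventually_hasDerivAt_logBranch ζ₀, hXan, hne, hQ,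
    htend.eventually hode, eventually_exp_logBranch ζ₀] with v h1 h2 h3 h4 h5 h6 h7
  rw [h1.deriv_eq]
  have e1 := h3.differentiableAt.hasDerivAt.comp v h2
  have e2 := h3.deriv.differentiableAt.hasDerivAt.comp v h2
  have e := (((h2.div_const 2).cexp).mul ((e1.div_const 2).add e2)).mul (hasDerivAt_inv h4)
  refine e.deriv.trans ?_
  simp only [Function.comp_apply, ← hℓ, Pi.add_apply, Pi.mul_apply] at h7 ⊢
  rw [h6, h7]
  have h8 : Q v = (B v - 1 / 4) / v ^ 2 := by
    rw [eq_div_iff (pow_ne_zero 2 h4), ← h5]; ring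
  rw [h8]
  field_simp
  ring

lemma cover_of_isSolutionAt {Q B y : ℂ → ℂ} {ζ₀ : ℂ} (hy : IsSolutionAt Q y (Complex.exp ζ₀))
    (hQ : ∀ᶠ v in 𝓝 (Complex.exp ζ₀), v ^ 2 * Q v = B v - 1 / 4) :
    AnalyticAt ℂ (fun ζ => Complex.exp (-ζ / 2) * y (Complex.exp ζ)) ζ₀ ∧
    ∀ᶠ ζ in 𝓝 ζ₀, deriv (deriv (fun ζ => Complex.exp (-ζ / 2) * y (Complex.exp ζ))) ζ =
      B (Complex.exp ζ) * (Complex.exp (-ζ / 2) * y (Complex.exp ζ)) := by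
  have htend : Tendsto Complex.exp (𝓝 ζ₀) (𝓝 (Complex.exp ζ₀)) :=
    Complex.continuous_exp.continuousAt
  have hexp : ∀ ζ : ℂ, HasDerivAt (fun ζ => Complex.exp (-ζ / 2))
      (Complex.exp (-ζ / 2) * (-1 / 2)) ζ := fun ζ => ((hasDerivAt_id ζ).neg.div_const 2).cexp
  have d1e : deriv (fun ζ => Complex.exp (-ζ / 2) * y (Complex.exp ζ)) =ᶠ[𝓝 ζ₀] fun ζ =>
      Complex.exp (-ζ / 2) * (deriv y (Complex.exp ζ) * Complex.exp ζ - y (Complex.exp ζ) / 2) := by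
    filter_upwards [htend.eventually hy.eventually] with ζ h
    have := (hexp ζ).mul (h.1.differentiableAt.hasDerivAt.comp ζ (Complex.hasDerivAt_exp ζ))
    refine this.deriv.trans ?_
    simp only [Function.comp_apply]
    ring
  refine ⟨AnalyticAt.mul (by fun_prop) (hy.1.comp (f := Complex.exp) (by fun_prop)), ?_⟩
  filter_upwards [d1e.eventuallyEq_nhds, htend.eventually hy.eventually, htend.eventually hQ]
    with ζ h1 h2 h3
  rw [h1.deriv_eq]
  have e1 := h2.1.differentiableAt.hasDerivAt.comp ζ (Complex.hasDerivAt_exp ζ)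
  have e2 := h2.1.deriv.differentiableAt.hasDerivAt.comp ζ (Complex.hasDerivAt_exp ζ)
  have e := (hexp ζ).mul ((e2.mul (Complex.hasDerivAt_exp ζ)).sub (e1.div_const 2))
  refine e.deriv.trans ?_
  simp only [Function.comp_apply, Pi.sub_apply, Pi.mul_apply]
  rw [h2.2.self_of_nhds]
  linear_combination Complex.exp (-ζ / 2) * y (Complex.exp ζ) * h3

lemma PuncturedDiskCover.map_nhds {r : ℝ} (ζ : PuncturedDiskCover r) :
    map Subtype.val (𝓝 ζ) = 𝓝 ζ.1 :=
  (isOpen_halfPlane (Real.log r)).isOpenEmbedding_subtypeVal.map_nhds_eq ζ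

lemma PuncturedDiskCover.eventually_nhds {r : ℝ} {ζ : PuncturedDiskCover r} {p : ℂ → Prop} :
    (∀ᶠ η in 𝓝 ζ, p η.1) ↔ ∀ᶠ η in 𝓝 ζ.1, p η := by
  rw [← PuncturedDiskCover.map_nhds ζ, eventually_map]

lemma eventually_punctured {r : ℝ} (hr : 0 < r) {ζ : ℂ} (hζ : ζ.re < Real.log r) :
    ∀ᶠ v in 𝓝 (Complex.exp ζ), 0 < ‖v‖ ∧ ‖v‖ < r := by
  refine (continuousAt_id.norm.eventually_const_lt ?_).and
    (continuousAt_id.norm.eventually_lt_const ?_)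
  · exact norm_pos_iff.2 (Complex.exp_ne_zero ζ)
  · exact norm_exp_lt hr hζ

lemma cover_mem_solutionSpace {Q B Z : ℂ → ℂ} {r : ℝ} (hr : 0 < r)
    (hQ : ∀ v : ℂ, 0 < ‖v‖ → ‖v‖ < r → v ^ 2 * Q v = B v - 1 / 4)
    (hZ : ∀ ζ : ℂ, ζ.re < Real.log r → DifferentiableAt ℂ Z ζ)
    (hode : ∀ ζ : ℂ, ζ.re < Real.log r → deriv (deriv Z) ζ = B (Complex.exp ζ) * Z ζ) :
    (fun ζ : PuncturedDiskCover r => Complex.exp (ζ.1 / 2) * Z ζ.1) ∈ solutionSpace Q r := by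
  intro ζ₀
  have hU := (isOpen_halfPlane (Real.log r)).mem_nhds ζ₀.2
  have han : AnalyticAt ℂ Z ζ₀.1 :=
    DifferentiableOn.analyticAt (fun ζ hζ => (hZ ζ hζ).differentiableWithinAt) hU
  refine ⟨_, isSolutionAt_of_cover han (eventually_of_mem hU hode)
    ((eventually_punctured hr ζ₀.2).mono fun v hv => hQ v hv.1 hv.2), ?_⟩
  refine (PuncturedDiskCover.eventually_nhds (p := fun η => Complex.exp (η / 2) * Z η =
    Complex.exp (logBranch ζ₀.1 (Complex.exp η) / 2) * Z (logBranch ζ₀.1 (Complex.exp η)))).2 ?_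
  filter_upwards [eventually_logBranch_exp ζ₀.1] with ζ hζ
  rw [hζ]

/-! ### Monodromy on the two-dimensional solution space -/

namespace IsFrobeniusPair

variable {B : ℂ → ℂ} {r : ℝ} {a c : ℂ} {X Φ : ℂ → ℂ}

lemma hasDerivAt_mul (h : IsFrobeniusPair B r a c X Φ) {ζ : ℂ} (hζ : ζ.re < Real.log r) :
    HasDerivAt (fun ζ => X ζ * Φ ζ) (deriv X ζ * Φ ζ + (X ζ)⁻¹) ζ := by
  refine ((h.differentiableAt ζ hζ).hasDerivAt.mul (h.hasDerivAt ζ hζ)).congr_deriv ?_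
  have := h.ne_zero ζ hζ
  field_simp

lemma analyticAt (h : IsFrobeniusPair B r a c X Φ) {ζ : ℂ} (hζ : ζ.re < Real.log r) :
    AnalyticAt ℂ X ζ :=
  DifferentiableOn.analyticAt (s := {ζ | ζ.re < Real.log r})
    (fun ζ hζ => (h.differentiableAt ζ hζ).differentiableWithinAt)
    ((isOpen_halfPlane (Real.log r)).mem_nhds hζ)

lemma analyticAt' (h : IsFrobeniusPair B r a c X Φ) {ζ : ℂ} (hζ : ζ.re < Real.log r) :
    AnalyticAt ℂ Φ ζ :=
  DifferentiableOn.analyticAt (s := {ζ | ζ.re < Real.log r})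
    (fun ζ hζ => (h.hasDerivAt ζ hζ).differentiableAt.differentiableWithinAt)
    ((isOpen_halfPlane (Real.log r)).mem_nhds hζ)

lemma deriv_deriv_mul (h : IsFrobeniusPair B r a c X Φ) {ζ : ℂ} (hζ : ζ.re < Real.log r) :
    deriv (deriv fun ζ => X ζ * Φ ζ) ζ = B (Complex.exp ζ) * (X ζ * Φ ζ) := by
  have e : deriv (fun ζ => X ζ * Φ ζ) =ᶠ[𝓝 ζ] fun ζ => deriv X ζ * Φ ζ + (X ζ)⁻¹ := by
    filter_upwards [(isOpen_halfPlane (Real.log r)).mem_nhds hζ] with η hη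
    exact (h.hasDerivAt_mul hη).deriv
  rw [e.deriv_eq]
  have hne := h.ne_zero ζ hζ
  have e1 := ((h.analyticAt hζ).deriv.differentiableAt.hasDerivAt.mul (h.hasDerivAt ζ hζ)).add
    ((h.differentiableAt ζ hζ).hasDerivAt.inv hne)
  refine e1.deriv.trans ?_
  rw [h.deriv_deriv ζ hζ]
  field_simp
  ring

/-- The two basic multivalued solutions. -/
noncomputable def sol {Q : ℂ → ℂ} (h : IsFrobeniusPair B r a c X Φ) (hr : 0 < r)
    (hQ : ∀ v : ℂ, 0 < ‖v‖ → ‖v‖ < r → v ^ 2 * Q v = B v - 1 / 4) : Fin 2 → solutionSpace Q r :=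
  ![⟨_, cover_mem_solutionSpace hr hQ h.differentiableAt h.deriv_deriv⟩,
    ⟨_, cover_mem_solutionSpace hr hQ (fun _ hζ => (h.hasDerivAt_mul hζ).differentiableAt)
      (fun _ hζ => h.deriv_deriv_mul hζ)⟩]

/-- Every solution of `Z'' = B (exp ζ) Z` is a combination of `X` and `X Φ`. -/
lemma exists_combination (h : IsFrobeniusPair B r a c X Φ) {Z : ℂ → ℂ}
    (hZ : ∀ ζ : ℂ, ζ.re < Real.log r → AnalyticAt ℂ Z ζ)
    (hode : ∀ ζ : ℂ, ζ.re < Real.log r → deriv (deriv Z) ζ = B (Complex.exp ζ) * Z ζ) :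
    ∃ k w : ℂ, ∀ ζ : ℂ, ζ.re < Real.log r → Z ζ = k * X ζ + w * (X ζ * Φ ζ) := by
  have hUo := isOpen_halfPlane (Real.log r)
  have hUp := (convex_halfPlane (Real.log r)).isPreconnected
  obtain ⟨ζ₀, hζ₀⟩ := nonempty_halfPlane (Real.log r)
  -- The Wronskian `W` of `Z` and `X` is constant and `(Z / X)' = W X⁻² = W Φ'`, so `Z / X - W Φ` is
  -- constant as well.
  set W : ℂ → ℂ := fun ζ => deriv Z ζ * X ζ - Z ζ * deriv X ζ with hW
  have hWd : ∀ ζ : ℂ, ζ.re < Real.log r → HasDerivAt W 0 ζ := by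
    intro ζ hζ
    refine (((hZ ζ hζ).deriv.differentiableAt.hasDerivAt.mul
      (h.differentiableAt ζ hζ).hasDerivAt).sub ((hZ ζ hζ).differentiableAt.hasDerivAt.mul
      (h.analyticAt hζ).deriv.differentiableAt.hasDerivAt)).congr_deriv ?_
    rw [h.deriv_deriv ζ hζ, hode ζ hζ]
    ring
  have hWc : ∀ ζ : ℂ, ζ.re < Real.log r → W ζ = W ζ₀ := fun ζ hζ =>
    hUo.is_const_of_deriv_eq_zero hUp
      (fun x hx => (hWd x hx).differentiableAt.differentiableWithinAt)
      (fun x hx => (hWd x hx).deriv) hζ hζ₀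
  set q : ℂ → ℂ := fun ζ => Z ζ / X ζ - W ζ₀ * Φ ζ with hq
  have hqd : ∀ ζ : ℂ, ζ.re < Real.log r → HasDerivAt q 0 ζ := by
    intro ζ hζ
    refine (((hZ ζ hζ).differentiableAt.hasDerivAt.div (h.differentiableAt ζ hζ).hasDerivAt
      (h.ne_zero ζ hζ)).sub ((h.hasDerivAt ζ hζ).const_mul (W ζ₀))).congr_deriv ?_
    rw [← hWc ζ hζ, hW]
    ring
  have hqc : ∀ ζ : ℂ, ζ.re < Real.log r → q ζ = q ζ₀ := fun ζ hζ =>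
    hUo.is_const_of_deriv_eq_zero hUp
      (fun x hx => (hqd x hx).differentiableAt.differentiableWithinAt)
      (fun x hx => (hqd x hx).deriv) hζ hζ₀
  refine ⟨q ζ₀, W ζ₀, fun ζ hζ => ?_⟩
  have hne := h.ne_zero ζ hζ
  rw [← hqc ζ hζ, hq]
  field_simp
  ring

variable {Q : ℂ → ℂ}

lemma linearIndependent_sol (h : IsFrobeniusPair B r a c X Φ) (hr : 0 < r)
    (hQ : ∀ v : ℂ, 0 < ‖v‖ → ‖v‖ < r → v ^ 2 * Q v = B v - 1 / 4) :
    LinearIndependent ℂ (h.sol hr hQ) := by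
  rw [sol, LinearIndependent.pair_iff]
  intro k w hkw
  have key : ∀ ζ : ℂ, ζ.re < Real.log r → k + w * Φ ζ = 0 := by
    intro ζ hζ
    have h1 := congrFun (congrArg Subtype.val hkw) ⟨ζ, hζ⟩
    have h2 : k * (Complex.exp (ζ / 2) * X ζ) + w * (Complex.exp (ζ / 2) * (X ζ * Φ ζ)) = 0 := h1
    have h3 : Complex.exp (ζ / 2) * X ζ ≠ 0 :=
      mul_ne_zero (Complex.exp_ne_zero _) (h.ne_zero ζ hζ)
    refine mul_left_cancel₀ h3 ?_
    linear_combination h2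
  obtain ⟨ζ₀, hζ₀⟩ := nonempty_halfPlane (Real.log r)
  have hw : w = 0 := by
    have e1 : HasDerivAt (fun ζ => k + w * Φ ζ) (w * (X ζ₀ ^ 2)⁻¹) ζ₀ :=
      ((h.hasDerivAt ζ₀ hζ₀).const_mul w).const_add k
    have e2 := (hasDerivAt_const ζ₀ (0 : ℂ)).congr_of_eventuallyEq
      (f₁ := fun ζ => k + w * Φ ζ) (by
        filter_upwards [(isOpen_halfPlane (Real.log r)).mem_nhds hζ₀] with η hη using key η hη)
    exact (mul_eq_zero.1 (e1.unique e2)).resolve_right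
      (inv_ne_zero (pow_ne_zero 2 (h.ne_zero ζ₀ hζ₀)))
  refine ⟨?_, hw⟩
  have := key ζ₀ hζ₀
  rwa [hw, zero_mul, add_zero] at this

lemma span_sol (h : IsFrobeniusPair B r a c X Φ) (hr : 0 < r)
    (hQ : ∀ v : ℂ, 0 < ‖v‖ → ‖v‖ < r → v ^ 2 * Q v = B v - 1 / 4) :
    ⊤ ≤ Submodule.span ℂ (range (h.sol hr hQ)) := by
  rintro ⟨Y, hY⟩ -
  classical
  set Z : ℂ → ℂ := fun ζ => Complex.exp (-ζ / 2) *
    (if hζ : ζ.re < Real.log r then Y ⟨ζ, hζ⟩ else 0) with hZ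
  have hloc : ∀ ζ₀ : ℂ, ζ₀.re < Real.log r → AnalyticAt ℂ Z ζ₀ ∧
      deriv (deriv Z) ζ₀ = B (Complex.exp ζ₀) * Z ζ₀ := by
    intro ζ₀ hζ₀
    obtain ⟨y, hy, hYy⟩ := hY ⟨ζ₀, hζ₀⟩
    have hev : Z =ᶠ[𝓝 ζ₀] fun ζ => Complex.exp (-ζ / 2) * y (Complex.exp ζ) := by
      have h1 : ∀ᶠ η in 𝓝 ζ₀, ∀ hη : η.re < Real.log r, Y ⟨η, hη⟩ = y (Complex.exp η) := by
        rw [← PuncturedDiskCover.eventually_nhds (ζ := ⟨ζ₀, hζ₀⟩)]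
        filter_upwards [hYy] with η hη _ using hη
      filter_upwards [h1, (isOpen_halfPlane (Real.log r)).mem_nhds hζ₀] with η h1 h2
      have h2' : η.re < Real.log r := h2
      simp only [hZ, dif_pos h2', h1 h2']
    obtain ⟨c1, c2⟩ := cover_of_isSolutionAt hy
      ((eventually_punctured hr hζ₀).mono fun v hv => hQ v hv.1 hv.2)
    refine ⟨c1.congr hev.symm, ?_⟩
    rw [hev.deriv.deriv_eq, c2.self_of_nhds, hev.eq_of_nhds]
  obtain ⟨k, w, hkw⟩ := h.exists_combination (fun ζ hζ => (hloc ζ hζ).1) (fun ζ hζ => (hloc ζ hζ).2)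
  have : (⟨Y, hY⟩ : solutionSpace Q r) = k • h.sol hr hQ 0 + w • h.sol hr hQ 1 := by
    refine Subtype.ext (funext fun ζ => ?_)
    change Y ζ = k * (Complex.exp (ζ.1 / 2) * X ζ.1) + w * (Complex.exp (ζ.1 / 2) * (X ζ.1 * Φ ζ.1))
    have h1 := hkw ζ.1 ζ.2
    simp only [hZ, dif_pos ζ.2] at h1
    have h2 : Complex.exp (ζ.1 / 2) * Complex.exp (-ζ.1 / 2) = 1 := by
      rw [← Complex.exp_add]
      ring_nf
      exact Complex.exp_zero
    calc Y ζ = (Complex.exp (ζ.1 / 2) * Complex.exp (-ζ.1 / 2)) * Y ζ := by rw [h2, one_mul]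
      _ = Complex.exp (ζ.1 / 2) * (k * X ζ.1 + w * (X ζ.1 * Φ ζ.1)) := by
        rw [← h1, mul_assoc]
      _ = _ := by ring
  rw [this]
  exact add_mem (Submodule.smul_mem _ _ (Submodule.subset_span (mem_range_self 0)))
    (Submodule.smul_mem _ _ (Submodule.subset_span (mem_range_self 1)))

/-- This sign change produces the minus sign in the eigenvalues. -/
lemma exp_shift_half (ζ : ℂ) :
    Complex.exp ((ζ + 2 * Real.pi * Complex.I) / 2) = -Complex.exp (ζ / 2) := by
  rw [show (ζ + 2 * Real.pi * Complex.I) / 2 = ζ / 2 + Real.pi * Complex.I by ring,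
    Complex.exp_add, Complex.exp_pi_mul_I]
  ring

/-- In the basis `exp (ζ/2) X`, `exp (ζ/2) X Φ` the monodromy is upper triangular. The constant `c`
only enters off the diagonal, so it does not affect the characteristic polynomial. -/
lemma exists_basis_monodromy (h : IsFrobeniusPair B r a c X Φ) (hr : 0 < r)
    (hQ : ∀ v : ℂ, 0 < ‖v‖ → ‖v‖ < r → v ^ 2 * Q v = B v - 1 / 4) :
    ∃ b : Module.Basis (Fin 2) ℂ (solutionSpace Q r),
      (LinearMap.toMatrix b b (monodromy Q r)).charpoly =
        (Polynomial.X - Polynomial.C (-Complex.exp (2 * Real.pi * Complex.I * a))) *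
          (Polynomial.X - Polynomial.C (-Complex.exp (-(2 * Real.pi * Complex.I * a)))) := by
  set b := Module.Basis.mk (h.linearIndependent_sol hr hQ) (h.span_sol hr hQ) with hb
  set μ := Complex.exp (2 * Real.pi * Complex.I * a) with hμ
  have hμ2 : μ * Complex.exp (-(4 * Real.pi * Complex.I * a)) =
      Complex.exp (-(2 * Real.pi * Complex.I * a)) := by
    rw [hμ, ← Complex.exp_add]
    congr 1
    ring
  have hb0 : monodromy Q r (b 0) = (-μ) • b 0 := by
    rw [hb, Module.Basis.mk_apply]
    refine Subtype.ext (funext fun ζ => ?_)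
    change Complex.exp ((ζ.1 + 2 * Real.pi * Complex.I) / 2) * X (ζ.1 + 2 * Real.pi * Complex.I) =
      -μ * (Complex.exp (ζ.1 / 2) * X ζ.1)
    rw [exp_shift_half, h.shift ζ.1 ζ.2]
    ring
  have hb1 : monodromy Q r (b 1) = (-Complex.exp (-(2 * Real.pi * Complex.I * a))) • b 1
      + (-μ * c) • b 0 := by
    rw [hb, Module.Basis.mk_apply, Module.Basis.mk_apply]
    refine Subtype.ext (funext fun ζ => ?_)
    change Complex.exp ((ζ.1 + 2 * Real.pi * Complex.I) / 2) *
      (X (ζ.1 + 2 * Real.pi * Complex.I) * Φ (ζ.1 + 2 * Real.pi * Complex.I)) =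
      -Complex.exp (-(2 * Real.pi * Complex.I * a)) * (Complex.exp (ζ.1 / 2) * (X ζ.1 * Φ ζ.1))
        + -μ * c * (Complex.exp (ζ.1 / 2) * X ζ.1)
    rw [exp_shift_half, h.shift ζ.1 ζ.2, h.shift' ζ.1 ζ.2, ← hμ2]
    ring
  refine ⟨b, ?_⟩
  have hm : LinearMap.toMatrix b b (monodromy Q r) =
      !![-μ, -μ * c; 0, -Complex.exp (-(2 * Real.pi * Complex.I * a))] := by
    ext i j
    rw [LinearMap.toMatrix_apply]
    fin_cases j
    · simp only [Fin.zero_eta, hb0]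
      fin_cases i <;> simp
    · simp only [Fin.mk_one, hb1]
      fin_cases i <;> simp
  rw [hm, Matrix.charpoly_fin_two, Matrix.trace_fin_two, Matrix.det_fin_two]
  simp
  ring

end IsFrobeniusPair

/-! ### Local coordinates and quadratic differentials -/

section Coordinates

variable {S : Type*} [TopologicalSpace S]

lemma OpenPartialHomeomorph.tendsto_symm_nhds {e : OpenPartialHomeomorph S ℂ} {x : S}
    (hx : x ∈ e.source) : Tendsto e.symm (𝓝 (e x)) (𝓝 x) := by
  have := e.symm.continuousAt (e.map_source hx)
  rwa [ContinuousAt, e.left_inv hx] at this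

lemma deriv_transition_ne_zero_of_analyticAt {e e' : OpenPartialHomeomorph S ℂ}
    {x : S} (hx : x ∈ e.source) (hx' : x ∈ e'.source)
    (h : AnalyticAt ℂ (fun u => e' (e.symm u)) (e x)) :
    deriv (fun u => e' (e.symm u)) (e x) ≠ 0 := by
  refine h.deriv_ne_zero_of_injOn ((e.symm.trans e').open_source.mem_nhds ?_)
    (e.symm.trans e').injOn
  simp [hx, hx']

variable [ChartedSpace ℂ S]

lemma analyticAt_transition {e e' : OpenPartialHomeomorph S ℂ}
    (he : e ∈ IsManifold.maximalAtlas 𝓘(ℂ) ω S) (he' : e' ∈ IsManifold.maximalAtlas 𝓘(ℂ) ω S)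
    {x : S} (hx : x ∈ e.source) (hx' : x ∈ e'.source) :
    AnalyticAt ℂ (fun u => e' (e.symm u)) (e x) := by
  have h1 := contMDiffAt_symm_of_mem_maximalAtlas he (e.map_source hx)
  have h2 := contMDiffAt_of_mem_maximalAtlas he' hx'
  rw [← e.left_inv hx] at h2
  exact (h2.comp (e x) h1).contDiffAt.analyticAt

lemma deriv_transition_ne_zero {e e' : OpenPartialHomeomorph S ℂ}
    (he : e ∈ IsManifold.maximalAtlas 𝓘(ℂ) ω S) (he' : e' ∈ IsManifold.maximalAtlas 𝓘(ℂ) ω S)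
    {x : S} (hx : x ∈ e.source) (hx' : x ∈ e'.source) :
    deriv (fun u => e' (e.symm u)) (e x) ≠ 0 :=
  deriv_transition_ne_zero_of_analyticAt hx hx' (analyticAt_transition he he' hx hx')

/-- Injectivity forces the derivative to be nonzero, so the inverse function theorem makes the
inverse analytic too. -/
lemma mem_maximalAtlas_of_analyticAt [IsManifold 𝓘(ℂ) ω S] {f : OpenPartialHomeomorph S ℂ}
    (h : ∀ x ∈ f.source, ∃ e ∈ IsManifold.maximalAtlas 𝓘(ℂ) ω S, x ∈ e.source ∧
      AnalyticAt ℂ (fun u => f (e.symm u)) (e x)) :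
    f ∈ IsManifold.maximalAtlas 𝓘(ℂ) ω S := by
  refine f.mem_maximalAtlas_of_contMDiffOn (fun x hx => ?_) (fun w hw => ?_)
  · obtain ⟨e, he, hxe, han⟩ := h x hx
    have h1 : ContMDiffAt 𝓘(ℂ) 𝓘(ℂ) ω ((fun u => f (e.symm u)) ∘ e) x :=
      han.contDiffAt.contMDiffAt.comp x (contMDiffAt_of_mem_maximalAtlas he hxe)
    refine (h1.congr_of_eventuallyEq ?_).contMDiffWithinAt
    filter_upwards [e.open_source.mem_nhds hxe] with y hy
    simp [e.left_inv hy]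
  · set x := f.symm w with hx
    have hxf : x ∈ f.source := f.map_target hw
    have hfx : f x = w := f.right_inv hw
    obtain ⟨e, he, hxe, han⟩ := h x hxf
    set t := e.symm.trans f with ht
    have hmem : e x ∈ t.source := by simp [ht, hxe, hxf]
    have hd : deriv t (e x) ≠ 0 :=
      deriv_transition_ne_zero_of_analyticAt (e := e) (e' := f) hxe hxf han
    have hfd : fderiv ℂ t (e x) =
        (ContinuousLinearEquiv.unitsEquivAut ℂ (Units.mk0 _ hd) : ℂ →L[ℂ] ℂ) := by
      ext
      simp
    have h1 : AnalyticAt ℂ t.symm (t (e x)) := t.analyticAt_symm' hmem han hfd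
    have htx : t (e x) = w := by simp [ht, e.left_inv hxe, hfx]
    rw [htx] at h1
    have htw : t.symm w = e x := by simp [ht, ← hx]
    have h2 : ContMDiffAt 𝓘(ℂ) 𝓘(ℂ) ω (e.symm ∘ t.symm) w := by
      refine ContMDiffAt.comp w ?_ h1.contDiffAt.contMDiffAt
      rw [htw]
      exact contMDiffAt_symm_of_mem_maximalAtlas he (e.map_source hxe)
    refine (h2.congr_of_eventuallyEq ?_).contMDiffWithinAt
    have hev : ∀ᶠ v in 𝓝 w, f.symm v ∈ e.source :=
      (f.symm.continuousAt hw).eventually (e.open_source.mem_nhds hxe)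
    filter_upwards [hev] with v hv
    simp [ht, e.left_inv hv]

namespace MeromorphicQuadraticDifferential

variable (φ : MeromorphicQuadraticDifferential S)

lemma eventually_coeff_eq {e e' : OpenPartialHomeomorph S ℂ}
    (he : e ∈ IsManifold.maximalAtlas 𝓘(ℂ) ω S) (he' : e' ∈ IsManifold.maximalAtlas 𝓘(ℂ) ω S)
    {x : S} (hx : x ∈ e.source) (hx' : x ∈ e'.source) :
    ∀ᶠ u in 𝓝 (e x), φ.coeff e u =
      φ.coeff e' (e' (e.symm u)) * deriv (fun u => e' (e.symm u)) u ^ 2 := by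
  filter_upwards [e.open_target.mem_nhds (e.map_source hx),
    (OpenPartialHomeomorph.tendsto_symm_nhds hx).eventually (e'.open_source.mem_nhds hx')]
    with u hu hu'
  have := φ.transform e he e' he' (e.symm u) ⟨e.map_target hu, hu'⟩
  rwa [e.right_inv hu] at this

lemma analyticAt_coeff_transition {e e' : OpenPartialHomeomorph S ℂ}
    (he : e ∈ IsManifold.maximalAtlas 𝓘(ℂ) ω S) (he' : e' ∈ IsManifold.maximalAtlas 𝓘(ℂ) ω S)
    {x : S} (hx : x ∈ e.source) (hx' : x ∈ e'.source) (h : AnalyticAt ℂ (φ.coeff e') (e' x)) :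
    AnalyticAt ℂ (φ.coeff e) (e x) := by
  have hτ := analyticAt_transition he he' hx hx'
  have h1 : AnalyticAt ℂ (φ.coeff e') (e' (e.symm (e x))) := by rwa [e.left_inv hx]
  exact ((h1.comp (f := fun u => e' (e.symm u)) hτ).mul (hτ.deriv.pow 2)).congr
    ((φ.eventually_coeff_eq he he' hx hx').mono fun u hu => hu.symm)

/-- Here the normal form matters: a meromorphic function in normal form with nonnegative order is
itself analytic, with no value to correct. -/
lemma notMem_poles_iff [IsManifold 𝓘(ℂ) ω S] {x : S} {e : OpenPartialHomeomorph S ℂ}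
    (he : e ∈ IsManifold.maximalAtlas 𝓘(ℂ) ω S) (hx : x ∈ e.source) :
    x ∉ φ.poles ↔ AnalyticAt ℂ (φ.coeff e) (e x) := by
  have hc := IsManifold.chart_mem_maximalAtlas (I := 𝓘(ℂ)) (n := ω) x
  have hnf := φ.meromorphic _ hc (mem_chart_target ℂ x)
  have h1 : x ∉ φ.poles ↔ AnalyticAt ℂ (φ.coeff (chartAt ℂ x)) (chartAt ℂ x x) := by
    rw [← hnf.meromorphicOrderAt_nonneg_iff_analyticAt]
    exact not_lt (α := WithTop ℤ)
  rw [h1]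
  exact ⟨φ.analyticAt_coeff_transition he hc hx (mem_chart_source ℂ x),
    φ.analyticAt_coeff_transition hc he (mem_chart_source ℂ x) hx⟩

lemma eventually_notMem_poles [IsManifold 𝓘(ℂ) ω S] (p : S) : ∀ᶠ x in 𝓝[≠] p, x ∉ φ.poles := by
  have hc := IsManifold.chart_mem_maximalAtlas (I := 𝓘(ℂ)) (n := ω) p
  set e := chartAt ℂ p with he
  have hp : p ∈ e.source := mem_chart_source ℂ p
  have h1 := (φ.meromorphic _ hc (e.map_source hp)).meromorphicAt.eventually_analyticAt
  have h2 : Tendsto e (𝓝[≠] p) (𝓝[≠] (e p)) := by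
    refine tendsto_nhdsWithin_iff.2 ⟨(e.continuousAt hp).mono_left nhdsWithin_le_nhds, ?_⟩
    filter_upwards [self_mem_nhdsWithin,
      mem_nhdsWithin_of_mem_nhds (e.open_source.mem_nhds hp)] with x hx hxs
    exact fun h => hx (e.injOn hxs hp h)
  filter_upwards [h2.eventually h1, mem_nhdsWithin_of_mem_nhds (e.open_source.mem_nhds hp)]
    with x hx hxs
  exact (φ.notMem_poles_iff hc hxs).2 hx

/-- The leading coefficient at order `-2` is independent of the coordinate: for a transition map `τ`
the correction factor `(τ' (u - e p) / (τ u - e' p))²` tends to `1`. -/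
lemma tendsto_sq_mul_coeff {e e' : OpenPartialHomeomorph S ℂ}
    (he : e ∈ IsManifold.maximalAtlas 𝓘(ℂ) ω S) (he' : e' ∈ IsManifold.maximalAtlas 𝓘(ℂ) ω S)
    {p : S} (hp : p ∈ e.source) (hp' : p ∈ e'.source) {l : ℂ}
    (h : Tendsto (fun u => (u - e' p) ^ 2 * φ.coeff e' u) (𝓝[≠] (e' p)) (𝓝 l)) :
    Tendsto (fun u => (u - e p) ^ 2 * φ.coeff e u) (𝓝[≠] (e p)) (𝓝 l) := by
  set τ : ℂ → ℂ := fun u => e' (e.symm u) with hτ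
  have hτan : AnalyticAt ℂ τ (e p) := analyticAt_transition he he' hp hp'
  have hτ' : deriv τ (e p) ≠ 0 := deriv_transition_ne_zero he he' hp hp'
  have hτp : τ (e p) = e' p := by simp [hτ, e.left_inv hp]
  have hne : ∀ᶠ u in 𝓝[≠] (e p), τ u ≠ e' p := by
    rw [← hτp]
    exact hτan.differentiableAt.hasDerivAt.eventually_ne hτ'
  have ht : Tendsto τ (𝓝[≠] (e p)) (𝓝[≠] (e' p)) := by
    refine tendsto_nhdsWithin_iff.2 ⟨?_, hne⟩
    have := hτan.continuousAt.tendsto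
    rw [hτp] at this
    exact this.mono_left nhdsWithin_le_nhds
  have hslope : Tendsto (fun u => (τ u - e' p) / (u - e p)) (𝓝[≠] (e p)) (𝓝 (deriv τ (e p))) := by
    have := hasDerivAt_iff_tendsto_slope.1 hτan.differentiableAt.hasDerivAt
    refine this.congr fun u => ?_
    rw [slope_def_field, hτp]
  have hd : Tendsto (deriv τ) (𝓝[≠] (e p)) (𝓝 (deriv τ (e p))) :=
    hτan.deriv.continuousAt.tendsto.mono_left nhdsWithin_le_nhds
  have hlim := (h.comp ht).mul ((hd.div hslope hτ').pow 2)
  rw [div_self hτ', one_pow, mul_one] at hlim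
  refine hlim.congr' ?_
  filter_upwards [hne, self_mem_nhdsWithin,
    (φ.eventually_coeff_eq he he' hp hp').filter_mono nhdsWithin_le_nhds] with u h1 h2 h3
  have h4 : u - e p ≠ 0 := sub_ne_zero.2 h2
  have h5 : τ u - e' p ≠ 0 := sub_ne_zero.2 h1
  rw [h3]
  simp only [Function.comp_apply, Pi.div_apply]
  change _ = (u - e p) ^ 2 * (φ.coeff e' (τ u) * deriv τ u ^ 2)
  field_simp

lemma tendsto_of_isResidue {p : S} {s : ℂ} {e e' : OpenPartialHomeomorph S ℂ}
    (he : e ∈ IsManifold.maximalAtlas 𝓘(ℂ) ω S) (he' : e' ∈ IsManifold.maximalAtlas 𝓘(ℂ) ω S)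
    (hp : p ∈ e.source) (hp' : p ∈ e'.source) (hp0 : e' p = 0)
    (h : Tendsto (fun u => u ^ 2 * φ.coeff e' u) (𝓝[≠] 0) (𝓝 (s ^ 2))) :
    Tendsto (fun u => (u - e p) ^ 2 * φ.coeff e u) (𝓝[≠] (e p)) (𝓝 (s ^ 2)) := by
  refine φ.tendsto_sq_mul_coeff he he' hp hp' ?_
  simpa [hp0] using h

/-- At a pole of order exactly two, `(u - x)² φ` has order zero, whereas the limit zero would
require positive order. -/
lemma leading_coeff_ne_zero [IsManifold 𝓘(ℂ) ω S] {p : S} (hp : φ.order p = ((-2 : ℤ) : WithTop ℤ)) {l : ℂ}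
    (h : Tendsto (fun u => (u - chartAt ℂ p p) ^ 2 * φ.coeff (chartAt ℂ p) u)
      (𝓝[≠] (chartAt ℂ p p)) (𝓝 l)) : l ≠ 0 := by
  rintro rfl
  have hc := IsManifold.chart_mem_maximalAtlas (I := 𝓘(ℂ)) (n := ω) p
  have hm := (φ.meromorphic _ hc (mem_chart_target ℂ p)).meromorphicAt
  set x := chartAt ℂ p p
  have hlin : AnalyticAt ℂ (fun u => (u - x) ^ 2) x := by fun_prop
  have ho : meromorphicOrderAt (fun u => (u - x) ^ 2) x = 2 := by
    rw [hlin.meromorphicOrderAt_eq]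
    have : analyticOrderAt (fun u => (u - x) ^ 2) x = 2 := by
      have h2 : ((2 : ℕ) : ℕ∞) = 2 := rfl
      rw [← h2, hlin.analyticOrderAt_eq_natCast]
      exact ⟨fun _ => 1, analyticAt_const, one_ne_zero, by simp⟩
    rw [this]
    rfl
  have h1 := (tendsto_zero_iff_meromorphicOrderAt_pos
    (f := (fun u => (u - x) ^ 2) * φ.coeff (chartAt ℂ p)) (hlin.meromorphicAt.mul hm)).1 h
  rw [meromorphicOrderAt_mul hlin.meromorphicAt hm, ho,
    show meromorphicOrderAt (φ.coeff (chartAt ℂ p)) x = _ from hp] at h1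
  exact absurd h1 (by decide)

end MeromorphicQuadraticDifferential

end Coordinates

/-! ### Schwarzian derivatives of charts of projective structures -/

lemma OnePoint.coe_eq_smul_coe {N : GL (Fin 2) ℂ} {a b : ℂ}
    (h : ((a : ℂ) : OnePoint ℂ) = N • ((b : ℂ) : OnePoint ℂ)) :
    N 1 0 * b + N 1 1 ≠ 0 ∧ a = (N 0 0 * b + N 0 1) / (N 1 0 * b + N 1 1) := by
  rw [OnePoint.smul_some_eq_ite] at h
  split_ifs at h with h0
  · exact absurd h (OnePoint.coe_ne_infty a)
  · exact ⟨h0, by exact_mod_cast h⟩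

/-- A Möbius map is a ratio of two independent solutions of `y'' = 0`, so its own Schwarzian
vanishes. -/
lemma schwarzian_smul {N : GL (Fin 2) ℂ} {h h' : ℂ → ℂ} {u : ℂ} (hh : AnalyticAt ℂ h u)
    (hd : deriv h u ≠ 0)
    (hN : ∀ᶠ v in 𝓝 u, ((h' v : ℂ) : OnePoint ℂ) = N • ((h v : ℂ) : OnePoint ℂ)) :
    schwarzian h' u = schwarzian h u := by
  have hev : h' =ᶠ[𝓝 u] fun v => (N 0 0 * h v + N 0 1) / (N 1 0 * h v + N 1 1) :=
    hN.mono fun v hv => (OnePoint.coe_eq_smul_coe hv).2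
  have h0 := (OnePoint.coe_eq_smul_coe hN.self_of_nhds).1
  have s1 : ∀ a b x : ℂ, IsSolutionAt (fun _ => 0) (fun t => a * t + b) x := by
    intro a b x
    refine ⟨by fun_prop, ?_⟩
    filter_upwards with v
    have : deriv (fun t : ℂ => a * t + b) = fun _ => a := by
      funext t
      rw [deriv_add_const, deriv_const_mul_field, deriv_id'', mul_one]
    rw [this]
    simp
  have hdet : N 0 0 * N 1 1 - N 0 1 * N 1 0 ≠ 0 := by
    rw [← Matrix.det_fin_two]
    exact N.det_ne_zero
  have hder : ∀ a b x : ℂ, deriv (fun t : ℂ => a * t + b) x = a := by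
    intro a b x
    rw [deriv_add_const, deriv_const_mul_field, deriv_id'', mul_one]
  have hW : wronskian (fun t => N 0 0 * t + N 0 1) (fun t => N 1 0 * t + N 1 1) (h u) ≠ 0 := by
    unfold wronskian
    rw [hder, hder]
    convert hdet using 1
    ring
  have hm : AnalyticAt ℂ (fun t => (N 0 0 * t + N 0 1) / (N 1 0 * t + N 1 1)) (h u) :=
    (s1 _ _ _).1.div (s1 _ _ _).1 h0
  rw [schwarzian_congr hev, schwarzian_comp
    (f := fun t => (N 0 0 * t + N 0 1) / (N 1 0 * t + N 1 1)) hm hh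
    (deriv_div_ne_zero_of_isSolutionAt (s1 _ _ _) (s1 _ _ _) h0 hW) hd,
    schwarzian_div_of_isSolutionAt (s1 _ _ _) (s1 _ _ _) h0 hW]
  ring

section

variable {S : Type*} [TopologicalSpace S]

/-- A complex valued local coordinate, regarded as a map to the projective line. -/
noncomputable def OpenPartialHomeomorph.toP1 (w : OpenPartialHomeomorph S ℂ) :
    OpenPartialHomeomorph S (OnePoint ℂ) :=
  w.trans (OnePoint.isOpenEmbedding_coe (X := ℂ)).toOpenPartialHomeomorph

lemma OpenPartialHomeomorph.toP1_apply (w : OpenPartialHomeomorph S ℂ) (x : S) :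
    w.toP1 x = ((w x : ℂ) : OnePoint ℂ) := rfl

lemma OpenPartialHomeomorph.toP1_source (w : OpenPartialHomeomorph S ℂ) :
    w.toP1.source = w.source := by
  simp [OpenPartialHomeomorph.toP1]

end

section

variable {S : Type*} [TopologicalSpace S] [ChartedSpace ℂ S]

/-- The local coordinate `z` is, near `x`, a finite chart of the projective structure `P`. -/
def ProjectiveStructure.IsAffineChartAt {U : Set S} (P : ProjectiveStructure U)
    (z : OpenPartialHomeomorph S ℂ) (x : S) : Prop :=
  z ∈ IsManifold.maximalAtlas 𝓘(ℂ) ω S ∧ x ∈ z.source ∧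
    ∃ c ∈ P.charts, x ∈ c.source ∧ ∀ᶠ y in 𝓝 x, c y = ((z y : ℂ) : OnePoint ℂ)

namespace ProjectiveStructure

variable {U : Set S} {P : ProjectiveStructure U}

lemma IsAffineChartAt.eventually {z : OpenPartialHomeomorph S ℂ} {x : S}
    (h : P.IsAffineChartAt z x) : ∀ᶠ y in 𝓝 x, P.IsAffineChartAt z y := by
  obtain ⟨hz, hx, c, hc, hxc, hev⟩ := h
  filter_upwards [z.open_source.mem_nhds hx, c.open_source.mem_nhds hxc, hev.eventually_nhds]
    with y h1 h2 h3
  exact ⟨hz, h1, c, hc, h2, h3⟩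

lemma IsAffineChartAt.exists_smul {z z' : OpenPartialHomeomorph S ℂ} {x : S}
    (h : P.IsAffineChartAt z x) (h' : P.IsAffineChartAt z' x) :
    ∃ N : GL (Fin 2) ℂ, ∀ᶠ y in 𝓝 x, ((z' y : ℂ) : OnePoint ℂ) = N • ((z y : ℂ) : OnePoint ℂ) := by
  obtain ⟨-, -, c, hc, hxc, hev⟩ := h
  obtain ⟨-, -, c', hc', hxc', hev'⟩ := h'
  obtain ⟨N, hN⟩ := P.compatible c hc c' hc' x ⟨hxc, hxc'⟩
  refine ⟨N, ?_⟩
  filter_upwards [hev, hev', hN] with y h1 h2 h3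
  rw [← h1, ← h2, h3]

lemma IsAffineChartAt.schwarzian_eq {z z' e : OpenPartialHomeomorph S ℂ} {x : S}
    (h : P.IsAffineChartAt z x) (h' : P.IsAffineChartAt z' x)
    (he : e ∈ IsManifold.maximalAtlas 𝓘(ℂ) ω S) (hx : x ∈ e.source) :
    schwarzian (fun v => z' (e.symm v)) (e x) = schwarzian (fun v => z (e.symm v)) (e x) := by
  obtain ⟨N, hN⟩ := h.exists_smul h'
  exact schwarzian_smul (analyticAt_transition he h.1 hx h.2.1)
    (deriv_transition_ne_zero he h.1 hx h.2.1)
    ((OpenPartialHomeomorph.tendsto_symm_nhds hx).eventually hN)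

variable {φ : MeromorphicQuadraticDifferential S}

/-- In an affine chart `z` of `P` the Schwarzian of `w` is `-2 φ`. Passing to `e` by the cocycle
rule transforms `φ` as a quadratic differential and adds the Schwarzian of `z`, which may be
replaced by that of any other affine chart. -/
lemma schwarzian_of_mem_addCharts {w : OpenPartialHomeomorph S (OnePoint ℂ)}
    (hw : w ∈ P.addCharts φ) {x : S} (hx : x ∈ w.source) (hfin : w x ≠ OnePoint.infty)
    {e : OpenPartialHomeomorph S ℂ} (he : e ∈ IsManifold.maximalAtlas 𝓘(ℂ) ω S)
    (hxe : x ∈ e.source) {z₀ : OpenPartialHomeomorph S ℂ} (hz₀ : P.IsAffineChartAt z₀ x) :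
    schwarzian (fun v => (w (e.symm v)).elim 0 id) (e x) =
      -2 * φ.coeff e (e x) + schwarzian (fun v => z₀ (e.symm v)) (e x) := by
  obtain ⟨-, -, hloc⟩ := hw
  obtain ⟨z, hz, hxz, hc, y₁, y₂, h₁, h₂, hW, hev⟩ := hloc x hx
  have haff : P.IsAffineChartAt z x := ⟨hz, hxz, hc⟩
  have hy₂ : y₂ (z x) ≠ 0 := by
    intro h0
    apply hfin
    rw [hev.self_of_nhds, projPoint, if_pos h0]
  have hτ := analyticAt_transition he hz hxe hxz
  have hτ' := deriv_transition_ne_zero he hz hxe hxz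
  have hzx : z (e.symm (e x)) = z x := by rw [e.left_inv hxe]
  have hne : ∀ᶠ v in 𝓝 (e x), y₂ (z (e.symm v)) ≠ 0 := by
    have : ContinuousAt (fun v => y₂ (z (e.symm v))) (e x) :=
      ContinuousAt.comp (g := y₂) (by rw [hzx]; exact h₂.1.continuousAt) hτ.continuousAt
    exact this.eventually_ne (by rwa [hzx])
  have hcongr : (fun v => (w (e.symm v)).elim 0 id) =ᶠ[𝓝 (e x)]
      fun v => (fun t => y₁ t / y₂ t) (z (e.symm v)) := by
    filter_upwards [(OpenPartialHomeomorph.tendsto_symm_nhds hxe).eventually hev, hne] with v e1 e2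
    rw [e1, projPoint, if_neg e2]
    rfl
  rw [schwarzian_congr hcongr, schwarzian_comp (f := fun t => y₁ t / y₂ t)
    (by rw [hzx]; exact h₁.1.div h₂.1 hy₂) hτ
    (by rw [hzx]; exact deriv_div_ne_zero_of_isSolutionAt h₁ h₂ hy₂ hW) hτ', hzx,
    schwarzian_div_of_isSolutionAt h₁ h₂ hy₂ hW, hz₀.schwarzian_eq haff he hxe]
  have := (φ.eventually_coeff_eq he hz hxe hxz).self_of_nhds
  rw [hzx] at this
  rw [this]
  ring

/-- A function `f` of the local coordinate `e` with the Schwarzian derivative of the charts of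
`P + φ` is locally a ratio of solutions of `y'' = φ y` in any affine chart of `P`. -/
lemma exists_solutions {e z : OpenPartialHomeomorph S ℂ}
    (he : e ∈ IsManifold.maximalAtlas 𝓘(ℂ) ω S) {x : S} (hxe : x ∈ e.source)
    (hz : P.IsAffineChartAt z x) {f : ℂ → ℂ} (hf : AnalyticAt ℂ f (e x)) (hf' : deriv f (e x) ≠ 0)
    (hS : ∀ᶠ v in 𝓝 (e x), ∀ z, P.IsAffineChartAt z (e.symm v) →
      schwarzian f v = -2 * φ.coeff e v + schwarzian (fun v => z (e.symm v)) v) :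
    ∃ y₁ y₂ : ℂ → ℂ, IsSolutionAt (φ.coeff z) y₁ (z x) ∧ IsSolutionAt (φ.coeff z) y₂ (z x) ∧
      wronskian y₁ y₂ (z x) ≠ 0 ∧ ∀ᶠ y in 𝓝 x, y₂ (z y) ≠ 0 ∧ f (e y) = y₁ (z y) / y₂ (z y) := by
  set ρ : ℂ → ℂ := fun t => e (z.symm t) with hρ
  have hρan := analyticAt_transition hz.1 he hz.2.1 hxe
  have hρ' := deriv_transition_ne_zero hz.1 he hz.2.1 hxe
  have hρx : ρ (z x) = e x := by simp [hρ, z.left_inv hz.2.1]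
  have hfρ : AnalyticAt ℂ (fun t => f (ρ t)) (z x) := AnalyticAt.comp (by rwa [hρx]) hρan
  have hfρ' : deriv (fun t => f (ρ t)) (z x) ≠ 0 := by
    have := (AnalyticAt.eventually_deriv_comp (f := f) (g := ρ) (by rwa [hρx]) hρan).self_of_nhds
    rw [this]
    change deriv f (ρ (z x)) * deriv ρ (z x) ≠ 0
    rw [hρx]
    exact mul_ne_zero hf' hρ'
  have hzt := OpenPartialHomeomorph.tendsto_symm_nhds hz.2.1
  have hρt : Tendsto ρ (𝓝 (z x)) (𝓝 (e x)) := by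
    have := hρan.continuousAt.tendsto
    rwa [show e (z.symm (z x)) = e x from hρx] at this
  have hsch : ∀ᶠ t in 𝓝 (z x), schwarzian (fun t => f (ρ t)) t = -2 * φ.coeff z t := by
    have hne : ∀ᶠ v in 𝓝 (e x), deriv f v ≠ 0 := hf.deriv.continuousAt.eventually_ne hf'
    filter_upwards [hρt.eventually hS, hzt.eventually hz.eventually,
      φ.eventually_coeff_eq hz.1 he hz.2.1 hxe, hρt.eventually hf.eventually_analyticAt,
      hρan.eventually_analyticAt, hρt.eventually hne, hzt.eventually (e.open_source.mem_nhds hxe),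
      z.open_target.mem_nhds (z.map_source hz.2.1)] with t h1 h2 h3 h4 h5 h6 h7 h8
    have hzs : z.symm t ∈ z.source := z.map_target h8
    have hinv : e.symm (ρ t) = z.symm t := e.left_inv h7
    have hτ := analyticAt_transition he hz.1 h7 hzs
    have hτ' := deriv_transition_ne_zero he hz.1 h7 hzs
    have hρ't : deriv ρ t ≠ 0 := by
      have := deriv_transition_ne_zero hz.1 he hzs h7
      rwa [z.right_inv h8] at this
    have hid : (fun t => (fun v => z (e.symm v)) (ρ t)) =ᶠ[𝓝 t] id := by
      have e1 : Tendsto z.symm (𝓝 t) (𝓝 (z.symm t)) := z.symm.continuousAt h8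
      filter_upwards [e1.eventually (e.open_source.mem_nhds h7), z.open_target.mem_nhds h8]
        with t' k1 k2
      simp [hρ, e.left_inv k1, z.right_inv k2]
    have hid0 : schwarzian (id : ℂ → ℂ) t = 0 := by
      unfold schwarzian
      simp
    -- Since `z ∘ e⁻¹ ∘ ρ` is the identity, the cocycle rule cancels the Schwarzian of `ρ` against
    -- the pulled-back Schwarzian of `z ∘ e⁻¹`, leaving `-2 φ` in the coordinate `z`.
    have h9 := schwarzian_comp (f := fun v => z (e.symm v)) (g := ρ) (u := t) hτ h5 hτ' hρ't
    rw [schwarzian_congr hid, hid0] at h9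
    rw [schwarzian_comp h4 h5 h6 hρ't, h1 z (by rwa [hinv]), h3]
    linear_combination -h9
  obtain ⟨y₁, y₂, s₁, s₂, hW, hy⟩ := exists_isSolutionAt_of_schwarzian hfρ hfρ' hsch
  refine ⟨y₁, y₂, s₁, s₂, hW, ?_⟩
  filter_upwards [(z.continuousAt hz.2.1).eventually hy, z.open_source.mem_nhds hz.2.1]
    with y h1 h2
  simpa [hρ, z.left_inv h2] using h1

/-- Solutions of `y'' = q y` are combinations of two independent ones. -/
lemma _root_.IsSolutionAt.eventually_eq_combination {q y y₁ y₂ : ℂ → ℂ} {u : ℂ}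
    (h : IsSolutionAt q y u) (h₁ : IsSolutionAt q y₁ u) (h₂ : IsSolutionAt q y₂ u)
    (hW : wronskian y₁ y₂ u ≠ 0) :
    ∀ᶠ v in 𝓝 u, y v = (wronskian y y₂ u / wronskian y₁ y₂ u) * y₁ v +
      (wronskian y₁ y u / wronskian y₁ y₂ u) * y₂ v := by
  filter_upwards [h.eventually_wronskian_eq h₂, h₁.eventually_wronskian_eq h,
    h₁.eventually_wronskian_eq h₂] with v e1 e2 e3
  rw [← e1, ← e2, ← e3]
  rw [← e3] at hW
  field_simp
  unfold wronskian
  ring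

lemma projPoint_eq_smul {N : GL (Fin 2) ℂ} {a b : ℂ} (hb : b ≠ 0) :
    projPoint (N 0 0 * a + N 0 1 * b) (N 1 0 * a + N 1 1 * b) =
      N • ((a / b : ℂ) : OnePoint ℂ) := by
  rw [OnePoint.smul_some_eq_ite, projPoint]
  have h1 : N 1 0 * (a / b) + N 1 1 = (N 1 0 * a + N 1 1 * b) / b := by field_simp
  have h2 : N 0 0 * (a / b) + N 0 1 = (N 0 0 * a + N 0 1 * b) / b := by field_simp
  rw [h1, h2, div_div_div_cancel_right₀ hb]
  simp [hb]

/-- Both `w` and `f` are ratios of solutions of the same linear equation in one affine chart. The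
change of basis between the two pairs is the required matrix, and the Wronskians show that it is
invertible. -/
lemma exists_smul_of_mem_addCharts {w : OpenPartialHomeomorph S (OnePoint ℂ)}
    (hw : w ∈ P.addCharts φ) {x : S} (hx : x ∈ w.source)
    {e : OpenPartialHomeomorph S ℂ} (he : e ∈ IsManifold.maximalAtlas 𝓘(ℂ) ω S)
    (hxe : x ∈ e.source) {f : ℂ → ℂ} (hf : AnalyticAt ℂ f (e x)) (hf' : deriv f (e x) ≠ 0)
    (hS : ∀ᶠ v in 𝓝 (e x), ∀ z, P.IsAffineChartAt z (e.symm v) →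
      schwarzian f v = -2 * φ.coeff e v + schwarzian (fun v => z (e.symm v)) v) :
    ∃ N : GL (Fin 2) ℂ, ∀ᶠ y in 𝓝 x, w y = N • ((f (e y) : ℂ) : OnePoint ℂ) := by
  obtain ⟨-, -, hloc⟩ := hw
  obtain ⟨z, hz, hxz, hc, Y₁, Y₂, H₁, H₂, HW, hev⟩ := hloc x hx
  obtain ⟨y₁, y₂, h₁, h₂, hW, hy⟩ := exists_solutions he hxe ⟨hz, hxz, hc⟩ hf hf' hS
  set d := wronskian y₁ y₂ (z x) with hd
  set M : Matrix (Fin 2) (Fin 2) ℂ := !![wronskian Y₁ y₂ (z x) / d, wronskian y₁ Y₁ (z x) / d;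
    wronskian Y₂ y₂ (z x) / d, wronskian y₁ Y₂ (z x) / d] with hM
  have c1 := H₁.eventually_eq_combination h₁ h₂ hW
  have c2 := H₂.eventually_eq_combination h₁ h₂ hW
  have hdet : M.det ≠ 0 := by
    rw [Matrix.det_fin_two]
    simp only [hM, Matrix.of_apply, Matrix.cons_val', Matrix.cons_val_zero, Matrix.cons_val_one,
      Matrix.cons_val_fin_one]
    intro h0
    apply HW
    have : deriv Y₁ (z x) * Y₂ (z x) - Y₁ (z x) * deriv Y₂ (z x) =
        d * (wronskian Y₁ y₂ (z x) / d * (wronskian y₁ Y₂ (z x) / d) -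
          wronskian y₁ Y₁ (z x) / d * (wronskian Y₂ y₂ (z x) / d)) := by
      field_simp
      rw [hd]
      unfold wronskian
      ring
    rw [this, h0, mul_zero]
  refine ⟨Matrix.GeneralLinearGroup.mkOfDetNeZero M hdet, ?_⟩
  have hzt := z.continuousAt hxz
  filter_upwards [hev, hy, hzt.eventually c1, hzt.eventually c2] with y e1 e2 e3 e4
  rw [e1, e2.2, ← projPoint_eq_smul e2.1, e3, e4]
  rfl

end ProjectiveStructure

/-- A locally injective holomorphic function of a local coordinate restricts to a local
coordinate, with arbitrarily small domain. -/
lemma exists_coordinate [IsManifold 𝓘(ℂ) ω S] {e : OpenPartialHomeomorph S ℂ}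
    (he : e ∈ IsManifold.maximalAtlas 𝓘(ℂ) ω S) {x : S} (hxe : x ∈ e.source) {f : ℂ → ℂ}
    (hf : AnalyticAt ℂ f (e x)) (hf' : deriv f (e x) ≠ 0) {p : S → Prop} (hp : ∀ᶠ y in 𝓝 x, p y) :
    ∃ w ∈ IsManifold.maximalAtlas 𝓘(ℂ) ω S, x ∈ w.source ∧ (∀ y ∈ w.source, p y) ∧
      ∀ y ∈ w.source, w y = f (e y) := by
  have hfd : HasStrictFDerivAt f
      ((ContinuousLinearEquiv.unitsEquivAut ℂ (Units.mk0 _ hf') : ℂ ≃L[ℂ] ℂ) : ℂ →L[ℂ] ℂ) (e x) :=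
    hf.hasStrictDerivAt.hasStrictFDerivAt_equiv hf'
  set F := hfd.toOpenPartialHomeomorph f with hF
  have hFf : ∀ v, F v = f v := fun v => rfl
  have hxF : e x ∈ F.source := hfd.mem_toOpenPartialHomeomorph_source
  obtain ⟨V, hVp, hVo, hxV⟩ := eventually_nhds_iff.1
    (hp.and ((e.continuousAt hxe).eventually hf.eventually_analyticAt))
  set w := (e.trans F).restrOpen V hVo with hw
  refine ⟨w, mem_maximalAtlas_of_analyticAt fun y hy => ?_, ?_, fun y hy => ?_, fun y hy => rfl⟩
  · have hye : y ∈ e.source := by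
      simp only [hw, OpenPartialHomeomorph.restrOpen_source, OpenPartialHomeomorph.trans_source] at hy
      exact hy.1.1
    refine ⟨e, he, hye, ?_⟩
    have h1 : AnalyticAt ℂ f (e y) := (hVp y (by
      simp only [hw, OpenPartialHomeomorph.restrOpen_source] at hy
      exact hy.2)).2
    refine h1.congr ?_
    filter_upwards [e.open_target.mem_nhds (e.map_source hye)] with v hv
    change f v = f (e (e.symm v))
    rw [e.right_inv hv]
  · simp [hw, hxe, hxF, hxV]
  · refine (hVp y ?_).1
    simp only [hw, OpenPartialHomeomorph.restrOpen_source] at hy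
    exact hy.2

lemma isP1Chart_toP1 [IsManifold 𝓘(ℂ) ω S] {w : OpenPartialHomeomorph S ℂ}
    (hw : w ∈ IsManifold.maximalAtlas 𝓘(ℂ) ω S) : IsP1Chart w.toP1 := by
  intro x hx
  rw [OpenPartialHomeomorph.toP1_source] at hx
  refine ⟨1, fun u => w ((chartAt ℂ x).symm u),
    analyticAt_transition (IsManifold.chart_mem_maximalAtlas x) hw (mem_chart_source ℂ x) hx, ?_⟩
  filter_upwards with v
  rw [one_smul]
  rfl

namespace ProjectiveStructure

variable {U : Set S} {P : ProjectiveStructure U} {φ : MeromorphicQuadraticDifferential S}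

/-- The domain of the new chart is shrunk so that the same affine chart and the same two solutions
serve at each of its points, not only at `x`. -/
lemma exists_mem_addCharts [IsManifold 𝓘(ℂ) ω S] {e z : OpenPartialHomeomorph S ℂ}
    (he : e ∈ IsManifold.maximalAtlas 𝓘(ℂ) ω S) {x : S} (hxe : x ∈ e.source)
    (hz : P.IsAffineChartAt z x) {f : ℂ → ℂ} (hf : AnalyticAt ℂ f (e x)) (hf' : deriv f (e x) ≠ 0)
    (hS : ∀ᶠ v in 𝓝 (e x), ∀ z, P.IsAffineChartAt z (e.symm v) →
      schwarzian f v = -2 * φ.coeff e v + schwarzian (fun v => z (e.symm v)) v) :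
    ∃ w ∈ P.addCharts φ, x ∈ w.source ∧ ∀ y ∈ w.source, w y = ((f (e y) : ℂ) : OnePoint ℂ) := by
  obtain ⟨y₁, y₂, h₁, h₂, hW, hy⟩ := exists_solutions he hxe hz hf hf' hS
  have hzt := z.continuousAt hz.2.1
  have hWev : ∀ᶠ t in 𝓝 (z x), wronskian y₁ y₂ t ≠ 0 := by
    filter_upwards [h₁.eventually_wronskian_eq h₂] with t ht
    rwa [ht]
  have hU : ∀ᶠ y in 𝓝 x, y ∈ U := by
    obtain ⟨-, -, c, hc, hxc, -⟩ := hz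
    filter_upwards [c.open_source.mem_nhds hxc] with y hy' using P.source_subset c hc hy'
  obtain ⟨w, hw, hxw, hwp, hwf⟩ := exists_coordinate he hxe hf hf'
    (hU.and (hz.eventually.and ((hzt.eventually h₁.eventually).and
      ((hzt.eventually h₂.eventually).and ((hzt.eventually hWev).and hy.eventually_nhds)))))
  refine ⟨w.toP1, ⟨isP1Chart_toP1 hw, ?_, ?_⟩, ?_, ?_⟩
  · rw [OpenPartialHomeomorph.toP1_source]
    exact fun y hy' => (hwp y hy').1
  · rw [OpenPartialHomeomorph.toP1_source]
    intro y hy'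
    obtain ⟨-, ⟨k1, k2, k3⟩, k4, k5, k6, k7⟩ := hwp y hy'
    refine ⟨z, k1, k2, k3, y₁, y₂, k4, k5, k6, ?_⟩
    filter_upwards [k7, w.open_source.mem_nhds hy'] with y' l1 l2
    rw [OpenPartialHomeomorph.toP1_apply, hwf y' l2, l1.2, projPoint, if_neg l1.1]
  · rwa [OpenPartialHomeomorph.toP1_source]
  · rw [OpenPartialHomeomorph.toP1_source]
    intro y hy'
    rw [OpenPartialHomeomorph.toP1_apply, hwf y hy']

end ProjectiveStructure

end

/-! ### Sections of the uniformizing covering -/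

section

variable {S : Type*} [TopologicalSpace S] [ChartedSpace ℂ S]

lemma analyticAt_of_holomorphicToP1At {f : ℂ → ℂ} {u : ℂ}
    (h : HolomorphicToP1At (fun v => ((f v : ℂ) : OnePoint ℂ)) u) : AnalyticAt ℂ f u := by
  obtain ⟨N, h, hh, hN⟩ := h
  have h0 := (OnePoint.coe_eq_smul_coe hN.self_of_nhds).1
  have : AnalyticAt ℂ (fun v => (N 0 0 * h v + N 0 1) / (N 1 0 * h v + N 1 1)) u := by
    fun_prop (disch := assumption)
  exact this.congr (hN.mono fun v hv => (OnePoint.coe_eq_smul_coe hv).2.symm)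

lemma mem_maximalAtlas_of_isP1Chart_toP1 [IsManifold 𝓘(ℂ) ω S] {z : OpenPartialHomeomorph S ℂ}
    (h : IsP1Chart z.toP1) : z ∈ IsManifold.maximalAtlas 𝓘(ℂ) ω S := by
  refine mem_maximalAtlas_of_analyticAt fun x hx =>
    ⟨chartAt ℂ x, IsManifold.chart_mem_maximalAtlas x, mem_chart_source ℂ x, ?_⟩
  exact analyticAt_of_holomorphicToP1At (h x (by rwa [OpenPartialHomeomorph.toP1_source]))

/-- A local section of a local homeomorphism from a plane domain, all of whose sections are charts
of `P`, is an affine chart of `P`. -/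
lemma ProjectiveStructure.exists_isAffineChartAt [IsManifold 𝓘(ℂ) ω S] {U : Set S}
    {P : ProjectiveStructure U} {D : Set ℂ} (hD : IsOpen D) {ψ : D → S} (hψU : range ψ = U)
    (hψ : IsLocalHomeomorph ψ)
    (hsec : ∀ z : OpenPartialHomeomorph S ℂ, z.source ⊆ U →
      (∀ x ∈ z.source, ∃ hx : z x ∈ D, ψ ⟨z x, hx⟩ = x) → z.toP1 ∈ P.charts) (d : D) :
    ∃ z : OpenPartialHomeomorph S ℂ, P.IsAffineChartAt z (ψ d) ∧ z (ψ d) = d ∧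
      ∀ᶠ d' in 𝓝 d, z (ψ d') = d' := by
  obtain ⟨f, hdf, hf⟩ := hψ d
  have : Nonempty D := ⟨d⟩
  set z : OpenPartialHomeomorph S ℂ :=
    f.symm.trans (hD.isOpenEmbedding_subtypeVal.toOpenPartialHomeomorph) with hz
  have hzs : z.source = f.target := by simp [hz]
  have hza : ∀ x, z x = (f.symm x : ℂ) := fun x => rfl
  have hmem : z.toP1 ∈ P.charts := by
    refine hsec z ?_ ?_
    · rw [hzs, ← hψU]
      intro x hx
      exact ⟨f.symm x, by rw [hf, f.right_inv hx]⟩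
    · rw [hzs]
      intro x hx
      refine ⟨by rw [hza]; exact (f.symm x).2, ?_⟩
      change ψ (f.symm x) = x
      rw [hf, f.right_inv hx]
  have hd : ψ d ∈ z.source := by rw [hzs, hf]; exact f.map_source hdf
  have hleft : ∀ d' ∈ f.source, z (ψ d') = d' := by
    intro d' hd'
    rw [hza, hf, f.left_inv hd']
  refine ⟨z, ⟨mem_maximalAtlas_of_isP1Chart_toP1 (P.isP1Chart _ hmem), hd, z.toP1, hmem, ?_, ?_⟩,
    hleft d hdf, ?_⟩
  · rwa [OpenPartialHomeomorph.toP1_source]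
  · exact Eventually.of_forall fun y => rfl
  · filter_upwards [f.open_source.mem_nhds hdf] with d' hd' using hleft d' hd'

end

section

/-- Convexity gives contractibility. Together with local path-connectedness this is what the lifting
criterion for coverings demands of the source. -/
instance PuncturedDiskCover.simplyConnectedSpace (r : ℝ) :
    SimplyConnectedSpace (PuncturedDiskCover r) := by
  have : ContractibleSpace (PuncturedDiskCover r) :=
    (convex_halfPlane (Real.log r)).contractibleSpace (nonempty_halfPlane _)
  exact SimplyConnectedSpace.ofContractible _

instance PuncturedDiskCover.locallyPathConnectedSpace (r : ℝ) :
    LocallyPathConnectedSpace (PuncturedDiskCover r) :=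
  (isOpen_halfPlane (Real.log r)).locallyPathConnectedSpace

variable {S : Type*} [TopologicalSpace S]

/-- A lift of the exponential parametrization of a punctured coordinate disk to a covering of the
surface by a plane domain is injective or periodic. -/
lemma exists_lift_exp {U : Set S} {D : Set ℂ} {ψ : D → S} (hψU : range ψ = U)
    (hψ : IsCoveringMapOn ψ U) {e : OpenPartialHomeomorph S ℂ} {r : ℝ}
    (hr : ∀ ζ : ℂ, ζ.re < Real.log r → Complex.exp ζ ∈ e.target ∧ e.symm (Complex.exp ζ) ∈ U) :
    ∃ g : PuncturedDiskCover r → D, Continuous g ∧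
      (∀ ζ, ψ (g ζ) = e.symm (Complex.exp ζ.1)) ∧
      (Function.Injective g ∨ ∃ n : ℕ, 0 < n ∧ ∀ ζ : PuncturedDiskCover r,
        ∃ h : (ζ.1 + n * (2 * Real.pi * Complex.I)).re < Real.log r, g ⟨_, h⟩ = g ζ) := by
  let f : C(PuncturedDiskCover r, S) := ⟨fun ζ => e.symm (Complex.exp ζ.1), by
    refine continuous_iff_continuousAt.2 fun ζ => ?_
    have h1 : ContinuousAt (fun ζ : PuncturedDiskCover r => Complex.exp ζ.1) ζ := by fun_prop
    exact ContinuousAt.comp (f := fun ζ : PuncturedDiskCover r => Complex.exp ζ.1)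
      (g := e.symm) (e.symm.continuousAt (hr ζ.1 ζ.2).1) h1⟩
  have hfU : ∀ ζ, f ζ ∈ U := fun ζ => (hr ζ.1 ζ.2).2
  obtain ⟨ζ₀, hζ₀⟩ := nonempty_halfPlane (Real.log r)
  obtain ⟨d₀, hd₀⟩ : f ⟨ζ₀, hζ₀⟩ ∈ range ψ := by rw [hψU]; exact hfU _
  obtain ⟨g, ⟨-, hg⟩, -⟩ := hψ.existsUnique_continuousMap_lifts f hd₀ hfU
  have hg' : ∀ ζ, ψ (g ζ) = f ζ := congr_fun hg
  refine ⟨g, g.continuous, hg', ?_⟩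
  by_cases hinj : Function.Injective g
  · exact Or.inl hinj
  right
  -- Translation by `2πi n` preserves the map being lifted. If `g` and its translate agree at one
  -- point, uniqueness of lifts makes them agree everywhere.
  have key : ∀ (n : ℕ) (ζ ζ' : PuncturedDiskCover r),
      ζ'.1 = ζ.1 + n * (2 * Real.pi * Complex.I) → g ζ' = g ζ →
      ∀ ζ : PuncturedDiskCover r,
        ∃ h : (ζ.1 + n * (2 * Real.pi * Complex.I)).re < Real.log r, g ⟨_, h⟩ = g ζ := by
    intro n ζ ζ' hζ hgζ
    have hre : ∀ ζ : PuncturedDiskCover r,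
        (ζ.1 + n * (2 * Real.pi * Complex.I)).re < Real.log r := fun ζ => by
      simpa using ζ.2
    let T : C(PuncturedDiskCover r, PuncturedDiskCover r) := ⟨fun ζ => ⟨_, hre ζ⟩, by fun_prop⟩
    have hTζ : T ζ = ζ' := Subtype.ext hζ.symm
    have huniq := (hψ.existsUnique_continuousMap_lifts f (hg' ζ) hfU).unique
      (y₁ := g.comp T) (y₂ := g) ⟨by simp [hTζ, hgζ], ?_⟩ ⟨rfl, hg⟩
    · intro η
      exact ⟨hre η, congr_fun (congr_arg DFunLike.coe huniq) η⟩
    · funext η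
      change ψ (g (T η)) = f η
      rw [hg']
      change e.symm (Complex.exp (η.1 + n * (2 * Real.pi * Complex.I))) = e.symm (Complex.exp η.1)
      have := (Complex.exp_periodic.nat_mul n) η.1
      rw [this]
  simp only [Function.Injective, not_forall] at hinj
  obtain ⟨ζ, ζ', hgζ, hne⟩ := hinj
  have hexp : Complex.exp ζ.1 = Complex.exp ζ'.1 := by
    have : f ζ = f ζ' := by rw [← hg', ← hg', hgζ]
    exact e.symm.injOn (hr ζ.1 ζ.2).1 (hr ζ'.1 ζ'.2).1 this
  obtain ⟨n, hn⟩ := Complex.exp_eq_exp_iff_exists_int.1 hexp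
  have hn0 : n ≠ 0 := by
    rintro rfl
    exact hne (Subtype.ext (by simpa using hn))
  refine ⟨n.natAbs, Int.natAbs_pos.2 hn0, ?_⟩
  rcases n.natAbs_eq with h | h
  · refine key _ ζ' ζ ?_ hgζ
    rw [hn, h]
    simp
  · refine key _ ζ ζ' ?_ hgζ.symm
    rw [hn, h]
    simp

end

/-- The filter `comap Complex.re atBot` stands for the puncture on the universal cover, uniformly in
the imaginary part. -/
lemma tendsto_symm_exp {S : Type*} [TopologicalSpace S] {e : OpenPartialHomeomorph S ℂ} {p : S} (hpe : p ∈ e.source)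
    (hep : e p = 0) : Tendsto (fun ζ => e.symm (Complex.exp ζ)) (comap Complex.re atBot) (𝓝 p) := by
  have h := OpenPartialHomeomorph.tendsto_symm_nhds hpe
  rw [hep] at h
  exact h.comp Complex.tendsto_exp_comap_re_atBot

lemma eventually_re_lt (a : ℝ) : ∀ᶠ ζ in comap Complex.re atBot, ζ.re < a :=
  (eventually_lt_atBot a).comap _

instance neBot_comap_re_atBot : (comap Complex.re atBot).NeBot :=
  comap_neBot_iff.2 fun t ht => by
    obtain ⟨x, hx⟩ := Filter.nonempty_of_mem ht
    exact ⟨x, by simpa using hx⟩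

section

variable {S : Type*} [TopologicalSpace S] [ChartedSpace ℂ S]

/-- `ψ` is a covering of `U` by the plane domain `D`, whose inverse branches are affine charts of
`P`, and `g` lifts the exponential parametrization of the punctured coordinate disk of radius `r`
to `D`. -/
structure IsUniformizingLift {U : Set S} (P : ProjectiveStructure U)
    (e : OpenPartialHomeomorph S ℂ) (r : ℝ) (D : Set ℂ) (ψ : ℂ → S) (g : ℂ → ℂ) : Prop where
  isOpen : IsOpen D
  continuousOn : ContinuousOn ψ D
  mapsTo : MapsTo ψ D U
  exists_chart : ∀ w ∈ D, ∃ z, P.IsAffineChartAt z (ψ w) ∧ ∀ᶠ w' in 𝓝 w, z (ψ w') = w'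
  mem_target : ∀ ζ : ℂ, ζ.re < Real.log r → Complex.exp ζ ∈ e.target
  mem_domain : ∀ ζ : ℂ, ζ.re < Real.log r → g ζ ∈ D
  apply_lift : ∀ ζ : ℂ, ζ.re < Real.log r → ψ (g ζ) = e.symm (Complex.exp ζ)
  continuousOn_lift : ContinuousOn g {ζ | ζ.re < Real.log r}
  injOn_or_periodic : InjOn g {ζ | ζ.re < Real.log r} ∨
    ∃ n : ℕ, 0 < n ∧ ∀ ζ : ℂ, ζ.re < Real.log r → g (ζ + n * (2 * Real.pi * Complex.I)) = g ζ

lemma exists_isUniformizingLift_of_isCoveringMapOn [IsManifold 𝓘(ℂ) ω S] {U : Set S}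
    {P : ProjectiveStructure U} {D : Set ℂ} (hD : IsOpen D) {ψ : D → S} (hψU : range ψ = U)
    (hψ : IsCoveringMapOn ψ U)
    (hsec : ∀ z : OpenPartialHomeomorph S ℂ, z.source ⊆ U →
      (∀ x ∈ z.source, ∃ hx : z x ∈ D, ψ ⟨z x, hx⟩ = x) → z.toP1 ∈ P.charts)
    {e : OpenPartialHomeomorph S ℂ} {r : ℝ}
    (hr : ∀ ζ : ℂ, ζ.re < Real.log r → Complex.exp ζ ∈ e.target ∧ e.symm (Complex.exp ζ) ∈ U) :
    ∃ (ψ' : ℂ → S) (g : ℂ → ℂ), IsUniformizingLift P e r D ψ' g := by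
  classical
  obtain ⟨G, hG, hGψ, hGp⟩ := exists_lift_exp hψU hψ hr
  have hmem : ∀ d, ψ d ∈ U := fun d => hψU ▸ mem_range_self d
  have hloc : IsLocalHomeomorph ψ := by
    rw [isLocalHomeomorph_iff_isLocalHomeomorphOn_univ]
    have := hψ.isLocalHomeomorphOn
    rwa [show ψ ⁻¹' U = univ from eq_univ_of_forall hmem] at this
  obtain ⟨x₀⟩ : Nonempty S := by
    obtain ⟨ζ, hζ⟩ := nonempty_halfPlane (Real.log r)
    exact ⟨e.symm (Complex.exp ζ)⟩
  set ψ' : ℂ → S := fun w => if h : w ∈ D then ψ ⟨w, h⟩ else x₀ with hψ'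
  set g : ℂ → ℂ := fun ζ => if h : ζ.re < Real.log r then (G ⟨ζ, h⟩ : ℂ) else 0 with hg
  have hψe : ∀ d : D, ψ' d = ψ d := fun d => by simp [hψ']
  have hge : ∀ ζ : PuncturedDiskCover r, g ζ.1 = G ζ := fun ζ => by
    simp only [hg]
    rw [dif_pos ζ.2]
  refine ⟨ψ', g, hD, ?_, ?_, ?_, fun ζ hζ => (hr ζ hζ).1, ?_, ?_, ?_, ?_⟩
  · rw [continuousOn_iff_continuous_domRestrict]
    exact hloc.continuous.congr fun d => (hψe d).symm
  · intro w hw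
    rw [hψe ⟨w, hw⟩]
    exact hmem _
  · intro w hw
    obtain ⟨z, hz, hzw, hev⟩ := P.exists_isAffineChartAt hD hψU hloc hsec ⟨w, hw⟩
    refine ⟨z, by rwa [hψe ⟨w, hw⟩], ?_⟩
    rw [← hD.isOpenEmbedding_subtypeVal.map_nhds_eq ⟨w, hw⟩, eventually_map]
    exact hev.mono fun d hd => by rw [hψe, hd]
  · intro ζ hζ
    rw [hge ⟨ζ, hζ⟩]
    exact (G _).2
  · intro ζ hζ
    rw [hge ⟨ζ, hζ⟩, hψe, hGψ]
  · rw [continuousOn_iff_continuous_domRestrict]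
    exact (continuous_subtype_val.comp hG).congr fun ζ => (hge ζ).symm
  · rcases hGp with h | ⟨n, hn, h⟩
    · left
      intro ζ hζ ζ' hζ' heq
      rw [hge ⟨ζ, hζ⟩, hge ⟨ζ', hζ'⟩] at heq
      exact congr_arg Subtype.val (h (Subtype.ext heq))
    · right
      refine ⟨n, hn, fun ζ hζ => ?_⟩
      obtain ⟨h1, h2⟩ := h ⟨ζ, hζ⟩
      rw [hge ⟨ζ, hζ⟩, hge ⟨_, h1⟩, h2]

/-- The uniformizing covering of a punctured surface is not defined on the whole projective line,
and the parametrization of a punctured coordinate disk lifts to the covering domain. -/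
lemma ProjectiveStructure.IsUniformizing.exists_isUniformizingLift [T2Space S]
    [IsManifold 𝓘(ℂ) ω S] {U : Set S} {P : ProjectiveStructure U} (hP : P.IsUniformizing)
    {e : OpenPartialHomeomorph S ℂ} {p : S} (hpe : p ∈ e.source) (hep : e p = 0) (hpU : p ∉ U)
    {r : ℝ}
    (hr : ∀ ζ : ℂ, ζ.re < Real.log r → Complex.exp ζ ∈ e.target ∧ e.symm (Complex.exp ζ) ∈ U) :
    ∃ (D : Set ℂ) (ψ : ℂ → S) (g : ℂ → ℂ), (D = Metric.ball 0 1 ∨ D = univ) ∧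
      IsUniformizingLift P e r D ψ g := by
  obtain ⟨Ω, hΩ, π, hπU, hπ, hsec⟩ := hP
  have main : ∀ D : Set ℂ, IsOpen D → Ω = (fun z : ℂ => (z : OnePoint ℂ)) '' D →
      ∃ (ψ : ℂ → S) (g : ℂ → ℂ), IsUniformizingLift P e r D ψ g := by
    rintro D hD rfl
    let h := OnePoint.isOpenEmbedding_coe.isEmbedding.homeomorphImage D
    refine exists_isUniformizingLift_of_isCoveringMapOn hD (ψ := π ∘ h) ?_ (hπ.comp_homeomorph h)
      ?_ hr
    · rw [h.surjective.range_comp, hπU]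
    · intro z hz hzD
      refine hsec _ (by rwa [OpenPartialHomeomorph.toP1_source]) fun x hx => ?_
      rw [OpenPartialHomeomorph.toP1_source] at hx
      obtain ⟨h1, h2⟩ := hzD x hx
      exact ⟨mem_image_of_mem _ h1, h2⟩
  rcases hΩ with h | h | h
  · exact ⟨_, (main _ Metric.isOpen_ball h).imp fun ψ => Exists.imp fun g hg => ⟨Or.inl rfl, hg⟩⟩
  · exact ⟨_, (main _ isOpen_univ (h.trans image_univ.symm)).imp
      fun ψ => Exists.imp fun g hg => ⟨Or.inr rfl, hg⟩⟩
  -- For the sphere, `U` would be compact, hence closed, and would contain the limit `p` of points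
  -- of the punctured disk.
  · subst h
    exfalso
    have hc : Continuous π := continuous_iff_continuousAt.2 fun x =>
      hπ.continuousAt (hπU ▸ mem_range_self x)
    have : CompactSpace (univ : Set (OnePoint ℂ)) := isCompact_iff_compactSpace.1 isCompact_univ
    have hcl : IsClosed U := hπU ▸ (isCompact_range hc).isClosed
    refine hpU (hcl.mem_of_tendsto (tendsto_symm_exp hpe hep) ?_)
    filter_upwards [eventually_re_lt (Real.log r)] with ζ hζ using (hr ζ hζ).2

end

/-! ### Holomorphy and Schwarzian derivative of the lift -/

lemma schwarzian_exp (ζ : ℂ) : schwarzian Complex.exp ζ = -(1 / 2) := by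
  unfold schwarzian
  simp only [Complex.deriv_exp, div_self (Complex.exp_ne_zero _), deriv_const]
  norm_num

namespace IsUniformizingLift

variable {S : Type*} [TopologicalSpace S] [ChartedSpace ℂ S] {U : Set S} {P : ProjectiveStructure U}
  {e : OpenPartialHomeomorph S ℂ} {r : ℝ} {D : Set ℂ} {ψ : ℂ → S} {g : ℂ → ℂ}

lemma mem_nhds {ζ : ℂ} (hζ : ζ.re < Real.log r) :
    {ζ : ℂ | ζ.re < Real.log r} ∈ 𝓝 ζ := (isOpen_halfPlane _).mem_nhds hζ

lemma mem_source (h : IsUniformizingLift P e r D ψ g) {ζ : ℂ} (hζ : ζ.re < Real.log r) :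
    e.symm (Complex.exp ζ) ∈ e.source := e.map_target (h.mem_target ζ hζ)

lemma right_inv (h : IsUniformizingLift P e r D ψ g) {ζ : ℂ} (hζ : ζ.re < Real.log r) :
    e (e.symm (Complex.exp ζ)) = Complex.exp ζ := e.right_inv (h.mem_target ζ hζ)

lemma exists_chart_lift (h : IsUniformizingLift P e r D ψ g) {ζ : ℂ} (hζ : ζ.re < Real.log r) :
    ∃ z, P.IsAffineChartAt z (e.symm (Complex.exp ζ)) ∧ (∀ᶠ w in 𝓝 (g ζ), z (ψ w) = w) ∧
      g =ᶠ[𝓝 ζ] fun η => z (e.symm (Complex.exp η)) := by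
  obtain ⟨z, hz, hev⟩ := h.exists_chart _ (h.mem_domain ζ hζ)
  refine ⟨z, by rwa [h.apply_lift ζ hζ] at hz, hev, ?_⟩
  have hc : ContinuousAt g ζ := h.continuousOn_lift.continuousAt (mem_nhds hζ)
  filter_upwards [hc.eventually hev, mem_nhds hζ] with η h1 h2
  rw [← h.apply_lift η h2, h1]

lemma analyticAt_chart (h : IsUniformizingLift P e r D ψ g)
    (he : e ∈ IsManifold.maximalAtlas 𝓘(ℂ) ω S) {ζ : ℂ} (hζ : ζ.re < Real.log r)
    {z : OpenPartialHomeomorph S ℂ} (hz : P.IsAffineChartAt z (e.symm (Complex.exp ζ))) :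
    AnalyticAt ℂ (fun v => z (e.symm v)) (Complex.exp ζ) ∧
      deriv (fun v => z (e.symm v)) (Complex.exp ζ) ≠ 0 := by
  have h1 := analyticAt_transition he hz.1 (h.mem_source hζ) hz.2.1
  have h2 := deriv_transition_ne_zero he hz.1 (h.mem_source hζ) hz.2.1
  rw [h.right_inv hζ] at h1 h2
  exact ⟨h1, h2⟩

lemma analyticAt (h : IsUniformizingLift P e r D ψ g)
    (he : e ∈ IsManifold.maximalAtlas 𝓘(ℂ) ω S) {ζ : ℂ} (hζ : ζ.re < Real.log r) :
    AnalyticAt ℂ g ζ := by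
  obtain ⟨z, hz, -, hev⟩ := h.exists_chart_lift hζ
  exact ((h.analyticAt_chart he hζ hz).1.comp (f := Complex.exp) (by fun_prop)).congr hev.symm

lemma deriv_eq (h : IsUniformizingLift P e r D ψ g)
    (he : e ∈ IsManifold.maximalAtlas 𝓘(ℂ) ω S) {ζ : ℂ} (hζ : ζ.re < Real.log r)
    {z : OpenPartialHomeomorph S ℂ} (hz : P.IsAffineChartAt z (e.symm (Complex.exp ζ)))
    (hev : g =ᶠ[𝓝 ζ] fun η => z (e.symm (Complex.exp η))) :
    deriv g ζ = deriv (fun v => z (e.symm v)) (Complex.exp ζ) * Complex.exp ζ := by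
  rw [hev.deriv_eq]
  exact ((h.analyticAt_chart he hζ hz).1.differentiableAt.hasDerivAt.comp ζ
    (Complex.hasDerivAt_exp ζ)).deriv

lemma deriv_ne_zero (h : IsUniformizingLift P e r D ψ g)
    (he : e ∈ IsManifold.maximalAtlas 𝓘(ℂ) ω S) {ζ : ℂ} (hζ : ζ.re < Real.log r) :
    deriv g ζ ≠ 0 := by
  obtain ⟨z, hz, -, hev⟩ := h.exists_chart_lift hζ
  rw [h.deriv_eq he hζ hz hev]
  exact mul_ne_zero (h.analyticAt_chart he hζ hz).2 (Complex.exp_ne_zero ζ)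

/-- Locally `g` is an affine chart of `P` composed with `e.symm ∘ exp`, and the exponential has
Schwarzian `-1/2`. -/
lemma schwarzian_chart (h : IsUniformizingLift P e r D ψ g)
    (he : e ∈ IsManifold.maximalAtlas 𝓘(ℂ) ω S) {ζ : ℂ} (hζ : ζ.re < Real.log r)
    {z : OpenPartialHomeomorph S ℂ} (hz : P.IsAffineChartAt z (e.symm (Complex.exp ζ))) :
    Complex.exp ζ ^ 2 * schwarzian (fun v => z (e.symm v)) (Complex.exp ζ) =
      schwarzian g ζ + 1 / 2 := by
  obtain ⟨z', hz', -, hev⟩ := h.exists_chart_lift hζ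
  have h1 := hz'.schwarzian_eq hz he (h.mem_source hζ)
  rw [h.right_inv hζ] at h1
  have h2 := h.analyticAt_chart he hζ hz'
  rw [h1, schwarzian_congr hev, schwarzian_comp (f := fun v => z' (e.symm v)) (g := Complex.exp)
    h2.1 (by fun_prop) h2.2 (by simp), schwarzian_exp, Complex.deriv_exp]
  ring

/-- Although `g` itself need not descend to the punctured disk, its Schwarzian does: by
`schwarzian_chart` it depends only on `exp ζ`. -/
lemma schwarzian_eq_of_exp_eq (h : IsUniformizingLift P e r D ψ g)
    (he : e ∈ IsManifold.maximalAtlas 𝓘(ℂ) ω S) {ζ ζ' : ℂ} (hζ : ζ.re < Real.log r)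
    (hζ' : ζ'.re < Real.log r) (heq : Complex.exp ζ = Complex.exp ζ') :
    schwarzian g ζ = schwarzian g ζ' := by
  obtain ⟨z, hz, -, -⟩ := h.exists_chart_lift hζ
  have h1 := h.schwarzian_chart he hζ hz
  rw [heq] at hz h1
  have h2 := h.schwarzian_chart he hζ' hz
  rw [h2] at h1
  exact (add_right_cancel h1).symm

/-- The lift leaves every compact subset of the covering domain near the puncture. -/
lemma eventually_notMem [T2Space S] (h : IsUniformizingLift P e r D ψ g) {p : S}
    (hpe : p ∈ e.source) (hep : e p = 0) (hpU : p ∉ U) {K : Set ℂ} (hK : IsCompact K)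
    (hKD : K ⊆ D) : ∀ᶠ ζ in comap Complex.re atBot, g ζ ∉ K := by
  have hcl : IsClosed (ψ '' K) := (hK.image_of_continuousOn (h.continuousOn.mono hKD)).isClosed
  have hp : p ∉ ψ '' K := by
    rintro ⟨w, hw, rfl⟩
    exact hpU (h.mapsTo (hKD hw))
  filter_upwards [(tendsto_symm_exp hpe hep).eventually (hcl.isOpen_compl.mem_nhds hp),
    eventually_re_lt (Real.log r)] with ζ h1 h2 h3
  exact h1 ⟨g ζ, h3, h.apply_lift ζ h2⟩

end IsUniformizingLift

/-! ### Periodic holomorphic functions on a half-plane -/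

/-- A bounded periodic holomorphic function on a half-plane is a holomorphic function of the
exponential coordinate, which extends across the puncture. -/
lemma exists_analyticAt_exp_of_periodic {G : ℂ → ℂ} {a h : ℝ} (hh : 0 < h)
    (hol : ∀ ζ : ℂ, ζ.re < a → DifferentiableAt ℂ G ζ)
    (hper : ∀ ζ : ℂ, ζ.re < a → G (ζ + h * Complex.I) = G ζ)
    {C : ℝ} (hbd : ∀ᶠ ζ in comap Complex.re atBot, ‖G ζ‖ ≤ C) :
    ∃ k : ℂ → ℂ, AnalyticAt ℂ k 0 ∧
      ∀ ζ : ℂ, ζ.re < a → G ζ = k (Complex.exp (2 * Real.pi / h * ζ)) := by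
  classical
  -- Rotation by `I` turns the left half-plane into an upper half-plane and the period into a real
  -- one, so that `cuspFunction` applies. The value `0` below it is a periodic filler, irrelevant
  -- near the cusp.
  set F : ℂ → ℂ := fun w => if (Complex.I * w).re < a then G (Complex.I * w) else 0 with hF
  have hFper : Function.Periodic F h := by
    intro w
    have hre : (Complex.I * (w + h)).re = (Complex.I * w).re := by simp
    simp only [hF, hre]
    split_ifs with hw
    · rw [← hper _ hw]
      ring_nf
    · rfl
  have hl : Tendsto (fun w : ℂ => Complex.I * w) (comap Complex.im atTop)
      (comap Complex.re atBot) := by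
    rw [tendsto_comap_iff]
    have : Complex.re ∘ (fun w : ℂ => Complex.I * w) = Neg.neg ∘ Complex.im := by
      funext w
      simp
    rw [this]
    exact tendsto_neg_atTop_atBot.comp tendsto_comap
  have hopen : ∀ w : ℂ, (Complex.I * w).re < a → F =ᶠ[𝓝 w] fun w => G (Complex.I * w) := by
    intro w hw
    have : ContinuousAt (fun w : ℂ => (Complex.I * w).re) w := by fun_prop
    filter_upwards [this.eventually_lt_const hw] with w' hw'
    simp only [hF, if_pos hw']
  have hdiff : ∀ᶠ w in comap Complex.im atTop, DifferentiableAt ℂ F w := by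
    filter_upwards [hl.eventually (eventually_re_lt a)] with w hw
    exact ((hol _ hw).comp w (by fun_prop)).congr_of_eventuallyEq (hopen w hw)
  have hb : BoundedAtFilter (comap Complex.im atTop) F := by
    refine Asymptotics.IsBigO.of_bound C ?_
    filter_upwards [hl.eventually hbd, hl.eventually (eventually_re_lt a)] with w h1 h2
    simp only [hF, if_pos h2]
    simpa using h1
  refine ⟨Function.Periodic.cuspFunction h F, ?_, ?_⟩
  · rw [Complex.analyticAt_iff_eventually_differentiableAt]
    have h0 := Function.Periodic.differentiableAt_cuspFunction_zero hh hFper hdiff hb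
    have h1 := Function.Periodic.eventually_differentiableAt_cuspFunction_nhds_ne_zero hh hFper
      hdiff
    rw [eventually_nhdsWithin_iff] at h1
    filter_upwards [h1] with q hq
    rcases eq_or_ne q 0 with rfl | hq0
    · exact h0
    · exact hq hq0
  · intro ζ hζ
    have h1 := Function.Periodic.eq_cuspFunction hh.ne' hFper (-Complex.I * ζ)
    have h2 : Complex.I * (-Complex.I * ζ) = ζ := by
      rw [← mul_assoc]
      simp
    have h3 : Function.Periodic.qParam h (-Complex.I * ζ) =
        Complex.exp (2 * Real.pi / h * ζ) := by
      unfold Function.Periodic.qParam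
      congr 1
      linear_combination (-(2 * Real.pi * ζ / h) : ℂ) * Complex.I_sq
    rw [← h3, h1]
    simp only [hF, h2, if_pos hζ]

lemma tendsto_exp_mul_comap_re {c : ℝ} (hc : 0 < c) :
    Tendsto (fun ζ : ℂ => Complex.exp (c * ζ)) (comap Complex.re atBot) (𝓝[≠] 0) := by
  refine tendsto_nhdsWithin_iff.2 ⟨?_, Eventually.of_forall fun ζ => Complex.exp_ne_zero _⟩
  refine Complex.tendsto_exp_comap_re_atBot.comp ?_
  rw [tendsto_comap_iff]
  have : Complex.re ∘ (fun ζ : ℂ => c * ζ) = (fun x => c * x) ∘ Complex.re := by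
    funext w
    simp
  rw [this]
  exact (tendsto_id.const_mul_atBot hc).comp tendsto_comap

/-- Every `t ≠ 0` is `exp (c ζ)` for `ζ = log t / c`, and the real part of this `ζ` tends to `-∞` as
`t → 0`. -/
lemma eventually_nhdsNE_of_exp_mul {c : ℝ} (hc : 0 < c) {p : ℂ → Prop}
    (h : ∀ᶠ ζ in comap Complex.re atBot, p (Complex.exp (c * ζ))) : ∀ᶠ t in 𝓝[≠] 0, p t := by
  have hl : Tendsto (fun t : ℂ => Complex.log t / c) (𝓝[≠] 0) (comap Complex.re atBot) := by
    rw [tendsto_comap_iff]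
    have : Complex.re ∘ (fun t : ℂ => Complex.log t / c) = fun t => Real.log ‖t‖ / c := by
      funext t
      simp [Complex.div_ofReal_re, Complex.log_re]
    rw [this]
    exact (Real.tendsto_log_nhdsGT_zero.comp tendsto_norm_nhdsNE_zero).atBot_div_const hc
  filter_upwards [hl.eventually h, self_mem_nhdsWithin] with t ht ht0
  rwa [mul_div_cancel₀ _ (by exact_mod_cast hc.ne'), Complex.exp_log ht0] at ht

/-- There is no periodic holomorphic map from a half-plane to the unit disk which tends to the
boundary of the disk. -/
lemma not_tendsto_norm_one_of_periodic {g : ℂ → ℂ} {a h : ℝ} (hh : 0 < h)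
    (hol : ∀ ζ : ℂ, ζ.re < a → DifferentiableAt ℂ g ζ)
    (hper : ∀ ζ : ℂ, ζ.re < a → g (ζ + h * Complex.I) = g ζ) (hlt : ∀ ζ : ℂ, ζ.re < a → ‖g ζ‖ < 1) :
    ¬ Tendsto (fun ζ => ‖g ζ‖) (comap Complex.re atBot) (𝓝 1) := by
  intro hlim
  obtain ⟨k, hk, hgk⟩ := exists_analyticAt_exp_of_periodic hh hol hper (C := 1)
    ((eventually_re_lt a).mono fun ζ hζ => (hlt ζ hζ).le)
  have hc : 0 < 2 * Real.pi / h := by positivity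
  have hgk' : ∀ᶠ ζ in comap Complex.re atBot,
      g ζ = k (Complex.exp ((2 * Real.pi / h : ℝ) * ζ)) := by
    filter_upwards [eventually_re_lt a] with ζ hζ
    rw [hgk ζ hζ]
    push_cast
    rfl
  have h1 : ∀ᶠ t in 𝓝[≠] (0 : ℂ), ‖k t‖ < 1 := by
    refine eventually_nhdsNE_of_exp_mul hc ?_
    filter_upwards [hgk', eventually_re_lt a] with ζ e1 e2
    rw [← e1]
    exact hlt ζ e2
  have h0 : ‖k 0‖ = 1 := by
    refine tendsto_nhds_unique ?_ hlim
    have := (hk.continuousAt.norm.tendsto.mono_left nhdsWithin_le_nhds).comp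
      (tendsto_exp_mul_comap_re hc)
    refine this.congr' ?_
    filter_upwards [hgk'] with ζ e1
    rw [e1]
    rfl
  -- The extension has modulus one at the puncture and less than one around it, against the maximum
  -- principle.
  have hmax : IsLocalMax (norm ∘ k) 0 := by
    have := eventually_nhdsWithin_iff.1 h1
    filter_upwards [this] with t ht
    rcases eq_or_ne t 0 with rfl | ht0
    · exact le_rfl
    · simpa [h0] using (ht ht0).le
  have h2 := Complex.eventually_eq_of_isLocalMax_norm
    ((Complex.analyticAt_iff_eventually_differentiableAt).1 hk) hmax
  obtain ⟨t, ht, ht'⟩ := ((h2.filter_mono nhdsWithin_le_nhds).and h1).exists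
  rw [ht, h0] at ht'
  exact lt_irrefl _ ht'

/-- An entire function `f` whose quadratic differential `f(w) dw²` pulls back under a periodic
holomorphic map tending to infinity on a half-plane to one with a non-zero limit does not exist. -/
lemma not_tendsto_cobounded_of_periodic {f g : ℂ → ℂ} (hf : Differentiable ℂ f) {a h : ℝ}
    (hh : 0 < h) (hol : ∀ ζ : ℂ, ζ.re < a → DifferentiableAt ℂ g ζ)
    (hper : ∀ ζ : ℂ, ζ.re < a → g (ζ + h * Complex.I) = g ζ) {L : ℂ} (hL : L ≠ 0)
    (hlim : Tendsto (fun ζ => f (g ζ) * deriv g ζ ^ 2) (comap Complex.re atBot) (𝓝 L)) :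
    ¬ Tendsto g (comap Complex.re atBot) (Bornology.cobounded ℂ) := by
  intro hg
  have hinv : Tendsto (fun ζ => (g ζ)⁻¹) (comap Complex.re atBot) (𝓝 0) :=
    tendsto_inv₀_cobounded.comp hg
  obtain ⟨b, hb⟩ : ∃ b : ℝ, ∀ ζ : ℂ, ζ.re < b → ζ.re < a ∧ g ζ ≠ 0 := by
    have : ∀ᶠ ζ in comap Complex.re atBot, ζ.re < a ∧ g ζ ≠ 0 :=
      (eventually_re_lt a).and (hg.eventually (Bornology.eventually_ne_cobounded 0))
    rw [eventually_comap, eventually_atBot] at this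
    obtain ⟨b, hb⟩ := this
    exact ⟨b, fun ζ hζ => hb ζ.re hζ.le ζ rfl⟩
  obtain ⟨k, hk, hgk⟩ := exists_analyticAt_exp_of_periodic (G := fun ζ => (g ζ)⁻¹) (a := b) hh
    (fun ζ hζ => (hol ζ (hb ζ hζ).1).inv (hb ζ hζ).2)
    (fun ζ hζ => by simp only [hper ζ (hb ζ hζ).1]) (C := 1)
    ((hinv.norm.eventually_lt_const (by simp)).mono fun ζ hζ => hζ.le)
  set c : ℝ := 2 * Real.pi / h with hc'
  have hc : 0 < c := by positivity
  have hgk' : ∀ ζ : ℂ, ζ.re < b → (g ζ)⁻¹ = k (Complex.exp (c * ζ)) := by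
    intro ζ hζ
    rw [hgk ζ hζ, hc']
    push_cast
    rfl
  have hE := tendsto_exp_mul_comap_re hc
  have hk0 : k 0 = 0 := by
    refine tendsto_nhds_unique ((hk.continuousAt.tendsto.mono_left nhdsWithin_le_nhds).comp hE) ?_
    refine hinv.congr' ?_
    filter_upwards [eventually_re_lt b] with ζ hζ using hgk' ζ hζ
  have hkne : ∀ᶠ t in 𝓝[≠] (0 : ℂ), k t ≠ 0 := by
    refine eventually_nhdsNE_of_exp_mul hc ?_
    filter_upwards [eventually_re_lt b] with ζ hζ
    rw [← hgk' ζ hζ]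
    exact inv_ne_zero (hb ζ hζ).2
  have hnz : ¬ ∀ᶠ t in 𝓝 (0 : ℂ), k t = 0 := fun h0 => by
    obtain ⟨t, h1, h2⟩ := ((h0.filter_mono nhdsWithin_le_nhds).and hkne).exists
    exact h2 h1
  -- Factoring `1/g = k = tᵐ u` with `m ≥ 1` gives `1/g' = -k u / (c (m u + t u'))`. The denominator
  -- has the nonzero limit `c m u(0)`, so `1/g' → 0`.
  obtain ⟨m, u, hu, hu0, hku⟩ := hk.exists_eventuallyEq_pow_smul_nonzero_iff.2 hnz
  simp only [sub_zero, smul_eq_mul] at hku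
  have hm : m ≠ 0 := by
    rintro rfl
    have := hku.self_of_nhds
    rw [hk0] at this
    simp at this
    exact hu0 this.symm
  have hdk : ∀ᶠ t in 𝓝 (0 : ℂ), t * deriv k t = t ^ m * (m * u t + t * deriv u t) := by
    filter_upwards [hku.eventually_nhds, hu.eventually_analyticAt] with t h1 h2
    rw [EventuallyEq.deriv_eq h1, ((hasDerivAt_pow m t).fun_mul h2.differentiableAt.hasDerivAt).deriv]
    obtain ⟨j, rfl⟩ := Nat.exists_eq_succ_of_ne_zero hm
    simp only [Nat.succ_eq_add_one, Nat.add_sub_cancel]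
    push_cast
    ring
  -- the reciprocal of the derivative
  have hder : ∀ᶠ ζ in comap Complex.re atBot, (deriv g ζ)⁻¹ =
      (fun t => -(k t * (u t / (c * (m * u t + t * deriv u t))))) (Complex.exp (c * ζ)) := by
    filter_upwards [eventually_re_lt b, (hE.mono_right nhdsWithin_le_nhds).eventually hdk,
      (hE.mono_right nhdsWithin_le_nhds).eventually hku,
      (hE.mono_right nhdsWithin_le_nhds).eventually hk.eventually_analyticAt] with ζ h1 h2 h3 h4
    have e1 : HasDerivAt (fun ζ => (g ζ)⁻¹) (-deriv g ζ / g ζ ^ 2) ζ :=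
      (hol ζ (hb ζ h1).1).hasDerivAt.inv (hb ζ h1).2
    have e2 : HasDerivAt (fun ζ : ℂ => k (Complex.exp (c * ζ)))
        (deriv k (Complex.exp (c * ζ)) * (Complex.exp (c * ζ) * c)) ζ := by
      refine h4.differentiableAt.hasDerivAt.comp ζ ?_
      exact ((hasDerivAt_id ζ).const_mul (c : ℂ)).cexp.congr_deriv (by simp)
    have e3 : (fun ζ => (g ζ)⁻¹) =ᶠ[𝓝 ζ] fun ζ : ℂ => k (Complex.exp (c * ζ)) := by
      filter_upwards [(isOpen_halfPlane b).mem_nhds h1] with ζ' h' using hgk' ζ' h'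
    have e4 := (e2.congr_of_eventuallyEq e3).unique e1
    have e5 := hgk' ζ h1
    set t := Complex.exp (c * ζ) with ht
    have ht0 : t ^ m ≠ 0 := pow_ne_zero _ (Complex.exp_ne_zero _)
    have hg0 := (hb ζ h1).2
    have e6 : deriv g ζ = -(g ζ ^ 2 * (c * (t ^ m * (m * u t + t * deriv u t)))) := by
      rw [← h2]
      field_simp at e4
      linear_combination e4
    have e7 : g ζ = (t ^ m * u t)⁻¹ := by rw [← h3, ← e5, inv_inv]
    have hu' : u t ≠ 0 := by
      rintro h0
      rw [e7, h0] at hg0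
      simp at hg0
    rw [e6, e7, h3]
    generalize hw : (m * u t + t * deriv u t) = w
    rcases eq_or_ne w 0 with rfl | hw0
    · simp
    · have : (c : ℂ) ≠ 0 := by exact_mod_cast hc.ne'
      field_simp
  have hq : ContinuousAt (fun t => -(k t * (u t / (c * (m * u t + t * deriv u t))))) 0 := by
    have hne : (c : ℂ) * (m * u 0 + 0 * deriv u 0) ≠ 0 := by
      simp [hc.ne', hm, hu0]
    have := hk.continuousAt
    have := hu.continuousAt
    have := hu.deriv.continuousAt
    fun_prop (disch := assumption)
  have hder0 : Tendsto (fun ζ => (deriv g ζ)⁻¹) (comap Complex.re atBot) (𝓝 0) := by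
    have := (hq.tendsto.comp (hE.mono_right nhdsWithin_le_nhds)).congr'
      (hder.mono fun ζ h => h.symm)
    simpa [hk0] using this
  have hfg : Tendsto (fun ζ => f (g ζ)) (comap Complex.re atBot) (𝓝 0) := by
    have h1 := hlim.mul (hder0.pow 2)
    simp only [ne_eq, OfNat.ofNat_ne_zero, not_false_eq_true, zero_pow, mul_zero] at h1
    refine h1.congr' ?_
    filter_upwards [hlim.eventually_ne hL] with ζ hζ
    have : deriv g ζ ≠ 0 := fun h0 => by simp [h0] at hζ
    field_simp
  -- Being nonconstant, `k` is open at `0`, so the values `1/k t` fill a punctured neighbourhood of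
  -- infinity. The convergence `f → 0` along `g` thus becomes convergence at infinity, and
  -- Liouville's theorem applies.
  have hf0 : Tendsto f (cocompact ℂ) (𝓝 0) := by
    rw [← Metric.cobounded_eq_cocompact, Metric.tendsto_nhds]
    intro ε hε
    have h1 : ∀ᶠ t in 𝓝 (0 : ℂ), k t ≠ 0 → dist (f (k t)⁻¹) 0 < ε := by
      have : ∀ᶠ t in 𝓝[≠] (0 : ℂ), dist (f (k t)⁻¹) 0 < ε := by
        refine eventually_nhdsNE_of_exp_mul hc ?_
        filter_upwards [eventually_re_lt b, (Metric.tendsto_nhds.1 hfg) ε hε] with ζ h1 h2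
        rwa [← hgk' ζ h1, inv_inv]
      filter_upwards [eventually_nhdsWithin_iff.1 this] with t ht htk
      refine ht ?_
      rintro rfl
      exact htk hk0
    have h2 : ∀ᶠ y in 𝓝 (0 : ℂ), y ≠ 0 → dist (f y⁻¹) 0 < ε := by
      rcases hk.eventually_constant_or_nhds_le_map_nhds with h | h
      · rw [hk0] at h
        exact absurd h hnz
      · rw [hk0] at h
        exact h h1
    have h3 := (tendsto_inv₀_cobounded (α := ℂ)).eventually h2
    filter_upwards [h3, Bornology.eventually_ne_cobounded 0] with w hw hw0
    simpa using hw (inv_ne_zero hw0)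
  have hfz : ∀ w, f w = 0 := fun w => hf.apply_eq_of_tendsto_cocompact w hf0
  refine hL (tendsto_nhds_unique hlim ?_)
  simp [hfz]

lemma AnalyticAt.schwarzian {f : ℂ → ℂ} {u : ℂ} (hf : AnalyticAt ℂ f u) (h : deriv f u ≠ 0) :
    AnalyticAt ℂ (schwarzian f) u := by
  have h1 := hf.deriv.deriv.div hf.deriv h
  exact h1.deriv.sub ((h1.pow 2).div_const (c := 2))

/-! ### Injectivity of the lift and extension of the coefficient across a double pole -/

namespace IsUniformizingLift

variable {S : Type*} [TopologicalSpace S] [ChartedSpace ℂ S]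
  {φ : MeromorphicQuadraticDifferential S} {P : ProjectiveStructure φ.polesᶜ}
  {e : OpenPartialHomeomorph S ℂ} {r : ℝ} {D : Set ℂ} {ψ : ℂ → S} {g : ℂ → ℂ}

/-- The pull back of `φ` to the covering domain. -/
lemma exists_pullback [IsManifold 𝓘(ℂ) ω S] (h : IsUniformizingLift P e r D ψ g)
    (he : e ∈ IsManifold.maximalAtlas 𝓘(ℂ) ω S) :
    ∃ f : ℂ → ℂ, (∀ w ∈ D, DifferentiableAt ℂ f w) ∧ ∀ ζ : ℂ, ζ.re < Real.log r →
      f (g ζ) * deriv g ζ ^ 2 = Complex.exp ζ ^ 2 * φ.coeff e (Complex.exp ζ) := by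
  have : Nonempty (OpenPartialHomeomorph S ℂ) := ⟨e⟩
  choose! Z hZ hZψ using h.exists_chart
  -- The inverse branch `Z w` is chosen separately at each point. Two such branches near the same
  -- point have the identity as transition map, so the pulled-back coefficient is locally
  -- independent of the choice.
  have key : ∀ w ∈ D, ∀ᶠ w' in 𝓝 w, φ.coeff (Z w') w' = φ.coeff (Z w) w' := by
    intro w hw
    have hc : ContinuousAt ψ w := h.continuousOn.continuousAt (h.isOpen.mem_nhds hw)
    filter_upwards [h.isOpen.mem_nhds hw,
      (hc.eventually (hZ w hw).eventually).eventually_nhds, (hZψ w hw).eventually_nhds]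
      with w' h1 h2 h3
    have ht := φ.transform (Z w) (hZ w hw).1 (Z w') (hZ w' h1).1 (ψ w')
      ⟨h2.self_of_nhds.2.1, (hZ w' h1).2.1⟩
    rw [h3.self_of_nhds, (hZψ w' h1).self_of_nhds] at ht
    have hid : (fun u => Z w' ((Z w).symm u)) =ᶠ[𝓝 w'] id := by
      filter_upwards [h2, h3, hZψ w' h1] with u k1 k2 k3
      have : (Z w).symm u = ψ u := by
        rw [← k2, (Z w).left_inv k1.2.1]
        rw [k2]
      rw [this, k3]
      rfl
    rw [hid.deriv_eq, deriv_id, one_pow, mul_one] at ht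
    exact ht.symm
  refine ⟨fun w => φ.coeff (Z w) w, ?_, ?_⟩
  · intro w hw
    have h1 := (φ.notMem_poles_iff (hZ w hw).1 (hZ w hw).2.1).1 (h.mapsTo hw)
    rw [(hZψ w hw).self_of_nhds] at h1
    exact h1.differentiableAt.congr_of_eventuallyEq (key w hw)
  · intro ζ hζ
    have hD := h.mem_domain ζ hζ
    have hz := hZ _ hD
    rw [h.apply_lift ζ hζ] at hz
    have hc : ContinuousAt g ζ := h.continuousOn_lift.continuousAt (mem_nhds hζ)
    have hev : g =ᶠ[𝓝 ζ] fun η => Z (g ζ) (e.symm (Complex.exp η)) := by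
      filter_upwards [hc.eventually (hZψ _ hD), mem_nhds hζ] with η h1 h2
      rw [← h.apply_lift η h2, h1]
    have ht := φ.transform e he (Z (g ζ)) hz.1 (e.symm (Complex.exp ζ)) ⟨h.mem_source hζ, hz.2.1⟩
    have hz0 : Z (g ζ) (e.symm (Complex.exp ζ)) = g ζ := hev.self_of_nhds.symm
    rw [h.right_inv hζ, hz0] at ht
    rw [ht, h.deriv_eq he hζ hz hev]
    ring

/-- Near a double pole of `φ` the lift to the uniformizing covering is injective. -/
lemma injOn [T2Space S] [IsManifold 𝓘(ℂ) ω S] (h : IsUniformizingLift P e r D ψ g)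
    (hD : D = Metric.ball 0 1 ∨ D = univ) (he : e ∈ IsManifold.maximalAtlas 𝓘(ℂ) ω S)
    {p : S} (hpe : p ∈ e.source) (hep : e p = 0) (hp : p ∈ φ.poles) {L : ℂ} (hL : L ≠ 0)
    (hlim : Tendsto (fun u => u ^ 2 * φ.coeff e u) (𝓝[≠] 0) (𝓝 L)) :
    InjOn g {ζ | ζ.re < Real.log r} := by
  refine h.injOn_or_periodic.resolve_right ?_
  rintro ⟨n, hn, hper⟩
  have hh : (0 : ℝ) < n * (2 * Real.pi) := by positivity
  have hper' : ∀ ζ : ℂ, ζ.re < Real.log r →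
      g (ζ + (n * (2 * Real.pi) : ℝ) * Complex.I) = g ζ := by
    intro ζ hζ
    rw [← hper ζ hζ]
    push_cast
    ring_nf
  have hol : ∀ ζ : ℂ, ζ.re < Real.log r → DifferentiableAt ℂ g ζ := fun ζ hζ =>
    (h.analyticAt he hζ).differentiableAt
  have hpU : p ∉ φ.polesᶜ := fun h => h hp
  rcases hD with rfl | rfl
  -- In the disk, leaving every compact subset means `‖g‖ → 1`.
  · have hlt : ∀ ζ : ℂ, ζ.re < Real.log r → ‖g ζ‖ < 1 := fun ζ hζ => by
      simpa using h.mem_domain ζ hζ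
    refine not_tendsto_norm_one_of_periodic hh hol hper' hlt ?_
    refine tendsto_order.2 ⟨fun ρ hρ => ?_, fun ρ hρ => ?_⟩
    · filter_upwards [h.eventually_notMem hpe hep hpU (isCompact_closedBall 0 ρ)
        (Metric.closedBall_subset_ball hρ)] with ζ hζ
      simpa using hζ
    · filter_upwards [eventually_re_lt (Real.log r)] with ζ hζ using (hlt ζ hζ).trans hρ
  -- In the plane, leaving every compact subset means `g → ∞`, while `f(w) dw²`, the pullback of
  -- `φ`, becomes `z² φ(z) dζ²`, whose coefficient tends to `L ≠ 0`.
  · obtain ⟨f, hf, hfg⟩ := h.exists_pullback he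
    refine not_tendsto_cobounded_of_periodic (f := f) (fun w => hf w (mem_univ w)) hh hol hper' hL
      ?_ ?_
    · have h1 := hlim.comp (by simpa using tendsto_exp_mul_comap_re one_pos)
      refine h1.congr' ?_
      filter_upwards [eventually_re_lt (Real.log r)] with ζ hζ
      rw [hfg ζ hζ]
      rfl
    · rw [Metric.cobounded_eq_cocompact, (hasBasis_cocompact).tendsto_right_iff]
      intro K hK
      exact h.eventually_notMem hpe hep hpU hK (subset_univ K)

/-- The Schwarzian derivative of an injective lift tends to zero at the puncture. -/
lemma tendsto_schwarzian (h : IsUniformizingLift P e r D ψ g)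
    (he : e ∈ IsManifold.maximalAtlas 𝓘(ℂ) ω S) (hinj : InjOn g {ζ | ζ.re < Real.log r}) :
    Tendsto (schwarzian g) (comap Complex.re atBot) (𝓝 0) := by
  have hb : ∀ᶠ ζ in comap Complex.re atBot,
      ‖schwarzian g ζ‖ ≤ 66 / (Real.log r - ζ.re) ^ 2 := by
    filter_upwards [eventually_re_lt (Real.log r)] with ζ hζ
    -- The largest disk about `ζ` in the half-plane; its radius tends to infinity at the puncture.
    have hsub : Metric.ball ζ (Real.log r - ζ.re) ⊆ {ζ : ℂ | ζ.re < Real.log r} := by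
      intro η hη
      have h1 := Complex.abs_re_le_norm (η - ζ)
      rw [Metric.mem_ball, dist_eq_norm] at hη
      have h2 := le_abs_self (η - ζ).re
      rw [Complex.sub_re] at h1 h2
      simp only [mem_ofPred_eq]
      linarith
    exact norm_schwarzian_le_of_injOn (sub_pos.2 hζ)
      (fun η hη => (h.analyticAt he (hsub hη)).differentiableAt.differentiableWithinAt)
      (hinj.mono hsub)
  refine squeeze_zero_norm' hb ?_
  have h1 : Tendsto (fun x : ℝ => 66 / (Real.log r - x) ^ 2) atBot (𝓝 0) := by
    refine tendsto_const_nhds.div_atTop ?_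
    refine (tendsto_pow_atTop two_ne_zero).comp ?_
    exact tendsto_atTop_add_const_left _ _ tendsto_neg_atBot_atTop
  exact h1.comp tendsto_comap

/-- In the exponential coordinate, the coefficient of `P + φ` extends holomorphically across a
double pole of `φ`. -/
lemma exists_analyticAt_coeff [T2Space S] [IsManifold 𝓘(ℂ) ω S]
    (h : IsUniformizingLift P e r D ψ g)
    (hD : D = Metric.ball 0 1 ∨ D = univ) (he : e ∈ IsManifold.maximalAtlas 𝓘(ℂ) ω S)
    {p : S} (hpe : p ∈ e.source) (hep : e p = 0) (hp : p ∈ φ.poles) {L : ℂ} (hL : L ≠ 0)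
    (hlim : Tendsto (fun u => u ^ 2 * φ.coeff e u) (𝓝[≠] 0) (𝓝 L)) :
    ∃ B : ℂ → ℂ, AnalyticAt ℂ B 0 ∧ B 0 = L ∧ ∀ ζ : ℂ, ζ.re < Real.log r →
      B (Complex.exp ζ) =
        Complex.exp ζ ^ 2 * φ.coeff e (Complex.exp ζ) - schwarzian g ζ / 2 := by
  set G : ℂ → ℂ := fun ζ =>
    Complex.exp ζ ^ 2 * φ.coeff e (Complex.exp ζ) - schwarzian g ζ / 2 with hG
  have hE : Tendsto Complex.exp (comap Complex.re atBot) (𝓝[≠] 0) := by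
    simpa using tendsto_exp_mul_comap_re one_pos
  have hGlim : Tendsto G (comap Complex.re atBot) (𝓝 L) := by
    have h1 := (hlim.comp hE).sub
      ((h.tendsto_schwarzian he (h.injOn hD he hpe hep hp hL hlim)).div_const 2)
    simpa using h1
  have hGan : ∀ ζ : ℂ, ζ.re < Real.log r → DifferentiableAt ℂ G ζ := by
    intro ζ hζ
    have hU : e.symm (Complex.exp ζ) ∉ φ.poles := by
      rw [← h.apply_lift ζ hζ]
      exact h.mapsTo (h.mem_domain ζ hζ)
    have h1 := (φ.notMem_poles_iff he (h.mem_source hζ)).1 hU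
    rw [h.right_inv hζ] at h1
    have h2 := ((h.analyticAt he hζ).schwarzian (h.deriv_ne_zero he hζ)).differentiableAt
    have h3 : DifferentiableAt ℂ (fun ζ => φ.coeff e (Complex.exp ζ)) ζ :=
      h1.differentiableAt.comp (f := Complex.exp) ζ (by fun_prop)
    exact ((Complex.differentiableAt_exp.pow 2).mul h3).sub (h2.div_const 2)
  -- Period `2πi` makes the extended function one of `exp ζ` itself, and boundedness near the
  -- puncture comes from the limit `L`.
  have hGper : ∀ ζ : ℂ, ζ.re < Real.log r → G (ζ + (2 * Real.pi : ℝ) * Complex.I) = G ζ := by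
    intro ζ hζ
    have h1 : ζ + (2 * Real.pi : ℝ) * Complex.I = ζ + 2 * Real.pi * Complex.I := by push_cast; rfl
    have h2 := shift_mem_halfPlane hζ
    have h3 := Complex.exp_periodic ζ
    rw [h1]
    simp only [hG]
    rw [h3, h.schwarzian_eq_of_exp_eq he h2 hζ h3]
  obtain ⟨B, hB, hGB⟩ := exists_analyticAt_exp_of_periodic (C := ‖L‖ + 1) Real.two_pi_pos hGan hGper
    ((hGlim.norm.eventually_lt_const (lt_add_one _)).mono fun ζ hζ => hζ.le)
  have hexp : ∀ ζ : ℂ, (2 * Real.pi / (2 * Real.pi : ℝ) * ζ : ℂ) = ζ := by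
    intro ζ
    have : (Real.pi : ℂ) ≠ 0 := by exact_mod_cast Real.pi_ne_zero
    push_cast
    field_simp
  simp only [hexp] at hGB
  refine ⟨B, hB, ?_, fun ζ hζ => (hGB ζ hζ).symm⟩
  refine tendsto_nhds_unique
    ((hB.continuousAt.tendsto.mono_left nhdsWithin_le_nhds).comp hE) (hGlim.congr' ?_)
  filter_upwards [eventually_re_lt (Real.log r)] with ζ hζ using hGB ζ hζ

end IsUniformizingLift

/-! ### The Frobenius ratio as a developing map -/

namespace IsFrobeniusPair

variable {B : ℂ → ℂ} {r : ℝ} {a c : ℂ} {X Φ : ℂ → ℂ}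

lemma deriv_ne_zero (h : IsFrobeniusPair B r a c X Φ) {ζ : ℂ} (hζ : ζ.re < Real.log r) :
    deriv Φ ζ ≠ 0 := by
  rw [(h.hasDerivAt ζ hζ).deriv]
  exact inv_ne_zero (pow_ne_zero _ (h.ne_zero ζ hζ))

/-- From `Φ' = X⁻²` the Schwarzian is `-2 X'' / X`. -/
lemma schwarzian_eq (h : IsFrobeniusPair B r a c X Φ) {ζ : ℂ} (hζ : ζ.re < Real.log r) :
    schwarzian Φ ζ = -2 * B (Complex.exp ζ) := by
  have hU := (isOpen_halfPlane (Real.log r)).mem_nhds hζ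
  have e1 : deriv Φ =ᶠ[𝓝 ζ] fun η => (X η ^ 2)⁻¹ := by
    filter_upwards [hU] with η hη using (h.hasDerivAt η hη).deriv
  have e2 : deriv (deriv Φ) =ᶠ[𝓝 ζ] fun η => -2 * deriv X η / X η ^ 3 := by
    filter_upwards [e1.eventuallyEq_nhds, hU] with η h1 h2
    have hX := h.ne_zero η h2
    rw [h1.deriv_eq, (((h.differentiableAt η h2).hasDerivAt.fun_pow 2).fun_inv
      (pow_ne_zero _ hX)).deriv]
    field_simp
    ring
  have e3 : (fun η => deriv (deriv Φ) η / deriv Φ η) =ᶠ[𝓝 ζ] fun η => -2 * deriv X η / X η := by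
    filter_upwards [e1, e2, hU] with η h1 h2 h3
    have hX := h.ne_zero η h3
    rw [h1, h2]
    field_simp
  have hX := h.ne_zero ζ hζ
  have hd := ((h.analyticAt hζ).deriv.differentiableAt.hasDerivAt.const_mul (-2)).fun_div
    (h.differentiableAt ζ hζ).hasDerivAt hX
  have e4 := e3.self_of_nhds
  simp only at e4
  unfold schwarzian
  rw [e3.deriv_eq, e4, hd.deriv, h.deriv_deriv ζ hζ]
  field_simp
  ring

lemma tendsto_logBranch (ζ : ℂ) : Tendsto (logBranch ζ) (𝓝 (Complex.exp ζ)) (𝓝 ζ) := by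
  have := (analyticAt_logBranch ζ).continuousAt.tendsto
  rwa [logBranch_exp_self] at this

lemma analyticAt_branch (h : IsFrobeniusPair B r a c X Φ) {ζ : ℂ} (hζ : ζ.re < Real.log r) :
    AnalyticAt ℂ (fun v => Φ (logBranch ζ v)) (Complex.exp ζ) := by
  have h1 : AnalyticAt ℂ Φ (logBranch ζ (Complex.exp ζ)) := by
    rw [logBranch_exp_self]
    exact h.analyticAt' hζ
  exact h1.comp (analyticAt_logBranch ζ)

lemma deriv_branch_ne_zero (h : IsFrobeniusPair B r a c X Φ) {ζ : ℂ} (hζ : ζ.re < Real.log r) :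
    deriv (fun v => Φ (logBranch ζ v)) (Complex.exp ζ) ≠ 0 := by
  have h1 : HasDerivAt Φ (deriv Φ ζ) (logBranch ζ (Complex.exp ζ)) := by
    rw [logBranch_exp_self]
    exact (h.analyticAt' hζ).differentiableAt.hasDerivAt
  have h2 : HasDerivAt (fun v => Φ (logBranch ζ v)) _ _ :=
    h1.comp _ (eventually_hasDerivAt_logBranch ζ).self_of_nhds
  rw [h2.deriv]
  exact mul_ne_zero (h.deriv_ne_zero hζ) (inv_ne_zero (Complex.exp_ne_zero ζ))

/-- Composition with the logarithm divides the Schwarzian by `v²` and adds `1 / (2 v²)`; halved,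
this last term is the `1/4` in `z² Q = B - 1/4`. -/
lemma eventually_schwarzian_branch (h : IsFrobeniusPair B r a c X Φ) {ζ : ℂ}
    (hζ : ζ.re < Real.log r) :
    ∀ᶠ v in 𝓝 (Complex.exp ζ),
      v ^ 2 * schwarzian (fun v => Φ (logBranch ζ v)) v = -2 * B v + 1 / 2 := by
  have hne : ∀ᶠ v in 𝓝 (Complex.exp ζ), v ≠ 0 :=
    continuousAt_id.eventually_ne (Complex.exp_ne_zero ζ)
  filter_upwards [hne, (tendsto_logBranch ζ).eventually ((isOpen_halfPlane _).mem_nhds hζ),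
    (eventually_hasDerivAt_logBranch ζ).eventually_nhds, eventually_exp_logBranch ζ,
    (analyticAt_logBranch ζ).eventually_analyticAt] with v h1 h2 h3 h4 h5
  have hd : deriv (logBranch ζ) v = v⁻¹ := h3.self_of_nhds.deriv
  rw [schwarzian_comp (f := Φ) (g := logBranch ζ) (h.analyticAt' h2) h5 (h.deriv_ne_zero h2)
    (by rw [hd]; exact inv_ne_zero h1), h.schwarzian_eq h2, h4, hd,
    schwarzian_log h1 h3]
  field_simp

end IsFrobeniusPair

section

variable {S : Type*} [TopologicalSpace S] [ChartedSpace ℂ S]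
  {φ : MeromorphicQuadraticDifferential S} {P : ProjectiveStructure φ.polesᶜ}
  {e : OpenPartialHomeomorph S ℂ} {r : ℝ} {D : Set ℂ} {ψ : ℂ → S} {g : ℂ → ℂ}
  {B : ℂ → ℂ} {a c : ℂ} {X Φ : ℂ → ℂ}

namespace IsUniformizingLift

lemma mono (h : IsUniformizingLift P e r D ψ g) {r' : ℝ} (hr' : 0 < r') (hle : r' ≤ r) :
    IsUniformizingLift P e r' D ψ g := by
  have hlog : ∀ ζ : ℂ, ζ.re < Real.log r' → ζ.re < Real.log r := fun ζ hζ =>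
    hζ.trans_le (Real.log_le_log hr' hle)
  exact ⟨h.1, h.2, h.3, h.4, fun ζ hζ => h.5 ζ (hlog ζ hζ), fun ζ hζ => h.6 ζ (hlog ζ hζ),
    fun ζ hζ => h.7 ζ (hlog ζ hζ), h.8.mono hlog, h.9.imp (fun h' => h'.mono hlog)
      fun ⟨n, hn, h'⟩ => ⟨n, hn, fun ζ hζ => h' ζ (hlog ζ hζ)⟩⟩

/-- `Φ` has the Schwarzian derivative of the charts of `P + φ`. -/
lemma eventually_schwarzian_branch (h : IsUniformizingLift P e r D ψ g)
    (he : e ∈ IsManifold.maximalAtlas 𝓘(ℂ) ω S)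
    (hB : ∀ ζ : ℂ, ζ.re < Real.log r → B (Complex.exp ζ) =
      Complex.exp ζ ^ 2 * φ.coeff e (Complex.exp ζ) - schwarzian g ζ / 2)
    (hF : IsFrobeniusPair B r a c X Φ) {ζ : ℂ} (hζ : ζ.re < Real.log r) :
    ∀ᶠ v in 𝓝 (Complex.exp ζ), ∀ z, P.IsAffineChartAt z (e.symm v) →
      schwarzian (fun v => Φ (logBranch ζ v)) v =
        -2 * φ.coeff e v + schwarzian (fun v => z (e.symm v)) v := by
  filter_upwards [hF.eventually_schwarzian_branch hζ, eventually_exp_logBranch ζ,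
    (IsFrobeniusPair.tendsto_logBranch ζ).eventually ((isOpen_halfPlane _).mem_nhds hζ)]
    with v h1 h2 h3 z hz
  have hv : v ≠ 0 := h2 ▸ Complex.exp_ne_zero _
  have h4 := hB _ h3
  rw [← h2] at hz
  have h5 := h.schwarzian_chart he h3 hz
  rw [h2] at h4 h5
  refine mul_left_cancel₀ (pow_ne_zero 2 hv) ?_
  rw [h1, h4, mul_add, h5]
  ring

lemma exists_mem_addCharts [IsManifold 𝓘(ℂ) ω S] (h : IsUniformizingLift P e r D ψ g)
    (he : e ∈ IsManifold.maximalAtlas 𝓘(ℂ) ω S)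
    (hB : ∀ ζ : ℂ, ζ.re < Real.log r → B (Complex.exp ζ) =
      Complex.exp ζ ^ 2 * φ.coeff e (Complex.exp ζ) - schwarzian g ζ / 2)
    (hF : IsFrobeniusPair B r a c X Φ) {ζ : ℂ} (hζ : ζ.re < Real.log r) :
    ∃ w ∈ P.addCharts φ, e.symm (Complex.exp ζ) ∈ w.source ∧
      ∀ y ∈ w.source, w y = ((Φ (logBranch ζ (e y)) : ℂ) : OnePoint ℂ) := by
  obtain ⟨z, hz, -, -⟩ := h.exists_chart_lift hζ
  exact ProjectiveStructure.exists_mem_addCharts he (h.mem_source hζ) hz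
    (f := fun v => Φ (logBranch ζ v))
    (by rw [h.right_inv hζ]; exact hF.analyticAt_branch hζ)
    (by rw [h.right_inv hζ]; exact hF.deriv_branch_ne_zero hζ)
    (by rw [h.right_inv hζ]; exact h.eventually_schwarzian_branch he hB hF hζ)

/-- The polar differential of `P + φ` in the coordinate `e`. -/
lemma sq_mul_polarCoeff [IsManifold 𝓘(ℂ) ω S] (h : IsUniformizingLift P e r D ψ g)
    (he : e ∈ IsManifold.maximalAtlas 𝓘(ℂ) ω S)
    (hB : ∀ ζ : ℂ, ζ.re < Real.log r → B (Complex.exp ζ) =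
      Complex.exp ζ ^ 2 * φ.coeff e (Complex.exp ζ) - schwarzian g ζ / 2)
    (hF : IsFrobeniusPair B r a c X Φ) {v : ℂ} (hv : 0 < ‖v‖) (hvr : ‖v‖ < r) :
    v ^ 2 * polarCoeff (P.addCharts φ) e v = B v - 1 / 4 := by
  have hv0 : v ≠ 0 := norm_pos_iff.1 hv
  have hexp := Complex.exp_log hv0
  have hζ : (Complex.log v).re < Real.log r := by
    rw [Complex.log_re]
    exact Real.log_lt_log hv hvr
  obtain ⟨w, hw, hxw, hwf⟩ := h.exists_mem_addCharts he hB hF hζ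
  have hex : ∃ w ∈ P.addCharts φ, e.symm v ∈ w.source ∧ w (e.symm v) ≠ OnePoint.infty := by
    rw [hexp] at hxw
    exact ⟨w, hw, hxw, by rw [hwf _ hxw]; exact OnePoint.coe_ne_infty _⟩
  -- The chart picked by `polarCoeff` is arbitrary; `schwarzian_of_mem_addCharts` gives the same
  -- value for all finite ones.
  obtain ⟨h1, h2, h3⟩ := hex.choose_spec
  obtain ⟨z, hz, -, -⟩ := h.exists_chart_lift hζ
  have h4 := h.mem_source hζ
  have h5 := h.right_inv hζ
  have h6 := h.schwarzian_chart he hζ hz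
  have h7 := hB _ hζ
  rw [hexp] at hz h4 h5 h6 h7
  have h8 := ProjectiveStructure.schwarzian_of_mem_addCharts h1 h2 h3 he h4 hz
  rw [h5] at h8
  rw [polarCoeff, dif_pos hex, h8, h7]
  linear_combination -(1 / 2) * h6

lemma isDevelopingMap [IsManifold 𝓘(ℂ) ω S] (h : IsUniformizingLift P e r D ψ g)
    (he : e ∈ IsManifold.maximalAtlas 𝓘(ℂ) ω S)
    (hB : ∀ ζ : ℂ, ζ.re < Real.log r → B (Complex.exp ζ) =
      Complex.exp ζ ^ 2 * φ.coeff e (Complex.exp ζ) - schwarzian g ζ / 2)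
    (hF : IsFrobeniusPair B r a c X Φ) :
    IsDevelopingMap (P.addCharts φ) e r (fun ζ => ((Φ ζ.1 : ℂ) : OnePoint ℂ)) := by
  intro ζ₀
  obtain ⟨w, hw, hxw, hwf⟩ := h.exists_mem_addCharts he hB hF ζ₀.2
  refine ⟨w, hw, hxw, (PuncturedDiskCover.eventually_nhds (p := fun η =>
    ((Φ η : ℂ) : OnePoint ℂ) = w (e.symm (Complex.exp η)))).2 ?_⟩
  have hc : ContinuousAt (fun η => e.symm (Complex.exp η)) ζ₀.1 :=
    ContinuousAt.comp (g := e.symm) (e.symm.continuousAt (h.mem_target _ ζ₀.2)) (by fun_prop)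
  filter_upwards [hc.eventually (w.open_source.mem_nhds hxw), eventually_logBranch_exp ζ₀.1,
    mem_nhds ζ₀.2] with η h1 h2 h3
  rw [hwf _ h1, h.right_inv h3, h2]

lemma eventually_eq_smul_of_isDevelopingMap (h : IsUniformizingLift P e r D ψ g)
    (he : e ∈ IsManifold.maximalAtlas 𝓘(ℂ) ω S)
    (hB : ∀ ζ : ℂ, ζ.re < Real.log r → B (Complex.exp ζ) =
      Complex.exp ζ ^ 2 * φ.coeff e (Complex.exp ζ) - schwarzian g ζ / 2)
    (hF : IsFrobeniusPair B r a c X Φ) {F : PuncturedDiskCover r → OnePoint ℂ}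
    (hdev : IsDevelopingMap (P.addCharts φ) e r F) (ζ₀ : PuncturedDiskCover r) :
    ∃ N : GL (Fin 2) ℂ, ∀ᶠ ζ in 𝓝 ζ₀, F ζ = N • ((Φ ζ.1 : ℂ) : OnePoint ℂ) := by
  obtain ⟨w, hw, hxw, hFw⟩ := hdev ζ₀
  obtain ⟨N, hN⟩ := ProjectiveStructure.exists_smul_of_mem_addCharts hw hxw he
    (h.mem_source ζ₀.2) (f := fun v => Φ (logBranch ζ₀.1 v))
    (by rw [h.right_inv ζ₀.2]; exact hF.analyticAt_branch ζ₀.2)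
    (by rw [h.right_inv ζ₀.2]; exact hF.deriv_branch_ne_zero ζ₀.2)
    (by rw [h.right_inv ζ₀.2]; exact h.eventually_schwarzian_branch he hB hF ζ₀.2)
  have hc : ContinuousAt (fun η => e.symm (Complex.exp η)) ζ₀.1 :=
    ContinuousAt.comp (g := e.symm) (e.symm.continuousAt (h.mem_target _ ζ₀.2)) (by fun_prop)
  refine ⟨N, ?_⟩
  filter_upwards [hFw, (PuncturedDiskCover.eventually_nhds (p := fun η =>
    w (e.symm (Complex.exp η)) = N • ((Φ η : ℂ) : OnePoint ℂ))).2 (by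
      filter_upwards [hc.eventually hN, eventually_logBranch_exp ζ₀.1, mem_nhds ζ₀.2]
        with η h1 h2 h3
      rw [h1, h.right_inv h3, h2])] with ζ h1 h2
  rw [h1, h2]

end IsUniformizingLift

end

/-! ### Rigidity of Möbius maps and monodromy of developing maps -/

lemma OnePoint.smul_eq_self_of_infinite {N : GL (Fin 2) ℂ} {T : Set ℂ} (hT : T.Infinite)
    (h : ∀ x ∈ T, N • ((x : ℂ) : OnePoint ℂ) = ((x : ℂ) : OnePoint ℂ)) (y : OnePoint ℂ) :
    N • y = y := by
  -- A polynomial with infinitely many roots vanishes. Its coefficient of degree two is the lower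
  -- left entry of `N`, which settles the point at infinity.
  have h0 : N.fixpointPolynomial = 0 := by
    refine Polynomial.eq_zero_of_infinite_isRoot _ (hT.mono fun x hx => ?_)
    have := Matrix.GeneralLinearGroup.fixpointPolynomial_aeval_eq_zero_iff.2 (h x hx)
    rwa [Polynomial.coe_aeval_eq_eval] at this
  cases y with
  | infty =>
    rw [OnePoint.smul_infty_eq_self_iff]
    simpa [Matrix.GeneralLinearGroup.fixpointPolynomial] using
      congr_arg (fun q => Polynomial.coeff q 2) h0
  | coe c =>
    rw [← Matrix.GeneralLinearGroup.fixpointPolynomial_aeval_eq_zero_iff, h0, map_zero]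

namespace IsFrobeniusPair

variable {B : ℂ → ℂ} {r : ℝ} {a c : ℂ} {X Φ : ℂ → ℂ}

/-- As `Φ' ≠ 0`, the values of `Φ` near a point fill an open set, too many fixed points for a
nontrivial Möbius map. -/
lemma smul_eq_of_eventually (h : IsFrobeniusPair B r a c X Φ) {N N' : GL (Fin 2) ℂ}
    {ζ : PuncturedDiskCover r}
    (hN : ∀ᶠ η in 𝓝 ζ, N • ((Φ η.1 : ℂ) : OnePoint ℂ) = N' • ((Φ η.1 : ℂ) : OnePoint ℂ))
    (y : OnePoint ℂ) : N • y = N' • y := by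
  have h1 := (PuncturedDiskCover.eventually_nhds (p := fun η =>
    N • ((Φ η : ℂ) : OnePoint ℂ) = N' • ((Φ η : ℂ) : OnePoint ℂ))).1 hN
  have h2 : map Φ (𝓝 ζ.1) = 𝓝 (Φ ζ.1) :=
    (h.analyticAt' ζ.2).hasStrictDerivAt.map_nhds_eq (h.deriv_ne_zero ζ.2)
  have h3 : {x : ℂ | (N'⁻¹ * N) • ((x : ℂ) : OnePoint ℂ) = ((x : ℂ) : OnePoint ℂ)} ∈
      𝓝 (Φ ζ.1) := by
    rw [← h2, mem_map]
    filter_upwards [h1] with η hη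
    simp only [mem_preimage, mem_ofPred_eq]
    rw [mul_smul, hη, inv_smul_smul]
  have h4 := OnePoint.smul_eq_self_of_infinite (infinite_of_mem_nhds _ h3) (fun x hx => hx) y
  rw [mul_smul, inv_smul_eq_iff] at h4
  exact h4

/-- A map which is locally a Möbius transform of `Φ` is globally one. -/
lemma exists_eq_smul (h : IsFrobeniusPair B r a c X Φ) {F : PuncturedDiskCover r → OnePoint ℂ}
    (hF : ∀ ζ₀, ∃ N : GL (Fin 2) ℂ, ∀ᶠ ζ in 𝓝 ζ₀, F ζ = N • ((Φ ζ.1 : ℂ) : OnePoint ℂ)) :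
    ∃ N : GL (Fin 2) ℂ, ∀ ζ, F ζ = N • ((Φ ζ.1 : ℂ) : OnePoint ℂ) := by
  obtain ⟨ζ₀⟩ : Nonempty (PuncturedDiskCover r) := inferInstance
  obtain ⟨N₀, hN₀⟩ := hF ζ₀
  refine ⟨N₀, ?_⟩
  set T : Set (PuncturedDiskCover r) :=
    {ζ | ∀ᶠ η in 𝓝 ζ, F η = N₀ • ((Φ η.1 : ℂ) : OnePoint ℂ)} with hT
  have hopen : IsOpen T := isOpen_setOfPred_eventually_nhds
  have hclosed : IsClosed T := by
    refine isClosed_of_closure_subset fun ζ hζ => ?_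
    obtain ⟨N, hN⟩ := hF ζ
    obtain ⟨η, hη, hηT⟩ := mem_closure_iff_nhds.1 hζ _ hN.eventually_nhds
    have hη' : ∀ᶠ η in 𝓝 η, F η = N • ((Φ η.1 : ℂ) : OnePoint ℂ) := hη
    have hηT' : ∀ᶠ η in 𝓝 η, F η = N₀ • ((Φ η.1 : ℂ) : OnePoint ℂ) := hηT
    have key := h.smul_eq_of_eventually (N := N) (N' := N₀) (ζ := η) (by
      filter_upwards [hη', hηT'] with η' k1 k2
      rw [← k1, k2])
    simp only [hT, mem_ofPred_eq]
    filter_upwards [hN] with η' k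
    rw [k, key]
  have huniv : T = univ := IsClopen.eq_univ ⟨hclosed, hopen⟩ ⟨ζ₀, hN₀⟩
  intro ζ
  have : ζ ∈ T := huniv ▸ mem_univ ζ
  exact Eventually.self_of_nhds (p := fun η => F η = N₀ • ((Φ η.1 : ℂ) : OnePoint ℂ)) this

/-- The monodromy of `Φ`. -/
lemma exists_smul_shift (h : IsFrobeniusPair B r a c X Φ) :
    ∃ M : GL (Fin 2) ℂ, (∀ ζ : PuncturedDiskCover r,
      ((Φ ζ.shift.1 : ℂ) : OnePoint ℂ) = M • ((Φ ζ.1 : ℂ) : OnePoint ℂ)) ∧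
      (M : Matrix (Fin 2) (Fin 2) ℂ).charpoly =
        (Polynomial.X - Polynomial.C (-Complex.exp (2 * Real.pi * Complex.I * a))) *
          (Polynomial.X - Polynomial.C (-Complex.exp (-(2 * Real.pi * Complex.I * a)))) := by
  set μ := Complex.exp (2 * Real.pi * Complex.I * a) with hμ
  set μ' := Complex.exp (-(2 * Real.pi * Complex.I * a)) with hμ'
  have hμ0 : μ ≠ 0 := Complex.exp_ne_zero _
  have hμ0' : μ' ≠ 0 := Complex.exp_ne_zero _
  have hμ2 : μ * Complex.exp (-(4 * Real.pi * Complex.I * a)) = μ' := by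
    rw [hμ, hμ', ← Complex.exp_add]
    congr 1
    ring
  -- The map `x ↦ μ⁻² x + c` determines its matrix only up to a scalar. The scaling by `-μ` gives
  -- determinant one and the same eigenvalues as the monodromy of the linear equation.
  have hdet : (!![-μ', -μ * c; 0, -μ] : Matrix (Fin 2) (Fin 2) ℂ).det ≠ 0 := by
    simp [Matrix.det_fin_two, hμ0, hμ0']
  refine ⟨Matrix.GeneralLinearGroup.mkOfDetNeZero _ hdet, fun ζ => ?_, ?_⟩
  · rw [OnePoint.smul_some_eq_ite]
    have e00 : (Matrix.GeneralLinearGroup.mkOfDetNeZero _ hdet) 0 0 = -μ' := rfl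
    have e01 : (Matrix.GeneralLinearGroup.mkOfDetNeZero _ hdet) 0 1 = -μ * c := rfl
    have e10 : (Matrix.GeneralLinearGroup.mkOfDetNeZero _ hdet) 1 0 = 0 := rfl
    have e11 : (Matrix.GeneralLinearGroup.mkOfDetNeZero _ hdet) 1 1 = -μ := rfl
    rw [e00, e01, e10, e11, zero_mul, zero_add, if_neg (neg_ne_zero.2 hμ0)]
    congr 1
    change Φ (ζ.1 + 2 * Real.pi * Complex.I) = _
    rw [h.shift' ζ.1 ζ.2, eq_div_iff (neg_ne_zero.2 hμ0), ← hμ2]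
    ring
  · change (!![-μ', -μ * c; 0, -μ] : Matrix (Fin 2) (Fin 2) ℂ).charpoly = _
    rw [Matrix.charpoly_fin_two, Matrix.trace_fin_two, Matrix.det_fin_two]
    simp
    ring

end IsFrobeniusPair

/-! ### Assembly at the pole -/

lemma eventually_exp_mem {S : Type*} [TopologicalSpace S] {e : OpenPartialHomeomorph S ℂ} {p : S}
    (hpe : p ∈ e.source) (hep : e p = 0) {U : Set S} (hU : ∀ᶠ x in 𝓝[≠] p, x ∈ U) :
    ∃ r > 0, ∀ ζ : ℂ, ζ.re < Real.log r →
      Complex.exp ζ ∈ e.target ∧ e.symm (Complex.exp ζ) ∈ U := by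
  have h0 : (0 : ℂ) ∈ e.target := hep ▸ e.map_source hpe
  have h1 : Tendsto e.symm (𝓝 0) (𝓝 p) := by
    have := OpenPartialHomeomorph.tendsto_symm_nhds hpe
    rwa [hep] at this
  have h2 : ∀ᶠ v in 𝓝 (0 : ℂ), v ∈ e.target ∧ (v ≠ 0 → e.symm v ∈ U) := by
    filter_upwards [e.open_target.mem_nhds h0, h1.eventually (eventually_nhdsWithin_iff.1 hU)]
      with v k1 k2
    refine ⟨k1, fun hv => k2 fun k3 => hv ?_⟩
    have k3' : e.symm v = p := k3
    rw [← e.right_inv k1, k3', hep]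
  obtain ⟨r, hr, hball⟩ := Metric.eventually_nhds_iff.1 h2
  refine ⟨r, hr, fun ζ hζ => ?_⟩
  have := hball (y := Complex.exp ζ) (by simpa using norm_exp_lt hr hζ)
  exact ⟨this.1, this.2 (Complex.exp_ne_zero ζ)⟩

theorem mainTheorem7 {S : Type*} [TopologicalSpace S] [T2Space S] [CompactSpace S]
    [ConnectedSpace S] [ChartedSpace ℂ S] [IsManifold 𝓘(ℂ) ω S]
    (φ : MeromorphicQuadraticDifferential S) (hφ : φ.IsGMN)
    (P : ProjectiveStructure φ.polesᶜ) (hP : P.IsUniformizing)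
    (p : S) (hp : φ.order p = ((-2 : ℤ) : WithTop ℤ)) (R : ℂ) (hR : φ.IsResidue p R)
    (e : OpenPartialHomeomorph S ℂ) (he : e ∈ IsManifold.maximalAtlas 𝓘(ℂ) ω S)
    (hpe : p ∈ e.source) (hep : e p = 0) :
    ∀ᶠ r : ℝ in 𝓝[>] 0,
      (∃ b : Module.Basis (Fin 2) ℂ (solutionSpace (polarCoeff (P.addCharts φ) e) r),
        (LinearMap.toMatrix b b (monodromy (polarCoeff (P.addCharts φ) e) r)).charpoly =
          (Polynomial.X - Polynomial.C (-Complex.exp (R / 2))) *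
            (Polynomial.X - Polynomial.C (-Complex.exp (-R / 2)))) ∧
      (∃ F : PuncturedDiskCover r → OnePoint ℂ, IsDevelopingMap (P.addCharts φ) e r F) ∧
      ∀ F : PuncturedDiskCover r → OnePoint ℂ, IsDevelopingMap (P.addCharts φ) e r F →
        ∃ M : GL (Fin 2) ℂ,
          (∀ ζ, F ζ.shift = M • F ζ) ∧
          (M : Matrix (Fin 2) (Fin 2) ℂ).charpoly =
            (Polynomial.X - Polynomial.C (-Complex.exp (R / 2))) *
              (Polynomial.X - Polynomial.C (-Complex.exp (-R / 2))) := by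
  obtain ⟨e', he', hpe', hep', s, rfl, hs⟩ := hR
  have hlim := φ.tendsto_of_isResidue he he' hpe hpe' hep' hs
  simp only [hep, sub_zero] at hlim
  have hs0 : s ^ 2 ≠ 0 := φ.leading_coeff_ne_zero hp
    (φ.tendsto_of_isResidue (IsManifold.chart_mem_maximalAtlas p) he' (mem_chart_source ℂ p) hpe'
      hep' hs)
  have hpole : p ∈ φ.poles := by
    change φ.order p < 0
    rw [hp]
    exact WithTop.coe_lt_coe.2 (by norm_num)
  obtain ⟨r₁, hr₁, hexp⟩ := eventually_exp_mem hpe hep (φ.eventually_notMem_poles p)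
  obtain ⟨D, ψ, g, hD, hL⟩ := hP.exists_isUniformizingLift hpe hep (fun h => h hpole) hexp
  obtain ⟨B, hB, hB0, hBg⟩ := hL.exists_analyticAt_coeff hD he hpe hep hpole hs0 hlim
  obtain ⟨r₂, hr₂, a, c, X, Φ, ha, hF⟩ := exists_isFrobeniusPair hB hB0
  -- With `R = 4πi s` one has `R / 2 = 2πi s`; replacing `a = s` by `a = -s` merely exchanges the
  -- two factors.
  have hpoly : (Polynomial.X - Polynomial.C (-Complex.exp (2 * Real.pi * Complex.I * a))) *
      (Polynomial.X - Polynomial.C (-Complex.exp (-(2 * Real.pi * Complex.I * a)))) =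
      (Polynomial.X - Polynomial.C (-Complex.exp (4 * Real.pi * Complex.I * s / 2))) *
        (Polynomial.X - Polynomial.C (-Complex.exp (-(4 * Real.pi * Complex.I * s) / 2))) := by
    have e1 : 4 * Real.pi * Complex.I * s / 2 = 2 * Real.pi * Complex.I * s := by ring
    have e2 : -(4 * Real.pi * Complex.I * s) / 2 = -(2 * Real.pi * Complex.I * s) := by ring
    rw [e1, e2]
    rcases ha with rfl | rfl
    · rfl
    · rw [mul_neg, neg_neg, mul_comm]
  filter_upwards [Ioo_mem_nhdsGT (lt_min hr₁ hr₂)] with r hr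
  have hr0 : 0 < r := hr.1
  have hle₁ : r ≤ r₁ := hr.2.le.trans (min_le_left _ _)
  have hle₂ : r ≤ r₂ := hr.2.le.trans (min_le_right _ _)
  have hL' := hL.mono hr0 hle₁
  have hF' := hF.mono hr0 hle₂
  have hBg' : ∀ ζ : ℂ, ζ.re < Real.log r → B (Complex.exp ζ) =
      Complex.exp ζ ^ 2 * φ.coeff e (Complex.exp ζ) - schwarzian g ζ / 2 := fun ζ hζ =>
    hBg ζ (hζ.trans_le (Real.log_le_log hr0 hle₁))
  rw [← hpoly]
  refine ⟨hF'.exists_basis_monodromy hr0 fun v hv hvr => hL'.sq_mul_polarCoeff he hBg' hF' hv hvr,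
    ⟨_, hL'.isDevelopingMap he hBg' hF'⟩, fun F hFdev => ?_⟩
  obtain ⟨N, hN⟩ := hF'.exists_eq_smul
    (hL'.eventually_eq_smul_of_isDevelopingMap he hBg' hF' hFdev)
  obtain ⟨M, hM, hMpoly⟩ := hF'.exists_smul_shift
  -- If `F = N • Φ` and `Φ` has monodromy `M`, then `F` has the conjugate monodromy, with the same
  -- characteristic polynomial.
  refine ⟨N * M * N⁻¹, fun ζ => ?_, ?_⟩
  · rw [hN, hN ζ, hM, ← mul_smul, ← mul_smul]
    congr 1
    group
  · rw [← hMpoly, Units.val_mul, Units.val_mul, Matrix.coe_units_inv, Matrix.charpoly_units_conj]
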